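/- Notation. For a finite set $\mathcal H$ of positive integers and a prime $p$ let $\Omega_{\mathcal H}(p)$ be the set of residue classes $-h \pmod p$, $h\in\mathcal H$; $\mathcal H$ is admissible if $|\Omega_{\mathcal H}(p)|<p$ for all primes $p$. Put $$\mathfrak S(\mathcal H)=\prod_p\Big(1-\frac{|\Omega_{\mathcal H}(p)|}{p}\Big)\Big(1-\frac1p\Big)^{-|\mathcal H|},\qquad P(n;\mathcal H)=\prod_{h\in\mathcal H}(n+h),$$ $$\Lambda_R(n;\mathcal H,a)=\frac1{a!}\sum_{d\mid P(n;\mathcal H),\ d\le R}\mu(d)\Big(\log\frac Rd\Big)^a ,$$ $\varpi(n)=\log n$ if $n$ is prime and $\varpi(n)=0$ otherwise, and $\vartheta^*(y;a,q)=\sum_{y<n\le 2y,\ n\equiv a\,(\mathrm{mod}\,q)}\varpi(n)$. Lemma 2. Let $k,\ell>0$ be integers. There are constants $C>0$ and $c>0$, depending only on $k$ and $\ell$, with the following property. Let $0<\theta<1$ be such that, for every $A>0$, $$\sum_{q\le x^\theta}\ \sup_{0<y\le x}\ \max_{(a,q)=1}\Big|\vartheta^*(y;a,q)-\frac{y}{\varphi(q)}\Big|\ll_A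 \frac{x}{(\log x)^A}\qquad(x\ge2).$$ Let $N$ tend to infinity, and let $H$ and $R$ be parameters such that $$H\ll\log N\ll\log R\le\log N,\qquad R\le N^{\theta/2}/(\log N)^C .$$ Let $\mathcal H\subseteq[1,H]\cap\mathbb Z$ be admissible with $|\mathcal H|=k$, and let $h\le H$ be a positive integer. Then $\sum_{N<n\le 2N}\varpi(n+h)\,\Lambda_R(n;\mathcal H,k+\ell)^2$ is equal to $$\frac{\mathfrak S(\mathcal H\cup\{h\})}{(k+2\ell)!}\binom{2\ell}{\ell}N(\log R)^{k+2\ell}+O\big(N(\log N)^{k+2\ell-1}(\log\log N)^c\big)\quad\text{if }h\notin\mathcal H,$$ and to $$\frac{\mathfrak S(\mathcal H)}{(k+2\ell+1)!}\binom{2(\ell+1)}{\ell+1}N(\log R)^{k+2\ell+1}+O\big(N(\log N)^{k+2\ell}(\log\log N)^c\big)\quad\text{if }h\in\mathcal H.$$ Here the implied constants, and how large $N$ has to be, depend only on $k$, $\ell$, $\theta$ and the implied constants in $H\ll\log N\ll\log R$; in particular the estimates are uniform in $H$, $R$, $\mathcal H$ and $h$. -/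

import Mathlib

open scoped ENNReal

namespace GMPY

/-- The residue classes `-h mod p` with `h ∈ 𝓗`. -/
def Omega (𝓗 : Finset ℕ) (p : ℕ) : Finset (ZMod p) :=
  𝓗.image (fun h : ℕ => -(h : ZMod p))

/-- `𝓗` is admissible: for every prime `p`, the classes `-h mod p` do not cover all of `ℤ/pℤ`. -/
def Admissible (𝓗 : Finset ℕ) : Prop :=
  ∀ p : ℕ, p.Prime → (Omega 𝓗 p).card < p

/-- `P(n; 𝓗) = ∏_{h ∈ 𝓗} (n + h)`. -/
def tuplePoly (n : ℕ) (𝓗 : Finset ℕ) : ℕ :=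
  ∏ h ∈ 𝓗, (n + h)

/-- `λ_R(d; a) = μ(d) (log (R / d))^a / a!` for `d ≤ R`, and `0` for `d > R`. -/
noncomputable def sieveWeight (R : ℝ) (d a : ℕ) : ℝ :=
  if (d : ℝ) ≤ R then
    1 / (a.factorial : ℝ) * (ArithmeticFunction.moebius d : ℝ) * (Real.log (R / d)) ^ a
  else 0

/-- `Λ_R(n; 𝓗, a)`: the sum of `λ_R(d; a)` over the divisors `d` of `P(n; 𝓗)`. -/
noncomputable def sieveSum (R : ℝ) (n : ℕ) (𝓗 : Finset ℕ) (a : ℕ) : ℝ :=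
  ∑ d ∈ (tuplePoly n 𝓗).divisors, sieveWeight R d a

/-- `ϖ(n) = log n` if `n` is prime, and `0` otherwise. -/
noncomputable def primeLog (n : ℕ) : ℝ :=
  if n.Prime then Real.log n else 0

/-- The factor at `p` of the singular series of `𝓗`. -/
noncomputable def singularFactor (𝓗 : Finset ℕ) (p : ℕ) : ℝ :=
  (1 - ((Omega 𝓗 p).card : ℝ) / p) * ((1 - 1 / (p : ℝ)) ^ 𝓗.card)⁻¹

/-- The singular series `∏_p (1 - |Ω(p)| / p) (1 - 1 / p)^(-|𝓗|)`, over all primes `p`. -/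
noncomputable def singularSeries (𝓗 : Finset ℕ) : ℝ :=
  ∏' p : Nat.Primes, singularFactor 𝓗 (p : ℕ)

theorem one_sub_pow_le {x : ℝ} (h0 : 0 ≤ x) (h1 : x ≤ 1) (k : ℕ) :
    (1 - x) ^ k ≤ 1 - k * x + (k : ℝ) ^ 2 * x ^ 2 := by
  induction k with
  | zero => simp
  | succ k ih =>
    have hk : (0 : ℝ) ≤ k := Nat.cast_nonneg k
    have h2 := mul_le_mul_of_nonneg_right ih (sub_nonneg.2 h1)
    have h3 : 0 ≤ (k : ℝ) ^ 2 * x ^ 3 := by positivity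
    have h4 : 0 ≤ (k : ℝ) * x ^ 2 := by positivity
    rw [pow_succ]
    push_cast
    nlinarith [sq_nonneg x]

theorem omega_card_eq {𝓗 : Finset ℕ} {p : ℕ} (h : ∀ x ∈ 𝓗, x < p) :
    (Omega 𝓗 p).card = 𝓗.card := by
  refine Finset.card_image_of_injOn fun a ha b hb hab => ?_
  have h1 : (a : ZMod p) = b := neg_injective hab
  rw [ZMod.natCast_eq_natCast_iff] at h1
  exact Nat.ModEq.eq_of_lt_of_lt h1 (h a ha) (h b hb)

/-- The product defining the singular series converges absolutely (whether or not `𝓗` is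
admissible), so that `singularSeries` is its true value. -/
theorem multipliable_singularFactor (𝓗 : Finset ℕ) :
    Multipliable fun p : Nat.Primes => singularFactor 𝓗 (p : ℕ) := by
  set k := 𝓗.card with hk
  have hs : Summable fun p : Nat.Primes => (2 ^ k * (k : ℝ) ^ 2) * (1 / ((p : ℕ) : ℝ) ^ 2) :=
    ((Real.summable_one_div_nat_pow.2 one_lt_two).comp_injective
      Nat.Primes.coe_nat_injective).mul_left _
  have hs' : Summable fun p : Nat.Primes => singularFactor 𝓗 (p : ℕ) - 1 := by
    refine hs.of_norm_bounded_eventually ?_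
    refine Set.Finite.subset
      ((Set.finite_le_nat (𝓗.sup id)).preimage Nat.Primes.coe_nat_injective.injOn) ?_
    intro p hp
    by_contra hcon
    apply hp
    have hlt : ∀ x ∈ 𝓗, x < (p : ℕ) := fun x hx =>
      lt_of_le_of_lt (Finset.le_sup (f := id) hx) (not_le.1 hcon)
    have hp2 : (2 : ℝ) ≤ ((p : ℕ) : ℝ) := by exact_mod_cast p.2.two_le
    set x : ℝ := 1 / ((p : ℕ) : ℝ) with hx
    have hx0 : 0 ≤ x := by positivity
    have hx1 : x ≤ 1 / 2 := one_div_le_one_div_of_le (by norm_num) hp2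
    have hlow : 1 - k * x ≤ (1 - x) ^ k := by
      have := one_add_mul_le_pow (a := -x) (by linarith) k
      have e : (1 + -x) = 1 - x := by ring
      rw [e] at this
      linarith
    have hup := one_sub_pow_le hx0 (by linarith) k
    have hhalf : (1 / 2 : ℝ) ^ k ≤ (1 - x) ^ k :=
      pow_le_pow_left₀ (by norm_num) (by linarith) k
    have hpos : 0 < (1 - x) ^ k := lt_of_lt_of_le (by positivity) hhalf
    have hval : singularFactor 𝓗 (p : ℕ) - 1 = ((1 - k * x) - (1 - x) ^ k) * ((1 - x) ^ k)⁻¹ := by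
      rw [singularFactor, omega_card_eq hlt, ← hk, ← hx, sub_mul _ ((1 - x) ^ k),
        mul_inv_cancel₀ hpos.ne']
      congr 3
      rw [hx]
      ring
    have hinv : ((1 - x) ^ k)⁻¹ ≤ 2 ^ k := by
      have h5 := inv_anti₀ (by positivity) hhalf
      simpa using h5
    have hx2 : 1 / ((p : ℕ) : ℝ) ^ 2 = x ^ 2 := by rw [hx]; ring
    change ‖singularFactor 𝓗 (p : ℕ) - 1‖ ≤ 2 ^ k * (k : ℝ) ^ 2 * (1 / ((p : ℕ) : ℝ) ^ 2)
    rw [hval, hx2, norm_mul, Real.norm_eq_abs, Real.norm_eq_abs,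
      abs_of_nonneg (inv_nonneg.2 hpos.le), abs_of_nonpos (by linarith)]
    calc -(1 - k * x - (1 - x) ^ k) * ((1 - x) ^ k)⁻¹
        ≤ ((k : ℝ) ^ 2 * x ^ 2) * 2 ^ k :=
          mul_le_mul (by linarith) hinv (inv_nonneg.2 hpos.le) (by positivity)
      _ = _ := by ring
  have h := Real.multipliable_one_add_of_summable hs'
  simpa using h

/-- `ϑ*(y; a, q)`: the sum of `ϖ(n)` over `y < n ≤ 2y`, `n ≡ a mod q`. -/
noncomputable def thetaStar (y : ℝ) (a q : ℕ) : ℝ :=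
  ∑ n ∈ (Finset.Ioc ⌊y⌋₊ ⌊2 * y⌋₊).filter (fun n => n ≡ a [MOD q]), primeLog n

/-- The supremum of `|ϑ*(y; a, q) - y / φ(q)|` over real `0 < y ≤ x` and over `a` coprime to `q`,
taken in `[0, ∞]`. -/
noncomputable def maxDiscrepancy (x : ℝ) (q : ℕ) : ℝ≥0∞ :=
  ⨆ y ∈ Set.Ioc (0 : ℝ) x, ⨆ a : ℕ, ⨆ _ : a.Coprime q,
    ENNReal.ofReal |thetaStar y a q - y / (q.totient : ℝ)|

/-- The primes have level of distribution `θ`: for every `A > 0`, the sum over `q ≤ x^θ` of the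
maximal discrepancies is `O_A(x / (log x)^A)`. -/
def LevelOfDistribution (θ : ℝ) : Prop :=
  ∀ A : ℝ, 0 < A → ∃ K : ℝ, ∀ x : ℝ, 2 ≤ x →
    ∑ q ∈ Finset.Icc 1 ⌊x ^ θ⌋₊, maxDiscrepancy x q ≤
      ENNReal.ofReal (K * (x / (Real.log x) ^ A))

/-- The sum of `ϖ(n + h) Λ_R(n; 𝓗, a)^2` over integers `N < n ≤ 2N`. -/
noncomputable def twistedSum (N R : ℝ) (𝓗 : Finset ℕ) (h a : ℕ) : ℝ :=
  ∑ n ∈ Finset.Ioc ⌊N⌋₊ ⌊2 * N⌋₊, primeLog (n + h) * (sieveSum R n 𝓗 a) ^ 2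

end GMPY

/-!
The proof is elementary: no zero-free region and no contour integration is used, since the prime
number theorem, with any power of the logarithm saved, is the term `q = 1` of the level of
distribution hypothesis.

Put `𝓖 = insert h 𝓗` and let `κ + 1` be its cardinality. Both cases of the theorem are the same
statement about `𝓖`, with weights of exponent `κ + b`: for `h ∉ 𝓗` one has `(κ, b) = (k, ℓ)`, for `h
∈ 𝓗` one has `(κ, b) = (k - 1, ℓ + 1)`.

*Reduction to a quadratic form.* Expanding the square gives a sum over pairs `d₁, d₂ ≤ R` of the sum
of `ϖ(n + h)` over the `n` with `D ∣ P(n; 𝓗)`, where `D = lcm(d₁, d₂)`. A prime `n + h` exceeds `R`,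
so it lies in an invertible class, and by the Chinese remainder theorem the number of classes of `n`
modulo `D` is `∏_{p ∣ D} (|Ω_𝓖(p)| - 1)`. Dividing by `φ(D)` gives the multiplicative density `g(D)`
with `g(p) = (|Ω_𝓖(p)| - 1) / (p - 1)`, called `localDensity`. As `D ≤ R² ≤ N^θ`, the level of
distribution controls the error once the number of pairs and of classes, a divisor function of `D`,
has been separated from the discrepancy (`sum_sqfreeMul_mul_maxDiscrepancy_le`,
`exists_abs_twistedSum_sub_le`).

*The quadratic form.* It is diagonalized as `∑_m g(m) ∏_{p ∣ m} (1 - g(p)) (∑_{(e, m) = 1} μ(e) g(e)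
(log (R / (m e)))^{κ + b} / (κ + b)!)²` (`sum_sieveWeight_lcm_eq`). In the variable `u = log (R /
m)` the inner sum is a Riesz mean of a multiplicative function that is close to `-κ / p` at primes,
hence equal to `r * α^κ` with `α(n) = μ(n) / n` and `∑ |r(n)| (1 + log n)` at most a power of `log
log N`. That bound is Rankin's trick: only the primes below about `log N` and those dividing `m`
matter, and their contribution to `∑ 1 / p` is `O(log log log N)`. The Riesz mean of order `κ + b`
of `α^κ` is `u^b / b! + O((1 + u)^{b-1})`, so the inner sum is `𝔖_m u^b / b!` up to lower order
(`exists_rieszSum_sqfreeMul_neg`), and `𝔖_m ∏_{p ∣ m} (1 - g(p))` is the singular series of `𝓖`. If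
the latter vanishes all main terms do. Otherwise the outer sum is a Riesz mean of order `2b` of the
multiplicative function with values `g / (1 - g) ≈ κ / p`, compared in the same way with powers of
`1 / n` (`exists_rieszSum_sqfreeMul_pos`), and its Euler product is the inverse of the singular
series; this leaves one factor of the singular series, `binom(2b, b)` and `(log R)^{κ + 2b} / (κ +
2b)!` (`exists_abs_sum_sieveWeight_lcm_sub_le`).

*Powers of `μ(n) / n`.* Put `A(u) = ∑_{n ≤ e^u} μ(n) / n`. From `∑_{n ≤ e^v} Λ(n) / n = v + c +
O(v^{-A})` and the identity `μ log = -μ * Λ`, the hyperbola method improves a bound for `A` by a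
factor `√u`, and iterating it `A` decays faster than any power of `u`
(`exists_abs_rieszSum_moebiusDiv_le`). Since Riesz means of Dirichlet products are convolution
integrals (`rieszSum_mul_succ`) and `A` has integral `1`, an induction on `κ` evaluates the means of
`α^κ` (`exists_abs_rieszSum_moebiusDiv_pow_sub_le`).
-/

namespace GMPY

open Finset ArithmeticFunction MeasureTheory
open scoped Nat

/-! ### Riesz means of arithmetic functions -/

/-- The truncated power `w^a / a!`, extended by `0` to negative `w`. -/
noncomputable def truncPow (a : ℕ) (w : ℝ) : ℝ := if 0 ≤ w then w ^ a / (a ! : ℝ) else 0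

/-- The Riesz mean `∑_{n ≤ e^u} f(n) (u - log n)^a / a!`, in the logarithmic variable `u`. -/
noncomputable def rieszSum (f : ArithmeticFunction ℝ) (a : ℕ) (u : ℝ) : ℝ :=
  ∑ n ∈ Ioc 0 ⌊Real.exp u⌋₊, f n * ((u - Real.log n) ^ a / (a ! : ℝ))

theorem truncPow_nonneg (a : ℕ) (w : ℝ) : 0 ≤ truncPow a w := by
  unfold truncPow; split_ifs <;> positivity

theorem le_floor_exp_iff {n : ℕ} (hn : 0 < n) (u : ℝ) :
    n ≤ ⌊Real.exp u⌋₊ ↔ Real.log n ≤ u := by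
  rw [Nat.le_floor_iff (Real.exp_pos u).le, Real.log_le_iff_le_exp (by exact_mod_cast hn)]

theorem rieszSum_eq_sum_truncPow (f : ArithmeticFunction ℝ) (a : ℕ) {u : ℝ} {N : ℕ}
    (hN : ⌊Real.exp u⌋₊ ≤ N) :
    rieszSum f a u = ∑ n ∈ Ioc 0 N, f n * truncPow a (u - Real.log n) := by
  rw [rieszSum]
  symm
  rw [← sum_subset (Ioc_subset_Ioc_right hN)]
  · refine sum_congr rfl fun n hn => ?_
    rw [mem_Ioc] at hn
    rw [truncPow, if_pos (sub_nonneg.2 ((le_floor_exp_iff hn.1 u).1 hn.2))]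
  · intro n hn hn'
    rw [mem_Ioc] at hn hn'
    have : ¬ n ≤ ⌊Real.exp u⌋₊ := fun h => hn' ⟨hn.1, h⟩
    rw [le_floor_exp_iff hn.1] at this
    rw [truncPow, if_neg (by linarith), mul_zero]

/-- Summing a Dirichlet convolution against a weight. -/
theorem sum_Ioc_mul_weight (f g : ArithmeticFunction ℝ) (F : ℕ → ℝ) (N : ℕ) :
    ∑ n ∈ Ioc 0 N, (f * g) n * F n =
      ∑ d ∈ Ioc 0 N, f d * ∑ e ∈ Ioc 0 (N / d), g e * F (d * e) := by
  have h1 : ∑ n ∈ Ioc 0 N, (f * g) n * F n =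
      ∑ n ∈ Ioc 0 N, ∑ x ∈ Ioc 0 N ×ˢ Ioc 0 N with x.1 * x.2 = n,
        f x.1 * (g x.2 * F (x.1 * x.2)) := by
    refine sum_congr rfl fun n hn => ?_
    simp only [mem_Ioc] at hn
    rw [mul_apply, Nat.divisorsAntidiagonal_eq_prod_filter_of_le hn.1.ne' hn.2, sum_mul]
    refine sum_congr rfl fun x hx => ?_
    rw [(mem_filter.1 hx).2]; ring
  rw [h1]
  simp_rw [sum_filter]
  rw [sum_comm, sum_product]
  refine sum_congr rfl fun d hd => ?_
  rw [mem_Ioc] at hd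
  rw [mul_sum, ← sum_subset (Ioc_subset_Ioc_right (Nat.div_le_self N d))]
  · refine sum_congr rfl fun e he => ?_
    rw [mem_Ioc] at he
    rw [Finset.sum_ite_eq, if_pos]
    have := (Nat.le_div_iff_mul_le hd.1).1 he.2
    exact mem_Ioc.2 ⟨Nat.mul_pos hd.1 he.1, by rwa [mul_comm]⟩
  · intro e he he'
    rw [mem_Ioc] at he he'
    rw [Finset.sum_ite_eq, if_neg]
    intro h
    exact he' ⟨he.1, (Nat.le_div_iff_mul_le hd.1).2 (by rw [mul_comm]; exact (mem_Ioc.1 h).2)⟩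

theorem floor_exp_sub_log {d : ℕ} (hd : 0 < d) (u : ℝ) :
    ⌊Real.exp (u - Real.log d)⌋₊ = ⌊Real.exp u⌋₊ / d := by
  rw [Real.exp_sub, Real.exp_log (by exact_mod_cast hd), Nat.floor_div_natCast]

theorem rieszSum_mul (f g : ArithmeticFunction ℝ) (a : ℕ) (u : ℝ) :
    rieszSum (f * g) a u =
      ∑ d ∈ Ioc 0 ⌊Real.exp u⌋₊, f d * rieszSum g a (u - Real.log d) := by
  rw [rieszSum, sum_Ioc_mul_weight]
  refine sum_congr rfl fun d hd => ?_
  rw [mem_Ioc] at hd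
  rw [rieszSum, floor_exp_sub_log hd.1]
  congr 1
  refine sum_congr rfl fun e he => ?_
  rw [mem_Ioc] at he
  have h1 : (d : ℝ) ≠ 0 := by exact_mod_cast hd.1.ne'
  have h2 : (e : ℝ) ≠ 0 := by exact_mod_cast he.1.ne'
  rw [Nat.cast_mul, Real.log_mul h1 h2, sub_sub]

theorem measurable_truncPow (a : ℕ) : Measurable (truncPow a) := by
  unfold truncPow
  exact Measurable.ite measurableSet_Ici (by fun_prop) measurable_const

theorem measurable_rieszSum (f : ArithmeticFunction ℝ) (a : ℕ) : Measurable (rieszSum f a) := by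
  -- The number of terms depends on `u`, so the sum is written as a limit of sums of fixed length.
  refine measurable_of_tendsto_metrizable
    (f := fun (N : ℕ) u => ∑ n ∈ Ioc 0 N, f n * truncPow a (u - Real.log n)) (fun N => ?_) ?_
  · refine Finset.measurable_sum _ fun n _ => ?_
    exact ((measurable_truncPow a).comp (measurable_id.sub_const _)).const_mul _
  · rw [tendsto_pi_nhds]
    intro u
    refine tendsto_const_nhds.congr' ?_
    filter_upwards [Filter.eventually_ge_atTop ⌊Real.exp u⌋₊] with N hN
    exact rieszSum_eq_sum_truncPow f a hN

theorem abs_rieszSum_le (f : ArithmeticFunction ℝ) (a : ℕ) {u U : ℝ} (hu : 0 ≤ u) (hU : u ≤ U) :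
    |rieszSum f a u| ≤ (∑ n ∈ Ioc 0 ⌊Real.exp U⌋₊, |f n|) * (U ^ a / (a ! : ℝ)) := by
  rw [rieszSum_eq_sum_truncPow f a (Nat.floor_mono (Real.exp_le_exp.2 hU)), sum_mul]
  refine (abs_sum_le_sum_abs _ _).trans (sum_le_sum fun n hn => ?_)
  rw [abs_mul, abs_of_nonneg (truncPow_nonneg _ _)]
  refine mul_le_mul_of_nonneg_left ?_ (abs_nonneg _)
  have hl : 0 ≤ Real.log n := Real.log_natCast_nonneg n
  have hU0 : 0 ≤ U := hu.trans hU
  unfold truncPow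
  split_ifs with h
  · gcongr
    linarith
  · positivity

theorem intervalIntegrable_rieszSum (f : ArithmeticFunction ℝ) (a : ℕ) {U : ℝ} (hU : 0 ≤ U) :
    IntervalIntegrable (rieszSum f a) volume 0 U := by
  rw [intervalIntegrable_iff_integrableOn_Ioc_of_le hU]
  refine Measure.integrableOn_of_bounded (M := (∑ n ∈ Ioc 0 ⌊Real.exp U⌋₊, |f n|) * (U ^ a / (a ! : ℝ))) (by simp)
    (measurable_rieszSum f a).aestronglyMeasurable ?_
  refine (ae_restrict_iff' measurableSet_Ioc).2 (Filter.Eventually.of_forall fun v hv => ?_)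
  exact abs_rieszSum_le f a hv.1.le hv.2

/-- The Laplace convolution of `1_{v ≥ x}` with a truncated power. -/
theorem integral_truncPow_mul (a : ℕ) {x y u : ℝ} (hx : 0 ≤ x) (hy : 0 ≤ y) (hu : 0 ≤ u) :
    ∫ v in (0 : ℝ)..u, truncPow 0 (v - x) * truncPow a (u - v - y) = truncPow (a + 1) (u - x - y) := by
  have key : ∀ v, truncPow 0 (v - x) * truncPow a (u - v - y) =
      (Set.Icc x (u - y)).indicator (fun v => (u - y - v) ^ a / (a ! : ℝ)) v := by
    intro v
    simp only [truncPow, Set.indicator, Set.mem_Icc, sub_nonneg]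
    by_cases h1 : x ≤ v <;> by_cases h2 : v ≤ u - y
    · have : y ≤ u - v := by linarith
      simp [h1, h2, this]; ring
    · have : ¬ y ≤ u - v := by intro h; apply h2; linarith
      simp [h2, this]
    · simp [h1]
    · simp [h1]
  simp_rw [key]
  rw [intervalIntegral.integral_of_le hu, setIntegral_indicator measurableSet_Icc]
  by_cases h : x ≤ u - y
  · have hae : (Set.Ioc 0 u ∩ Set.Icc x (u - y) : Set ℝ) =ᵐ[volume] Set.Ioc x (u - y) := by
      have h2 : (Set.Ioc x (u - y) : Set ℝ) = Set.Ioc 0 u ∩ Set.Ioc x (u - y) := by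
        ext v; simp only [Set.mem_Ioc, Set.mem_inter_iff]; constructor
        · rintro ⟨h1, h2⟩; exact ⟨⟨by linarith, by linarith⟩, h1, h2⟩
        · rintro ⟨-, h⟩; exact h
      rw [h2]
      exact Filter.EventuallyEq.inter (by rfl) Ioc_ae_eq_Icc.symm
    rw [setIntegral_congr_set hae, ← intervalIntegral.integral_of_le h]
    rw [intervalIntegral.integral_div, intervalIntegral.integral_comp_sub_left (fun v => v ^ a),
      integral_pow]
    rw [truncPow, if_pos (by linarith), Nat.factorial_succ]
    push_cast
    have : (a : ℝ) + 1 ≠ 0 := by positivity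
    field_simp
    simp
    ring
  · rw [truncPow, if_neg (by intro h'; apply h; linarith), Set.Icc_eq_empty (by linarith)]
    simp

/-- Raising the order of the Riesz mean of `f * g` by one is a Laplace convolution. -/
theorem rieszSum_mul_succ (f g : ArithmeticFunction ℝ) (a : ℕ) {u : ℝ} (hu : 0 ≤ u) :
    rieszSum (f * g) (a + 1) u = ∫ v in (0 : ℝ)..u, rieszSum f 0 v * rieszSum g a (u - v) := by
  set N := ⌊Real.exp u⌋₊ with hN
  have h1 : ∀ v ∈ Set.Icc 0 u, rieszSum f 0 v * rieszSum g a (u - v) =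
      ∑ d ∈ Ioc 0 N, ∑ e ∈ Ioc 0 N, f d * g e *
        (truncPow 0 (v - Real.log d) * truncPow a (u - v - Real.log e)) := by
    intro v hv
    rw [rieszSum_eq_sum_truncPow f 0 (N := N) (Nat.floor_mono (Real.exp_le_exp.2 hv.2)),
      rieszSum_eq_sum_truncPow g a (N := N)
        (Nat.floor_mono (Real.exp_le_exp.2 (by linarith [hv.1]))), sum_mul_sum]
    exact sum_congr rfl fun d _ => sum_congr rfl fun e _ => by ring
  have hint : ∀ d e : ℕ, IntervalIntegrable (fun v => f d * g e *
        (truncPow 0 (v - Real.log d) * truncPow a (u - v - Real.log e))) volume 0 u := by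
    intro d e
    refine IntervalIntegrable.const_mul ?_ _
    rw [intervalIntegrable_iff_integrableOn_Ioc_of_le hu]
    refine Measure.integrableOn_of_bounded (M := u ^ a / (a ! : ℝ)) (by simp) ?_ ?_
    · refine Measurable.aestronglyMeasurable ?_
      exact ((measurable_truncPow 0).comp (by fun_prop)).mul
        ((measurable_truncPow a).comp (by fun_prop))
    · refine (ae_restrict_iff' measurableSet_Ioc).2 (Filter.Eventually.of_forall fun v hv => ?_)
      rw [Real.norm_eq_abs, abs_of_nonneg (mul_nonneg (truncPow_nonneg _ _) (truncPow_nonneg _ _))]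
      have hl : 0 ≤ Real.log e := Real.log_natCast_nonneg e
      have h3 : truncPow a (u - v - Real.log e) ≤ u ^ a / (a ! : ℝ) := by
        unfold truncPow
        split_ifs
        · gcongr; linarith [hv.1]
        · positivity
      have h4 : truncPow 0 (v - Real.log d) ≤ 1 := by
        unfold truncPow; split_ifs <;> simp
      calc _ ≤ 1 * (u ^ a / (a ! : ℝ)) :=
            mul_le_mul h4 h3 (truncPow_nonneg _ _) zero_le_one
        _ = _ := one_mul _
  rw [intervalIntegral.integral_congr (g := fun v => ∑ d ∈ Ioc 0 N, ∑ e ∈ Ioc 0 N, f d * g e *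
        (truncPow 0 (v - Real.log d) * truncPow a (u - v - Real.log e)))
        (fun v hv => h1 v (by rwa [Set.uIcc_of_le hu] at hv)),
    intervalIntegral.integral_finsetSum fun d _ => ?_]
  swap
  · have h2 := IntervalIntegrable.sum (Ioc 0 N) (fun e _ => hint d e)
    rwa [Finset.sum_fn] at h2
  rw [rieszSum_mul]
  refine sum_congr rfl fun d hd => ?_
  rw [mem_Ioc] at hd
  rw [intervalIntegral.integral_finsetSum fun e _ => hint d e,
    rieszSum_eq_sum_truncPow g (a + 1) (N := N) (Nat.floor_mono (Real.exp_le_exp.2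
      (by linarith [Real.log_natCast_nonneg d]))), mul_sum]
  refine sum_congr rfl fun e he => ?_
  rw [intervalIntegral.integral_const_mul, integral_truncPow_mul a (Real.log_natCast_nonneg d)
    (Real.log_natCast_nonneg e) hu, mul_assoc]

theorem rieszSum_succ (g : ArithmeticFunction ℝ) (a : ℕ) {u : ℝ} (hu : 0 ≤ u) :
    rieszSum g (a + 1) u = ∫ v in (0 : ℝ)..u, rieszSum g a v := by
  have h1 : ∀ v, 0 ≤ v → rieszSum 1 0 v = 1 := by
    intro v hv
    rw [rieszSum, Finset.sum_eq_single 1]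
    · simp
    · intro n _ hn; simp [one_apply_ne hn]
    · intro h
      exfalso; apply h
      rw [mem_Ioc, le_floor_exp_iff one_pos]; simpa using hv
  have h2 : rieszSum g (a + 1) u = rieszSum (1 * g) (a + 1) u := by rw [one_mul]
  rw [h2, rieszSum_mul_succ _ _ _ hu,
    intervalIntegral.integral_congr (g := fun v => rieszSum g a (u - v)),
    intervalIntegral.integral_comp_sub_left (fun v => rieszSum g a v)]
  · simp
  · intro v hv
    rw [Set.uIcc_of_le hu] at hv
    simp [h1 v hv.1]

theorem rieszSum_one (a : ℕ) {u : ℝ} (hu : 0 ≤ u) : rieszSum 1 a u = u ^ a / (a ! : ℝ) := by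
  rw [rieszSum, Finset.sum_eq_single 1]
  · simp
  · intro n _ hn; simp [one_apply_ne hn]
  · intro h
    exfalso; apply h
    rw [mem_Ioc, le_floor_exp_iff one_pos]; simpa using hu

/-! ### The function `1 / n` and its Dirichlet powers -/

/-- The arithmetic function `n ↦ 1 / n`. -/
noncomputable def invArith : ArithmeticFunction ℝ := ⟨fun n => (n : ℝ)⁻¹, by simp⟩

theorem invArith_apply (n : ℕ) : invArith n = (n : ℝ)⁻¹ := rfl

theorem abs_rieszSum_invArith_zero_sub {u : ℝ} (hu : 0 ≤ u) :
    |rieszSum invArith 0 u - u| ≤ 1 := by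
  have h : rieszSum invArith 0 u = (harmonic ⌊Real.exp u⌋₊ : ℝ) := by
    rw [rieszSum, harmonic_eq_sum_Icc]
    push_cast
    exact sum_congr (by ext; simp [Nat.lt_iff_add_one_le]) fun n _ => by simp [invArith_apply]
  have h1 := harmonic_floor_le_one_add_log (Real.exp u) (Real.one_le_exp hu)
  have h2 := log_le_harmonic_floor (Real.exp u) (Real.exp_pos u).le
  rw [Real.log_exp] at h1 h2
  rw [h, abs_le]
  constructor <;> linarith

theorem abs_integral_sub_pow_le {F : ℝ → ℝ} {u C : ℝ} {n m : ℕ} (hu : 0 ≤ u) (hC : 0 ≤ C)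
    (hF : IntervalIntegrable F volume 0 u)
    (h : ∀ v, 0 ≤ v → v ≤ u → |F v - v ^ n / (n ! : ℝ)| ≤ C * (1 + v) ^ m) :
    |(∫ v in (0 : ℝ)..u, F v) - u ^ (n + 1) / ((n + 1)! : ℝ)| ≤ C * (1 + u) ^ (m + 1) := by
  have h1 : ∫ v in (0 : ℝ)..u, v ^ n / (n ! : ℝ) = u ^ (n + 1) / ((n + 1)! : ℝ) := by
    rw [intervalIntegral.integral_div, integral_pow, Nat.factorial_succ]
    push_cast
    have : (n : ℝ) + 1 ≠ 0 := by positivity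
    field_simp
    simp
  rw [← h1, ← intervalIntegral.integral_sub hF
    (Continuous.intervalIntegrable (by fun_prop) _ _)]
  have h2 := intervalIntegral.norm_integral_le_of_norm_le_const (a := 0) (b := u)
    (f := fun v => F v - v ^ n / (n ! : ℝ)) (C := C * (1 + u) ^ m) (fun v hv => by
      rw [Set.uIoc_of_le hu] at hv
      refine (h v hv.1.le hv.2).trans ?_
      have := hv.1.le
      gcongr
      exact hv.2)
  rw [Real.norm_eq_abs, sub_zero, abs_of_nonneg hu] at h2
  refine h2.trans ?_
  rw [pow_succ, ← mul_assoc]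
  gcongr
  linarith

theorem abs_rieszSum_invArith_sub (n : ℕ) {u : ℝ} (hu : 0 ≤ u) :
    |rieszSum invArith n u - u ^ (n + 1) / ((n + 1)! : ℝ)| ≤ (1 + u) ^ n := by
  induction n generalizing u with
  | zero => simpa using abs_rieszSum_invArith_zero_sub hu
  | succ n ih =>
    rw [rieszSum_succ _ _ hu]
    have := abs_integral_sub_pow_le (F := rieszSum invArith n) (n := n + 1) (m := n) hu zero_le_one
      (intervalIntegrable_rieszSum _ _ hu) (fun v hv _ => by simpa using ih hv)
    simpa using this

theorem rieszSum_invArith_zero_le {u : ℝ} (hu : 0 ≤ u) : rieszSum invArith 0 u ≤ 1 + u := by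
  have := (abs_le.1 (abs_rieszSum_invArith_zero_sub hu)).2
  linarith

/-- The Riesz means of the Dirichlet powers of `1 / n`. -/
theorem abs_rieszSum_invArith_pow_sub (κ : ℕ) {a : ℕ} (ha : 1 ≤ a) {u : ℝ} (hu : 0 ≤ u) :
    |rieszSum (invArith ^ κ) a u - u ^ (κ + a) / ((κ + a)! : ℝ)| ≤ κ * (1 + u) ^ (κ + a - 1) := by
  induction κ generalizing u with
  | zero => simp [rieszSum_one a hu]
  | succ κ ih =>
    rw [pow_succ', rieszSum_mul]
    have h1 := abs_rieszSum_invArith_sub (κ + a) hu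
    have h2 : |∑ d ∈ Ioc 0 ⌊Real.exp u⌋₊, invArith d * rieszSum (invArith ^ κ) a (u - Real.log d)
        - rieszSum invArith (κ + a) u| ≤ κ * (1 + u) ^ (κ + a) := by
      rw [rieszSum, ← sum_sub_distrib]
      have h3 : (κ : ℝ) * (1 + u) ^ (κ + a) = (1 + u) * (κ * (1 + u) ^ (κ + a - 1)) := by
        conv_lhs => rw [show κ + a = (κ + a - 1) + 1 by omega, pow_succ]
        ring
      rw [h3]
      refine (abs_sum_le_sum_abs _ _).trans ?_
      refine le_trans ?_ (mul_le_mul_of_nonneg_right (rieszSum_invArith_zero_le hu) (by positivity))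
      rw [rieszSum, sum_mul]
      refine sum_le_sum fun d hd => ?_
      rw [mem_Ioc] at hd
      have hd2 := (le_floor_exp_iff hd.1 u).1 hd.2
      have hl : 0 ≤ Real.log d := Real.log_natCast_nonneg d
      rw [← mul_sub, abs_mul, abs_of_nonneg (by rw [invArith_apply]; positivity)]
      simp only [pow_zero, Nat.factorial_zero, Nat.cast_one, div_one, mul_one]
      refine mul_le_mul_of_nonneg_left ?_ (by rw [invArith_apply]; positivity)
      refine (ih (by linarith)).trans ?_
      have : 0 ≤ 1 + (u - Real.log d) := by linarith
      gcongr
      linarith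
    have h4 : κ + 1 + a = κ + a + 1 := by ring
    rw [h4, Nat.add_sub_cancel]
    push_cast
    have := (abs_sub_le _ _ _).trans (add_le_add h2 h1)
    linarith

theorem pow_sub_pow_le_mul {u y : ℝ} (hy : 0 ≤ y) (h : y ≤ u) (q : ℕ) :
    u ^ q - y ^ q ≤ q * (u - y) * u ^ (q - 1) := by
  induction q with
  | zero => simp
  | succ q ih =>
    have h0 : 0 ≤ u := hy.trans h
    have h1 : y ^ q ≤ u ^ q := pow_le_pow_left₀ hy h q
    have h2 : u * (q * (u - y) * u ^ (q - 1)) = q * (u - y) * u ^ q := by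
      rcases q with _ | q
      · simp
      · rw [Nat.add_sub_cancel, pow_succ]; ring
    have h3 := mul_le_mul_of_nonneg_left ih h0
    have h4 := mul_le_mul_of_nonneg_left h1 (sub_nonneg.2 h)
    rw [h2] at h3
    rw [Nat.add_sub_cancel, pow_succ, pow_succ]
    push_cast
    linarith

/-- If the Riesz means of `β` are asymptotic to `u^q / q!`, those of `r * β` are asymptotic to
`(∑ r(n)) u^q / q!`, provided that `∑ |r(n)| (1 + log n)` converges. -/
theorem abs_rieszSum_mul_sub (r β : ArithmeticFunction ℝ) {a q : ℕ} (hq : 1 ≤ q) {C K : ℝ}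
    (hC : 0 ≤ C)
    (hβ : ∀ u, 0 ≤ u → |rieszSum β a u - u ^ q / (q ! : ℝ)| ≤ C * (1 + u) ^ (q - 1))
    (hs : Summable fun n => |r n| * (1 + Real.log n))
    (hK : ∑' n, |r n| * (1 + Real.log n) ≤ K) {u : ℝ} (hu : 0 ≤ u) :
    |rieszSum (r * β) a u - (∑' n, r n) * (u ^ q / (q ! : ℝ))| ≤
      (C + 1) * K * (1 + u) ^ (q - 1) := by
  set N := ⌊Real.exp u⌋₊ with hN
  have hr : Summable fun n => r n := by
    refine Summable.of_norm_bounded hs fun n => ?_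
    rw [Real.norm_eq_abs]
    exact le_mul_of_one_le_right (abs_nonneg _) (by linarith [Real.log_natCast_nonneg n])
  have hW : rieszSum (r * β) a u =
      ∑' n, if n ∈ Ioc 0 N then r n * rieszSum β a (u - Real.log n) else 0 := by
    rw [rieszSum_mul, tsum_eq_sum (s := Ioc 0 N) (fun n hn => if_neg hn)]
    exact sum_congr rfl fun n hn => (if_pos hn).symm
  have hsW : Summable fun n => if n ∈ Ioc 0 N then r n * rieszSum β a (u - Real.log n) else 0 :=
    summable_of_ne_finset_zero (s := Ioc 0 N) (fun n hn => if_neg hn)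
  rw [hW, ← tsum_mul_right, ← hsW.tsum_sub (hr.mul_right _)]
  have hbd : ∀ n, ‖(if n ∈ Ioc 0 N then r n * rieszSum β a (u - Real.log n) else 0) -
      r n * (u ^ q / (q ! : ℝ))‖ ≤
      |r n| * (1 + Real.log n) * ((C + 1) * (1 + u) ^ (q - 1)) := by
    intro n
    have hl : 0 ≤ Real.log n := Real.log_natCast_nonneg n
    have hfac : (1 : ℝ) ≤ (q ! : ℝ) := by exact_mod_cast Nat.one_le_iff_ne_zero.2 (Nat.factorial_ne_zero q)
    have hqf : (q : ℝ) / (q ! : ℝ) ≤ 1 := by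
      rw [div_le_one (by linarith)]; exact_mod_cast Nat.self_le_factorial q
    have hupow : u ^ (q - 1) ≤ (1 + u) ^ (q - 1) := pow_le_pow_left₀ hu (by linarith) _
    have hpos : 0 ≤ (1 + u) ^ (q - 1) := by positivity
    rw [Real.norm_eq_abs]
    rcases Nat.eq_zero_or_pos n with rfl | hn
    · simp
    split_ifs with h
    · have h2 := (le_floor_exp_iff hn u).1 (mem_Ioc.1 h).2
      rw [← mul_sub, abs_mul, mul_assoc]
      refine mul_le_mul_of_nonneg_left ?_ (abs_nonneg _)
      have h3 := hβ (u - Real.log n) (by linarith)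
      have h4 : C * (1 + (u - Real.log n)) ^ (q - 1) ≤ C * (1 + u) ^ (q - 1) := by
        have : 0 ≤ 1 + (u - Real.log n) := by linarith
        gcongr; linarith
      have h5 : |(u - Real.log n) ^ q / (q ! : ℝ) - u ^ q / (q ! : ℝ)| ≤
          Real.log n * (1 + u) ^ (q - 1) := by
        rw [← sub_div, abs_div, abs_of_pos (show (0 : ℝ) < (q ! : ℝ) by linarith), abs_sub_comm,
          abs_of_nonneg (sub_nonneg.2 (pow_le_pow_left₀ (by linarith) (by linarith) _))]
        have h6 := pow_sub_pow_le_mul (y := u - Real.log n) (by linarith) (by linarith) q (u := u)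
        calc _ ≤ (q * (u - (u - Real.log n)) * u ^ (q - 1)) / (q ! : ℝ) := by gcongr
          _ = (q / (q ! : ℝ)) * (Real.log n * u ^ (q - 1)) := by ring
          _ ≤ 1 * (Real.log n * (1 + u) ^ (q - 1)) := by gcongr
          _ = _ := one_mul _
      have h7 := (abs_sub_le _ _ _).trans (add_le_add (h3.trans h4) h5)
      refine h7.trans ?_
      nlinarith [mul_nonneg hC (mul_nonneg hl hpos)]
    · have h2 : u < Real.log n := by
        rw [← not_le, ← le_floor_exp_iff hn]
        exact fun h' => h (mem_Ioc.2 ⟨hn, h'⟩)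
      rw [zero_sub, abs_neg, abs_mul, mul_assoc]
      refine mul_le_mul_of_nonneg_left ?_ (abs_nonneg _)
      rw [abs_of_nonneg (by positivity)]
      have h8 : u ^ q / (q ! : ℝ) ≤ Real.log n * (1 + u) ^ (q - 1) := by
        calc u ^ q / (q ! : ℝ) ≤ u ^ q := div_le_self (by positivity) hfac
          _ = u * u ^ (q - 1) := by rw [← pow_succ']; congr 1; omega
          _ ≤ _ := by gcongr
      nlinarith [mul_nonneg hC (mul_nonneg hl hpos), mul_nonneg hC hpos]
  refine (tsum_of_norm_bounded (hs.mul_right _).hasSum hbd).trans ?_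
  rw [tsum_mul_right]
  have : 0 ≤ (C + 1) * (1 + u) ^ (q - 1) := by positivity
  calc _ ≤ K * ((C + 1) * (1 + u) ^ (q - 1)) := by gcongr
    _ = _ := by ring

/-! ### The prime number theorem from the level of distribution -/

theorem thetaStar_one (y : ℝ) (hy : 0 ≤ y) :
    thetaStar y 1 1 = Chebyshev.theta (2 * y) - Chebyshev.theta y := by
  have h : ⌊y⌋₊ ≤ ⌊2 * y⌋₊ := Nat.floor_mono (by linarith)
  have e : Ioc 0 ⌊2 * y⌋₊ = Ioc 0 ⌊y⌋₊ ∪ Ioc ⌊y⌋₊ ⌊2 * y⌋₊ :=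
    (Ioc_union_Ioc_eq_Ioc (Nat.zero_le _) h).symm
  have hd : Disjoint (Ioc 0 ⌊y⌋₊) (Ioc ⌊y⌋₊ ⌊2 * y⌋₊) := Ioc_disjoint_Ioc_of_le le_rfl
  rw [thetaStar, Chebyshev.theta, Chebyshev.theta, sum_filter, sum_filter, sum_filter, e,
    sum_union hd, add_sub_cancel_left]
  refine sum_congr rfl fun n _ => ?_
  rw [if_pos (Nat.modEq_one), primeLog]

/-- The term `q = 1` of the level of distribution hypothesis: the prime number theorem on dyadic
intervals. -/
theorem abs_theta_two_mul_sub_le {θ : ℝ} (hθ : 0 < θ) (h : LevelOfDistribution θ) {A : ℕ}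
    (hA : 0 < A) :
    ∃ K : ℝ, 0 ≤ K ∧ ∀ x : ℝ, 2 ≤ x →
      |Chebyshev.theta (2 * x) - Chebyshev.theta x - x| ≤ K * (x / Real.log x ^ A) := by
  obtain ⟨K, hK⟩ := h A (by exact_mod_cast hA)
  refine ⟨max K 0, le_max_right _ _, fun x hx => ?_⟩
  have h1 := hK x hx
  have hl : 0 < Real.log x := Real.log_pos (by linarith)
  have h2 : (1 : ℕ) ∈ Icc 1 ⌊x ^ θ⌋₊ := by
    rw [mem_Icc, Nat.le_floor_iff (by positivity)]
    exact ⟨le_rfl, by simpa using Real.one_le_rpow (by linarith) hθ.le⟩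
  have h3 : maxDiscrepancy x 1 ≤ ENNReal.ofReal (K * (x / Real.log x ^ (A : ℝ))) :=
    (single_le_sum (f := fun q => maxDiscrepancy x q) (fun _ _ => zero_le) h2).trans h1
  have h4 : ENNReal.ofReal |thetaStar x 1 1 - x / ((1 : ℕ).totient : ℝ)| ≤ maxDiscrepancy x 1 := by
    unfold maxDiscrepancy
    refine le_iSup₂_of_le x ⟨by linarith, le_rfl⟩ ?_
    exact le_iSup₂_of_le (f := fun (a : ℕ) (_ : a.Coprime 1) =>
      ENNReal.ofReal |thetaStar x a 1 - x / ((1 : ℕ).totient : ℝ)|) 1 (by simp) le_rfl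
  rw [Real.rpow_natCast] at h3
  have h5 := h4.trans (h3.trans (ENNReal.ofReal_le_ofReal
    (mul_le_mul_of_nonneg_right (le_max_left K 0) (by positivity))))
  rw [ENNReal.ofReal_le_ofReal_iff (by positivity), thetaStar_one x (by linarith)] at h5
  simpa using h5

/-- The prime number theorem, by summing over dyadic intervals. -/
theorem abs_theta_sub_le {θ : ℝ} (hθ : 0 < θ) (h : LevelOfDistribution θ) {A : ℕ}
    (hA : 0 < A) :
    ∃ K : ℝ, 0 ≤ K ∧ ∀ x : ℝ, 2 ≤ x →
      |Chebyshev.theta x - x| ≤ K * (x / Real.log x ^ A) := by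
  obtain ⟨K, hK0, hK⟩ := abs_theta_two_mul_sub_le hθ h hA
  -- Beyond some `x₀` halving `x` changes `(log x)^A` by a factor at most `3 / 2`.
  obtain ⟨x₀, hx₀4, hx₀⟩ : ∃ x₀ : ℝ, 2 ≤ x₀ ∧ ∀ y, x₀ ≤ y →
      Real.log (2 * y) ^ A ≤ 3 / 2 * Real.log y ^ A := by
    have h1 : Filter.Tendsto (fun y : ℝ => (Real.log 2 / Real.log y + 1) ^ A) Filter.atTop
        (nhds ((0 + 1) ^ A)) :=
      ((Filter.Tendsto.const_div_atTop Real.tendsto_log_atTop _).add_const 1).pow A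
    have h2 := h1.eventually_le_const (u := 3 / 2) (by norm_num)
    obtain ⟨x₀, hx₀⟩ := Filter.eventually_atTop.1 (h2.and (Filter.eventually_ge_atTop 2))
    refine ⟨max x₀ 2, le_max_right _ _, fun y hy => ?_⟩
    have h3 := (hx₀ y ((le_max_left _ _).trans hy)).1
    have hy2 := (le_max_right x₀ 2).trans hy
    have hl : 0 < Real.log y := Real.log_pos (by linarith)
    rw [Real.log_mul two_ne_zero (by linarith)]
    calc _ = (Real.log 2 / Real.log y + 1) ^ A * Real.log y ^ A := by
          rw [← mul_pow]; congr 1; field_simp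
      _ ≤ _ := by gcongr
  -- The first entry absorbs `K` at each halving, the second covers the range `x ≤ 2 x₀`.
  set K' := max (3 * K) (3 * Real.log (2 * x₀) ^ A) with hK'
  have hK'1 : 3 * K ≤ K' := le_max_left _ _
  have hK'0 : 0 ≤ K' := by linarith
  have hind : ∀ n : ℕ, ∀ x : ℝ, 2 ≤ x → x ≤ 2 ^ n * (2 * x₀) →
      |Chebyshev.theta x - x| ≤ K' * (x / Real.log x ^ A) := by
    intro n
    induction n with
    | zero =>
      intro x hx hxn
      have hl : 0 < Real.log x := Real.log_pos (by linarith)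
      have h1 : |Chebyshev.theta x - x| ≤ 3 * x := by
        have h2 := Chebyshev.theta_le_log4_mul_x (x := x) (by linarith)
        have h3 := Chebyshev.theta_nonneg x
        have h4 : Real.log 4 ≤ 2 := by
          rw [show (4 : ℝ) = 2 ^ 2 by norm_num, Real.log_pow]
          push_cast
          linarith [Real.log_two_lt_d9]
        rw [abs_le]
        constructor
        · linarith
        · nlinarith
      refine h1.trans ?_
      have h5 : Real.log x ^ A ≤ Real.log (2 * x₀) ^ A := by
        gcongr
        simpa using hxn
      calc 3 * x = 3 * Real.log x ^ A * (x / Real.log x ^ A) := by field_simp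
        _ ≤ K' * (x / Real.log x ^ A) := by
          refine mul_le_mul_of_nonneg_right ?_ (by positivity)
          exact le_trans (by linarith) (le_max_right _ _)
    | succ n ih =>
      intro x hx hxn
      rcases le_or_gt x (2 * x₀) with hlt | hgt
      · refine ih x hx (hlt.trans ?_)
        have : (1 : ℝ) ≤ 2 ^ n := one_le_pow₀ (by norm_num)
        nlinarith
      · set y := x / 2 with hy
        have hxy : x = 2 * y := by rw [hy]; ring
        have hyx : x₀ ≤ y := by linarith
        have h1 := ih y (by linarith) (by rw [pow_succ] at hxn; linarith)
        have h2 := hK y (by linarith)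
        have hl : 0 < Real.log y := Real.log_pos (by linarith)
        have hl2 : 0 < Real.log (2 * y) := Real.log_pos (by linarith)
        have h3 := hx₀ y hyx
        rw [hxy]
        have h4 : |Chebyshev.theta (2 * y) - 2 * y| ≤ (K' + K) * (y / Real.log y ^ A) := by
          have : Chebyshev.theta (2 * y) - 2 * y = (Chebyshev.theta y - y) +
            (Chebyshev.theta (2 * y) - Chebyshev.theta y - y) := by ring
          rw [this]
          refine (abs_add_le _ _).trans ?_
          linarith
        refine h4.trans ?_
        have h5 : y / Real.log y ^ A ≤ 3 / 2 * (y / Real.log (2 * y) ^ A) := by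
          rw [div_le_iff₀ (by positivity)]
          have h6 : 3 / 2 * (y / Real.log (2 * y) ^ A) * Real.log y ^ A =
            (y / Real.log (2 * y) ^ A) * (3 / 2 * Real.log y ^ A) := by ring
          rw [h6]
          calc y = (y / Real.log (2 * y) ^ A) * Real.log (2 * y) ^ A :=
                (div_mul_cancel₀ _ (pow_pos hl2 A).ne').symm
            _ ≤ _ := by gcongr
        calc (K' + K) * (y / Real.log y ^ A) ≤ (K' + K) * (3 / 2 * (y / Real.log (2 * y) ^ A)) := by
              gcongr
          _ = ((K' + K) * (3 / 2)) * (y / Real.log (2 * y) ^ A) := by ring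
          _ ≤ (K' * 2) * (y / Real.log (2 * y) ^ A) :=
              mul_le_mul_of_nonneg_right (by linarith) (by positivity)
          _ = _ := by ring
  refine ⟨K', hK'0, fun x hx => ?_⟩
  obtain ⟨n, hn⟩ := pow_unbounded_of_one_lt x (by norm_num : (1 : ℝ) < 2)
  refine hind n x hx (hn.le.trans ?_)
  have : (0 : ℝ) < 2 ^ n := by positivity
  nlinarith

/-- The prime number theorem with an arbitrary power of the logarithm saved, in the variable
`v = log x`. -/
theorem abs_psi_exp_sub_le {θ : ℝ} (hθ : 0 < θ) (h : LevelOfDistribution θ) {A : ℕ}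
    (hA : 0 < A) :
    ∃ K : ℝ, 0 ≤ K ∧ ∀ v : ℝ, 0 ≤ v →
      |Chebyshev.psi (Real.exp v) * Real.exp (-v) - 1| ≤ K / (1 + v) ^ A := by
  obtain ⟨K, hK0, hK⟩ := abs_theta_sub_le hθ h hA
  obtain ⟨C, hC⟩ := Chebyshev.psi_sub_theta_le_mul_sqrt
  -- `(1 + v)^A` is dominated by `e^{v/2}`.
  have hexp : ∀ v : ℝ, 0 ≤ v → (1 + v) ^ A * Real.exp (-(v / 2)) ≤ 2 ^ A * (A ! : ℝ) * Real.exp 1 := by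
    intro v hv
    have h1 := Real.pow_div_factorial_le_exp ((1 + v) / 2) (by linarith) A
    rw [div_le_iff₀ (by positivity)] at h1
    have h2 : (1 + v) ^ A = 2 ^ A * ((1 + v) / 2) ^ A := by rw [← mul_pow]; congr 1; ring
    have h3 : Real.exp ((1 + v) / 2) * Real.exp (-(v / 2)) ≤ Real.exp 1 := by
      rw [← Real.exp_add]; apply Real.exp_le_exp.2; linarith
    calc _ = 2 ^ A * (((1 + v) / 2) ^ A * Real.exp (-(v / 2))) := by rw [h2]; ring
      _ ≤ 2 ^ A * ((Real.exp ((1 + v) / 2) * (A ! : ℝ)) * Real.exp (-(v / 2))) := by gcongr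
      _ = 2 ^ A * (A ! : ℝ) * (Real.exp ((1 + v) / 2) * Real.exp (-(v / 2))) := by ring
      _ ≤ _ := by gcongr
  set B := 2 ^ A * (A ! : ℝ) * Real.exp 1 with hB
  have hB0 : 0 ≤ B := by positivity
  refine ⟨3 ^ A * K + |C| * B + 7 * 2 ^ A, by positivity, fun v hv => ?_⟩
  have hee : Real.exp v * Real.exp (-v) = 1 := by rw [← Real.exp_add]; simp
  rw [le_div_iff₀ (by positivity)]
  rcases le_or_gt 1 v with hv1 | hv1
  · have hx2 : 2 ≤ Real.exp v := by
      have := Real.add_one_le_exp v; linarith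
    have h1 := hK (Real.exp v) hx2
    rw [Real.log_exp] at h1
    have h2 := hC (Real.exp v)
    have h2' : |Chebyshev.psi (Real.exp v) - Chebyshev.theta (Real.exp v)| ≤ |C| * √(Real.exp v) := by
      rw [abs_of_nonneg (sub_nonneg.2 (Chebyshev.theta_le_psi _))]
      exact h2.trans (mul_le_mul_of_nonneg_right (le_abs_self C) (Real.sqrt_nonneg _))
    have h3 : |Chebyshev.psi (Real.exp v) - Real.exp v| ≤
        |C| * √(Real.exp v) + K * (Real.exp v / v ^ A) :=
      (abs_sub_le _ _ _).trans (add_le_add h2' h1)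
    have h4 : Chebyshev.psi (Real.exp v) * Real.exp (-v) - 1 =
        (Chebyshev.psi (Real.exp v) - Real.exp v) * Real.exp (-v) := by rw [sub_mul, hee]
    rw [h4, abs_mul, abs_of_pos (Real.exp_pos _)]
    have h5 : √(Real.exp v) * Real.exp (-v) = Real.exp (-(v / 2)) := by
      rw [Real.sqrt_eq_rpow, ← Real.exp_mul, ← Real.exp_add]; congr 1; ring
    have h6 : (1 + v) ^ A / v ^ A ≤ 3 ^ A := by
      rw [← div_pow]
      refine pow_le_pow_left₀ (by positivity) ?_ A
      rw [div_le_iff₀ (by linarith)]; linarith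
    calc _ ≤ (|C| * √(Real.exp v) + K * (Real.exp v / v ^ A)) * Real.exp (-v) * (1 + v) ^ A := by
          gcongr
      _ = |C| * ((1 + v) ^ A * (√(Real.exp v) * Real.exp (-v))) +
          K * ((1 + v) ^ A / v ^ A) * (Real.exp v * Real.exp (-v)) := by ring
      _ = |C| * ((1 + v) ^ A * Real.exp (-(v / 2))) + K * ((1 + v) ^ A / v ^ A) := by
          rw [h5, hee, mul_one]
      _ ≤ |C| * B + K * 3 ^ A := by gcongr; exact hexp v hv
      _ ≤ _ := by
        have : (0 : ℝ) ≤ 7 * 2 ^ A := by positivity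
        linarith
  · have h1 : |Chebyshev.psi (Real.exp v) * Real.exp (-v) - 1| ≤ 7 := by
      have h2 := Chebyshev.psi_le_const_mul_self (x := Real.exp v) (Real.exp_pos v).le
      have h3 := Chebyshev.psi_nonneg (Real.exp v)
      have h4 : Real.log 4 ≤ 2 := by
        rw [show (4 : ℝ) = 2 ^ 2 by norm_num, Real.log_pow]
        push_cast
        linarith [Real.log_two_lt_d9]
      have h5 : Chebyshev.psi (Real.exp v) * Real.exp (-v) ≤ (Real.log 4 + 4) := by
        calc _ ≤ (Real.log 4 + 4) * Real.exp v * Real.exp (-v) := by gcongr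
          _ = _ := by rw [mul_assoc, hee, mul_one]
      have h6 : 0 ≤ Chebyshev.psi (Real.exp v) * Real.exp (-v) := by positivity
      rw [abs_le]; constructor <;> linarith
    have h7 : (1 + v) ^ A ≤ 2 ^ A := pow_le_pow_left₀ (by linarith) (by linarith) A
    have h8 : 0 ≤ 3 ^ A * K + |C| * B := by positivity
    refine (mul_le_mul h1 h7 (by positivity) (by norm_num)).trans ?_
    linarith

/-! ### Sums of `Λ(n) / n` -/

/-- The arithmetic function `n ↦ f(n) / n`. -/
noncomputable def divId (f : ArithmeticFunction ℝ) : ArithmeticFunction ℝ :=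
  ⟨fun n => f n / n, by simp⟩

theorem divId_apply (f : ArithmeticFunction ℝ) (n : ℕ) : divId f n = f n / n := rfl

theorem divId_mul (f g : ArithmeticFunction ℝ) : divId (f * g) = divId f * divId g := by
  ext n
  rw [divId_apply, mul_apply, mul_apply, sum_div]
  refine sum_congr rfl fun x hx => ?_
  rw [divId_apply, divId_apply, ← (Nat.mem_divisorsAntidiagonal.1 hx).1]
  push_cast
  rw [mul_div_mul_comm]

theorem divId_one : divId 1 = 1 := by
  ext n
  rw [divId_apply]
  by_cases h : n = 1
  · simp [h]
  · simp [one_apply_ne h]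

theorem integral_truncPow_zero_mul {F : ℝ → ℝ} {l v : ℝ} (hl : 0 ≤ l) (hv : l ≤ v) :
    ∫ w in (0 : ℝ)..v, truncPow 0 (w - l) * F w = ∫ w in l..v, F w := by
  have key : ∀ w, truncPow 0 (w - l) * F w = (Set.Ici l).indicator F w := by
    intro w
    by_cases h : l ≤ w <;> simp [truncPow, Set.indicator, h]
  simp_rw [key]
  rw [intervalIntegral.integral_of_le (hl.trans hv), setIntegral_indicator measurableSet_Ici,
    intervalIntegral.integral_of_le hv]
  refine setIntegral_congr_set ?_
  have h2 : (Set.Ioc l v : Set ℝ) = Set.Ioc 0 v ∩ Set.Ioi l := by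
    ext w; simp only [Set.mem_Ioc, Set.mem_inter_iff, Set.mem_Ioi]; constructor
    · rintro ⟨h1, h2⟩; exact ⟨⟨by linarith, by linarith⟩, h1⟩
    · rintro ⟨⟨-, h⟩, h'⟩; exact ⟨h', h⟩
  rw [h2]
  exact Filter.EventuallyEq.inter (by rfl) Ioi_ae_eq_Ici.symm

theorem rieszSum_vonMangoldt (v : ℝ) : rieszSum vonMangoldt 0 v = Chebyshev.psi (Real.exp v) := by
  simp [rieszSum, Chebyshev.psi]

/-- Partial summation from `ψ` to `∑ Λ(n) / n`. -/
theorem rieszSum_divId_vonMangoldt {v : ℝ} (hv : 0 ≤ v) :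
    rieszSum (divId vonMangoldt) 0 v = Chebyshev.psi (Real.exp v) * Real.exp (-v) +
      ∫ w in (0 : ℝ)..v, Chebyshev.psi (Real.exp w) * Real.exp (-w) := by
  set N := ⌊Real.exp v⌋₊ with hN
  have h1 : ∀ w ∈ Set.uIcc 0 v, Chebyshev.psi (Real.exp w) * Real.exp (-w) =
      ∑ n ∈ Ioc 0 N, vonMangoldt n * (truncPow 0 (w - Real.log n) * Real.exp (-w)) := by
    intro w hw
    rw [Set.uIcc_of_le hv] at hw
    rw [← rieszSum_vonMangoldt, rieszSum_eq_sum_truncPow _ 0 (N := N)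
      (Nat.floor_mono (Real.exp_le_exp.2 hw.2)), sum_mul]
    exact sum_congr rfl fun n _ => by ring
  rw [intervalIntegral.integral_congr h1, intervalIntegral.integral_finsetSum]
  · rw [← rieszSum_vonMangoldt, rieszSum, rieszSum, sum_mul, ← sum_add_distrib]
    refine sum_congr rfl fun n hn => ?_
    rw [mem_Ioc] at hn
    rw [intervalIntegral.integral_const_mul, integral_truncPow_zero_mul
      (Real.log_natCast_nonneg n) ((le_floor_exp_iff hn.1 v).1 hn.2), intervalIntegral.integral_comp_neg
      (fun x => Real.exp x), integral_exp, Real.exp_neg (Real.log n),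
      Real.exp_log (by exact_mod_cast hn.1), divId_apply]
    simp
    ring
  · intro n _
    refine IntervalIntegrable.const_mul ?_ _
    refine IntervalIntegrable.mul_continuousOn ?_ (by fun_prop)
    rw [intervalIntegrable_iff_integrableOn_Ioc_of_le hv]
    refine Measure.integrableOn_of_bounded (M := 1) (by simp) ?_ ?_
    · exact ((measurable_truncPow 0).comp (by fun_prop)).aestronglyMeasurable
    · refine Filter.Eventually.of_forall fun w => ?_
      unfold truncPow; split_ifs <;> simp

/-- Mertens' theorem for `∑ Λ(n) / n`, with an arbitrary power of the logarithm saved. -/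
theorem exists_abs_rieszSum_divId_vonMangoldt_sub_le {θ : ℝ} (hθ : 0 < θ)
    (h : LevelOfDistribution θ) (A : ℕ) :
    ∃ c K : ℝ, 0 ≤ K ∧ ∀ v : ℝ, 0 ≤ v →
      |rieszSum (divId vonMangoldt) 0 v - v - c| ≤ K / (1 + v) ^ A := by
  -- Two powers more than wanted, so that the error term is integrable.
  obtain ⟨K, hK0, hK⟩ := abs_psi_exp_sub_le hθ h (A := A + 2) (by omega)
  set E : ℝ → ℝ := fun v => Chebyshev.psi (Real.exp v) * Real.exp (-v) - 1 with hE
  have hEm : Measurable E :=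
    ((Chebyshev.psi_mono.measurable.comp Real.measurable_exp).mul (by fun_prop)).sub_const _
  have hdom : IntegrableOn (fun w : ℝ => (w + 1) ^ (-2 : ℝ)) (Set.Ioi 0) :=
    integrableOn_add_rpow_Ioi_of_lt (by norm_num) (by norm_num)
  have hrp : ∀ w : ℝ, 0 ≤ w → (w + 1) ^ (-2 : ℝ) = 1 / (1 + w) ^ 2 := by
    intro w hw
    rw [Real.rpow_neg (by linarith), add_comm]
    norm_num
  set J := ∫ w in Set.Ioi (0 : ℝ), (w + 1) ^ (-2 : ℝ) with hJ
  have hJ0 : 0 ≤ J := setIntegral_nonneg measurableSet_Ioi fun w hw => by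
    have : (0 : ℝ) < w := hw
    positivity
  have hEb : ∀ v w : ℝ, 0 ≤ v → v ≤ w → |E w| ≤ K / (1 + v) ^ A * (w + 1) ^ (-2 : ℝ) := by
    intro v w hv hvw
    have h2 : (1 + v) ^ A ≤ (1 + w) ^ A := pow_le_pow_left₀ (by linarith) (by linarith) _
    have : (0 : ℝ) ≤ w := hv.trans hvw
    rw [hrp w (hv.trans hvw)]
    refine (hK w (hv.trans hvw)).trans ?_
    calc K / (1 + w) ^ (A + 2) = K / (1 + w) ^ A * (1 / (1 + w) ^ 2) := by
          rw [pow_add]; field_simp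
      _ ≤ _ := by gcongr
  have hEi : IntegrableOn E (Set.Ioi 0) := by
    refine Integrable.mono' (hdom.const_mul K) hEm.aestronglyMeasurable ?_
    refine (ae_restrict_iff' measurableSet_Ioi).2 (Filter.Eventually.of_forall fun w hw => ?_)
    have := hEb 0 w le_rfl (le_of_lt hw)
    simpa using this
  refine ⟨1 + ∫ w in Set.Ioi (0 : ℝ), E w, K + K * J, by positivity, fun v hv => ?_⟩
  have hEv : IntervalIntegrable E volume 0 v := by
    rw [intervalIntegrable_iff_integrableOn_Ioc_of_le hv]
    exact hEi.mono_set Set.Ioc_subset_Ioi_self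
  have h1 : ∫ w in (0 : ℝ)..v, Chebyshev.psi (Real.exp w) * Real.exp (-w) =
      (∫ w in (0 : ℝ)..v, E w) + v := by
    have : ∀ w, Chebyshev.psi (Real.exp w) * Real.exp (-w) = E w + 1 := fun w => by simp [hE]
    simp_rw [this]
    rw [intervalIntegral.integral_add hEv (by simp)]
    simp
  have h2 : (∫ w in (0 : ℝ)..v, E w) + ∫ w in Set.Ioi v, E w = ∫ w in Set.Ioi (0 : ℝ), E w := by
    rw [intervalIntegral.integral_of_le hv, ← setIntegral_union _ measurableSet_Ioi
      (hEi.mono_set Set.Ioc_subset_Ioi_self) (hEi.mono_set (Set.Ioi_subset_Ioi hv)),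
      Set.Ioc_union_Ioi_eq_Ioi hv]
    rw [Set.disjoint_left]
    intro x hx hx'
    exact absurd hx.2 (not_le.2 hx')
  have h3 : rieszSum (divId vonMangoldt) 0 v - v - (1 + ∫ w in Set.Ioi (0 : ℝ), E w) =
      E v - ∫ w in Set.Ioi v, E w := by
    rw [rieszSum_divId_vonMangoldt hv, h1, ← h2]
    simp only [hE]
    ring
  have h4 : |∫ w in Set.Ioi v, E w| ≤ K / (1 + v) ^ A * J := by
    have hd2 := hdom.mono_set (Set.Ioi_subset_Ioi hv)
    have h5 := norm_integral_le_of_norm_le (μ := volume.restrict (Set.Ioi v)) (f := E)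
      (hd2.const_mul (K / (1 + v) ^ A))
      ((ae_restrict_iff' measurableSet_Ioi).2 (Filter.Eventually.of_forall fun w hw =>
        hEb v w hv (le_of_lt hw)))
    rw [integral_const_mul] at h5
    refine h5.trans (mul_le_mul_of_nonneg_left ?_ (by positivity))
    refine setIntegral_mono_set hdom ?_ (Set.Ioi_subset_Ioi hv).eventuallyLE
    refine (ae_restrict_iff' measurableSet_Ioi).2 (Filter.Eventually.of_forall fun w hw => ?_)
    have : (0 : ℝ) < w := hw
    simp only [Pi.zero_apply]
    positivity
  have h6 : |E v| ≤ K / (1 + v) ^ A := by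
    refine (hK v hv).trans ?_
    gcongr
    · linarith
    · omega
  rw [h3]
  calc _ ≤ |E v| + |∫ w in Set.Ioi v, E w| := abs_sub _ _
    _ ≤ K / (1 + v) ^ A + K / (1 + v) ^ A * J := add_le_add h6 h4
    _ = _ := by ring

/-! ### Decay of the sums `∑ μ(n) / n` -/

/-- The arithmetic function `n ↦ μ(n) / n`, the Dirichlet inverse of `n ↦ 1 / n`. -/
noncomputable def moebiusDiv : ArithmeticFunction ℝ :=
  divId (moebius : ArithmeticFunction ℝ)

theorem moebiusDiv_apply (n : ℕ) : moebiusDiv n = (moebius n : ℝ) / n := by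
  simp [moebiusDiv, divId_apply]

theorem abs_moebiusDiv_le (n : ℕ) : |moebiusDiv n| ≤ invArith n := by
  rw [moebiusDiv_apply, invArith_apply, abs_div, Nat.abs_cast, div_eq_mul_inv]
  have h : |(moebius n : ℝ)| ≤ 1 := by exact_mod_cast abs_moebius_le_one (n := n)
  exact mul_le_of_le_one_left (by positivity) h

theorem invArith_eq_divId : invArith = divId (zeta : ArithmeticFunction ℝ) := by
  ext n
  rw [divId_apply, invArith_apply, natCoe_apply, zeta_apply]
  split_ifs with h <;> simp [h]

theorem moebiusDiv_mul_invArith : moebiusDiv * invArith = 1 := by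
  rw [moebiusDiv, invArith_eq_divId, ← divId_mul, coe_moebius_mul_coe_zeta, divId_one]

/-- The identity `μ log = -μ * Λ`, divided by `n`. -/
theorem moebiusDiv_mul_log (n : ℕ) :
    moebiusDiv n * Real.log n = -(moebiusDiv * divId vonMangoldt) n := by
  have h1 : pmul (moebius : ArithmeticFunction ℝ) log * zeta = -vonMangoldt := by
    ext n
    rw [mul_comm, coe_zeta_mul_apply, ArithmeticFunction.neg_apply, ← sum_moebius_mul_log_eq]
    simp [pmul_apply]
  have h2 : pmul (moebius : ArithmeticFunction ℝ) log = -((moebius : ArithmeticFunction ℝ) * vonMangoldt) := by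
    calc _ = pmul (moebius : ArithmeticFunction ℝ) log * zeta * moebius := by
          rw [mul_assoc, coe_zeta_mul_coe_moebius, mul_one]
      _ = _ := by rw [h1, neg_mul, mul_comm]
  have h3 := congrArg (fun f : ArithmeticFunction ℝ => f n / n) h2
  simp only [pmul_apply, ArithmeticFunction.neg_apply, log_apply] at h3
  rw [moebiusDiv, ← divId_mul, divId_apply, divId_apply]
  rw [div_mul_eq_mul_div, h3, neg_div]

/-- `u ∑_{n ≤ e^u} μ(n)/n` in terms of the error in Mertens' theorem at `u - log n`. -/
theorem mul_rieszSum_moebiusDiv (u : ℝ) :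
    u * rieszSum moebiusDiv 0 u = -∑ n ∈ Ioc 0 ⌊Real.exp u⌋₊, moebiusDiv n *
      (rieszSum (divId vonMangoldt) 0 (u - Real.log n) - (u - Real.log n)) := by
  have h1 : ∑ n ∈ Ioc 0 ⌊Real.exp u⌋₊, moebiusDiv n * Real.log n =
      -rieszSum (moebiusDiv * divId vonMangoldt) 0 u := by
    simp_rw [moebiusDiv_mul_log]
    simp [rieszSum]
  rw [rieszSum_mul] at h1
  simp_rw [mul_sub, sum_sub_distrib]
  rw [h1]
  simp [rieszSum, mul_sum, mul_comm]

theorem abs_sum_moebiusDiv_mul_le {u B : ℝ} (hB : 0 ≤ B) (hu : 0 ≤ u) (F : ℕ → ℝ)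
    (hF : ∀ n : ℕ, 0 < n → Real.log n ≤ u → |F n| ≤ B) :
    |∑ n ∈ Ioc 0 ⌊Real.exp u⌋₊, moebiusDiv n * F n| ≤ (1 + u) * B := by
  refine (abs_sum_le_sum_abs _ _).trans ?_
  have h1 := rieszSum_invArith_zero_le hu
  rw [rieszSum] at h1
  simp only [pow_zero, Nat.factorial_zero, Nat.cast_one, div_one, mul_one] at h1
  calc _ ≤ ∑ n ∈ Ioc 0 ⌊Real.exp u⌋₊, invArith n * B := by
        refine sum_le_sum fun n hn => ?_
        rw [mem_Ioc] at hn
        rw [abs_mul]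
        have := hF n hn.1 ((le_floor_exp_iff hn.1 u).1 hn.2)
        have h0 : 0 ≤ invArith n := by rw [invArith_apply]; positivity
        exact mul_le_mul (abs_moebiusDiv_le n) this (abs_nonneg _) h0
    _ ≤ _ := by rw [← sum_mul]; gcongr

/-- The restriction of `f` to arguments exceeding `e^w`. -/
noncomputable def dropInit (f : ArithmeticFunction ℝ) (w : ℝ) : ArithmeticFunction ℝ :=
  ⟨fun n => if ⌊Real.exp w⌋₊ < n then f n else 0, by simp⟩

theorem dropInit_apply (f : ArithmeticFunction ℝ) (w : ℝ) (n : ℕ) :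
    dropInit f w n = if ⌊Real.exp w⌋₊ < n then f n else 0 := rfl

theorem sum_split_dropInit (f : ArithmeticFunction ℝ) (F : ℕ → ℝ) {w u : ℝ} (h : w ≤ u) :
    ∑ n ∈ Ioc 0 ⌊Real.exp u⌋₊, f n * F n = ∑ n ∈ Ioc 0 ⌊Real.exp w⌋₊, f n * F n +
      ∑ n ∈ Ioc 0 ⌊Real.exp u⌋₊, dropInit f w n * F n := by
  have h' := Nat.floor_mono (Real.exp_le_exp.2 h)
  have hd : Disjoint (Ioc 0 ⌊Real.exp w⌋₊) (Ioc ⌊Real.exp w⌋₊ ⌊Real.exp u⌋₊) :=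
    Ioc_disjoint_Ioc_of_le le_rfl
  rw [← Ioc_union_Ioc_eq_Ioc (Nat.zero_le _) h', sum_union hd, sum_union hd]
  congr 1
  have h0 : ∑ n ∈ Ioc 0 ⌊Real.exp w⌋₊, dropInit f w n * F n = 0 := by
    refine sum_eq_zero fun n hn => ?_
    rw [dropInit_apply, if_neg (not_lt.2 (mem_Ioc.1 hn).2), zero_mul]
  rw [h0, zero_add]
  refine sum_congr rfl fun n hn => ?_
  rw [dropInit_apply, if_pos (mem_Ioc.1 hn).1]

theorem rieszSum_dropInit (f : ArithmeticFunction ℝ) {w x : ℝ} (h : w ≤ x) :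
    rieszSum (dropInit f w) 0 x = rieszSum f 0 x - rieszSum f 0 w := by
  have := sum_split_dropInit f (fun _ => 1) h
  simp only [rieszSum, pow_zero, Nat.factorial_zero, Nat.cast_one, div_one]
  rw [this, add_sub_cancel_left]

theorem rieszSum_dropInit_of_le (f : ArithmeticFunction ℝ) {w x : ℝ} (h : x ≤ w) (a : ℕ) :
    rieszSum (dropInit f w) a x = 0 := by
  refine sum_eq_zero fun n hn => ?_
  rw [dropInit_apply, if_neg, zero_mul]
  exact not_lt.2 ((mem_Ioc.1 hn).2.trans (Nat.floor_mono (Real.exp_le_exp.2 h)))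

/-- The hyperbola method applied to `mul_rieszSum_moebiusDiv`: a bound `S` for `∑_{n ≤ e^w} μ(n)/n`
on a window of length `V` below `u` improves at `u` itself by a factor of about `V / u`. -/
theorem mul_abs_rieszSum_moebiusDiv_le {c K : ℝ} {A : ℕ} (hK0 : 0 ≤ K)
    (hK : ∀ v : ℝ, 0 ≤ v → |rieszSum (divId vonMangoldt) 0 v - v - c| ≤ K / (1 + v) ^ A)
    {u V S : ℝ} (hV : 0 ≤ V) (hVu : V ≤ u) (hS0 : 0 ≤ S)
    (hS : ∀ w, u - V ≤ w → w ≤ u → |rieszSum moebiusDiv 0 w| ≤ S) :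
    u * |rieszSum moebiusDiv 0 u| ≤
      (1 + u) * (K / (1 + V) ^ A) + S * (4 * V + 3 * |c| + 2 * K) := by
  have hu : 0 ≤ u := hV.trans hVu
  have hΛ0 : ∀ n, 0 ≤ divId vonMangoldt n := fun n => by
    rw [divId_apply]; exact div_nonneg vonMangoldt_nonneg (Nat.cast_nonneg _)
  have hR : ∀ x, x ≤ u → |rieszSum (dropInit moebiusDiv (u - V)) 0 x| ≤ 2 * S := by
    intro x hx
    rcases le_total x (u - V) with h | h
    · rw [rieszSum_dropInit_of_le _ h]; simpa using hS0
    · rw [rieszSum_dropInit _ h]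
      refine (abs_sub _ _).trans ?_
      have := hS x h hx
      have := hS (u - V) le_rfl (by linarith)
      linarith
  set G : ℕ → ℝ := fun n => rieszSum (divId vonMangoldt) 0 (u - Real.log n) - (u - Real.log n)
    with hG
  have e1 : u * |rieszSum moebiusDiv 0 u| = |∑ n ∈ Ioc 0 ⌊Real.exp u⌋₊, moebiusDiv n * G n| := by
    rw [← abs_of_nonneg hu, ← abs_mul, abs_of_nonneg hu, mul_rieszSum_moebiusDiv, abs_neg]
  -- For `n ≤ e^(u - V)` the argument `u - log n ≥ V` is large, and `G n` is close to `c`.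
  have e2 : ∑ n ∈ Ioc 0 ⌊Real.exp (u - V)⌋₊, moebiusDiv n * G n =
      ∑ n ∈ Ioc 0 ⌊Real.exp (u - V)⌋₊, moebiusDiv n * (G n - c) +
        c * rieszSum moebiusDiv 0 (u - V) := by
    simp only [rieszSum, pow_zero, Nat.factorial_zero, Nat.cast_one, div_one, mul_one]
    rw [mul_sum, ← sum_add_distrib]
    exact sum_congr rfl fun n _ => by ring
  have b1 : |∑ n ∈ Ioc 0 ⌊Real.exp (u - V)⌋₊, moebiusDiv n * (G n - c)| ≤
      (1 + u) * (K / (1 + V) ^ A) := by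
    refine (abs_sum_moebiusDiv_mul_le (B := K / (1 + V) ^ A) (by positivity) (by linarith) _ ?_).trans ?_
    · intro n hn hlog
      refine (hK (u - Real.log n) (by linarith)).trans ?_
      gcongr
      linarith
    · gcongr; linarith
  have b2 : |c * rieszSum moebiusDiv 0 (u - V)| ≤ |c| * S := by
    rw [abs_mul]
    exact mul_le_mul_of_nonneg_left (hS _ le_rfl (by linarith)) (abs_nonneg _)
  -- For the remaining `n` the order of summation is exchanged: only `l ≤ e^V` contribute.
  have e3 : ∑ n ∈ Ioc 0 ⌊Real.exp u⌋₊, dropInit moebiusDiv (u - V) n * G n =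
      ∑ l ∈ Ioc 0 ⌊Real.exp u⌋₊, divId vonMangoldt l *
        rieszSum (dropInit moebiusDiv (u - V)) 0 (u - Real.log l) -
      ∫ x in (0 : ℝ)..u, rieszSum (dropInit moebiusDiv (u - V)) 0 x := by
    rw [← rieszSum_mul, mul_comm, rieszSum_mul, ← rieszSum_succ _ _ hu]
    simp [rieszSum, hG, mul_sub]
  have b3 : |∑ l ∈ Ioc 0 ⌊Real.exp u⌋₊, divId vonMangoldt l *
        rieszSum (dropInit moebiusDiv (u - V)) 0 (u - Real.log l)| ≤
        (V + |c| + K) * (2 * S) := by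
    have hsub : Ioc 0 ⌊Real.exp V⌋₊ ⊆ Ioc 0 ⌊Real.exp u⌋₊ :=
      Ioc_subset_Ioc_right (Nat.floor_mono (Real.exp_le_exp.2 hVu))
    rw [← sum_subset hsub]
    · refine (abs_sum_le_sum_abs _ _).trans ?_
      have h1 : rieszSum (divId vonMangoldt) 0 V ≤ V + |c| + K := by
        have h2 := (abs_le.1 (hK V hV)).2
        have h3 : K / (1 + V) ^ A ≤ K := div_le_self hK0 (one_le_pow₀ (by linarith))
        have := le_abs_self c
        linarith
      rw [rieszSum] at h1
      simp only [pow_zero, Nat.factorial_zero, Nat.cast_one, div_one, mul_one] at h1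
      calc _ ≤ ∑ l ∈ Ioc 0 ⌊Real.exp V⌋₊, divId vonMangoldt l * (2 * S) := by
            refine sum_le_sum fun l _ => ?_
            rw [abs_mul, abs_of_nonneg (hΛ0 l)]
            refine mul_le_mul_of_nonneg_left (hR _ ?_) (hΛ0 l)
            linarith [Real.log_natCast_nonneg l]
        _ ≤ _ := by rw [← sum_mul]; gcongr
    · intro l hl hl'
      rw [mem_Ioc] at hl hl'
      have : ¬ l ≤ ⌊Real.exp V⌋₊ := fun h => hl' ⟨hl.1, h⟩
      rw [le_floor_exp_iff hl.1] at this
      rw [rieszSum_dropInit_of_le _ (by linarith), mul_zero]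
  have b4 : |∫ x in (0 : ℝ)..u, rieszSum (dropInit moebiusDiv (u - V)) 0 x| ≤ 2 * S * V := by
    have hi := intervalIntegrable_rieszSum (dropInit moebiusDiv (u - V)) 0 hu
    have hm : u - V ∈ Set.uIcc 0 u := by
      rw [Set.uIcc_of_le hu]; constructor <;> linarith
    rw [← intervalIntegral.integral_add_adjacent_intervals
      (hi.mono_set (Set.uIcc_subset_uIcc_left hm)) (hi.mono_set (Set.uIcc_subset_uIcc_right hm)),
      intervalIntegral.integral_congr (g := fun _ => (0 : ℝ)) (a := 0) (b := u - V)]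
    · have h1 := intervalIntegral.norm_integral_le_of_norm_le_const (a := u - V) (b := u)
        (f := fun x => rieszSum (dropInit moebiusDiv (u - V)) 0 x) (C := 2 * S) (fun x hx => by
          rw [Set.uIoc_of_le (by linarith)] at hx
          exact hR x hx.2)
      rw [Real.norm_eq_abs, sub_sub_cancel, abs_of_nonneg hV] at h1
      simpa using h1
    · intro x hx
      rw [Set.uIcc_of_le (by linarith)] at hx
      exact rieszSum_dropInit_of_le _ hx.2 _
  rw [e1, sum_split_dropInit _ _ (show u - V ≤ u by linarith), e2, e3]
  refine (abs_add_le _ _).trans ?_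
  have t1 := (abs_add_le (∑ n ∈ Ioc 0 ⌊Real.exp (u - V)⌋₊, moebiusDiv n * (G n - c))
    (c * rieszSum moebiusDiv 0 (u - V))).trans (add_le_add b1 b2)
  have t2 := (abs_sub (∑ l ∈ Ioc 0 ⌊Real.exp u⌋₊, divId vonMangoldt l *
        rieszSum (dropInit moebiusDiv (u - V)) 0 (u - Real.log l))
        (∫ x in (0 : ℝ)..u, rieszSum (dropInit moebiusDiv (u - V)) 0 x)).trans (add_le_add b3 b4)
  refine (add_le_add t1 t2).trans (le_of_eq ?_)
  ring

/-- The sums `∑_{n ≤ e^u} μ(n) / n` decay faster than any power of `u`. -/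
theorem exists_abs_rieszSum_moebiusDiv_le {θ : ℝ} (hθ : 0 < θ) (h : LevelOfDistribution θ) (j : ℕ) :
    ∃ C : ℝ, 0 ≤ C ∧ ∀ u : ℝ, 0 ≤ u → |rieszSum moebiusDiv 0 u| ≤ C / √(1 + u) ^ j := by
  have hsmall : ∀ u : ℝ, 0 ≤ u → |rieszSum moebiusDiv 0 u| ≤ 1 + u := by
    intro u hu
    have := abs_sum_moebiusDiv_mul_le zero_le_one hu (fun _ => 1) (fun _ _ _ => by simp)
    simpa [rieszSum] using this
  -- Each application of the hyperbola method, with `V = √u`, gains a factor `√u`.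
  induction j with
  | zero =>
    obtain ⟨c, K, hK0, hK⟩ := exists_abs_rieszSum_divId_vonMangoldt_sub_le hθ h 0
    refine ⟨2 * (|c| + K + 1), by positivity, fun u hu => ?_⟩
    simp only [pow_zero, div_one]
    rcases le_or_gt 1 u with h1 | h1
    · have h2 : u * |rieszSum moebiusDiv 0 u| ≤ (1 + u) * (|c| + K) := by
        have e1 : u * |rieszSum moebiusDiv 0 u| = |u * rieszSum moebiusDiv 0 u| := by
          rw [abs_mul, abs_of_nonneg hu]
        rw [e1, mul_rieszSum_moebiusDiv, abs_neg]
        refine abs_sum_moebiusDiv_mul_le (by positivity) hu _ fun n hn hl => ?_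
        have h3 := hK (u - Real.log n) (by linarith)
        simp only [pow_zero, div_one] at h3
        have := abs_sub_abs_le_abs_sub
          (rieszSum (divId vonMangoldt) 0 (u - Real.log n) - (u - Real.log n)) c
        linarith
      have h4 : (1 + u) * (|c| + K) ≤ u * (2 * (|c| + K + 1)) := by
        have : 0 ≤ |c| + K := by positivity
        nlinarith
      exact le_of_mul_le_mul_left (h2.trans h4) (by linarith)
    · have := hsmall u hu
      have : 0 ≤ |c| + K := by positivity
      linarith
  | succ j ih =>
    obtain ⟨C, hC0, hC⟩ := ih
    obtain ⟨c, K, hK0, hK⟩ := exists_abs_rieszSum_divId_vonMangoldt_sub_le hθ h (j + 1)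
    refine ⟨2 * (K + C * 2 ^ j * (8 + 3 * |c| + 2 * K)) + 5 * 3 ^ (j + 1), by positivity, fun u hu => ?_⟩
    set s := √(1 + u) with hs
    have hs2 : s ^ 2 = 1 + u := Real.sq_sqrt (by linarith)
    have hs1 : 1 ≤ s := Real.one_le_sqrt.2 (by linarith)
    rw [le_div_iff₀ (by positivity)]
    rcases le_or_gt 4 u with h4 | h4
    · set V := √u with hVdef
      have hV0 : 0 ≤ V := Real.sqrt_nonneg u
      have hV2 : V ^ 2 = u := Real.sq_sqrt hu
      have hV2' : 2 ≤ V := by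
        rw [hVdef]; exact Real.le_sqrt_of_sq_le (by linarith)
      have hVu : V ≤ u / 2 := by nlinarith
      have hVs : s ≤ 1 + V := by
        rw [hs]; exact Real.sqrt_le_iff.2 ⟨by linarith, by nlinarith⟩
      have hVs' : V ≤ s := Real.sqrt_le_sqrt (by linarith)
      have hS : ∀ w, u - V ≤ w → w ≤ u → |rieszSum moebiusDiv 0 w| ≤ C * 2 ^ j / s ^ j := by
        intro w hw1 hw2
        refine (hC w (by linarith)).trans ?_
        have hsw : s / 2 ≤ √(1 + w) := by
          apply Real.le_sqrt_of_sq_le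
          rw [div_pow, hs2]; linarith
        have : (s / 2) ^ j ≤ √(1 + w) ^ j := pow_le_pow_left₀ (by positivity) hsw j
        calc C / √(1 + w) ^ j ≤ C / (s / 2) ^ j := by gcongr
          _ = _ := by rw [div_pow]; field_simp
      have h5 := mul_abs_rieszSum_moebiusDiv_le hK0 hK hV0 (by linarith) (S := C * 2 ^ j / s ^ j)
        (by positivity) hS
      have h6 : (1 + u) * (K / (1 + V) ^ (j + 1)) ≤ s ^ 2 * (K / s ^ (j + 1)) := by
        rw [hs2]; gcongr
      have h7 : C * 2 ^ j / s ^ j * (4 * V + 3 * |c| + 2 * K) ≤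
          C * 2 ^ j / s ^ j * ((8 + 3 * |c| + 2 * K) * s) := by
        gcongr
        have : 0 ≤ 3 * |c| + 2 * K := by positivity
        nlinarith
      have h8 : s ^ 2 * (K / s ^ (j + 1)) + C * 2 ^ j / s ^ j * ((8 + 3 * |c| + 2 * K) * s) =
          s ^ 2 * ((K + C * 2 ^ j * (8 + 3 * |c| + 2 * K)) / s ^ (j + 1)) := by
        rw [pow_succ s j]; field_simp
      have h9 : s ^ 2 / 2 * |rieszSum moebiusDiv 0 u| ≤
          s ^ 2 / 2 * (2 * ((K + C * 2 ^ j * (8 + 3 * |c| + 2 * K)) / s ^ (j + 1))) := by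
        have h10 : s ^ 2 / 2 * |rieszSum moebiusDiv 0 u| ≤ u * |rieszSum moebiusDiv 0 u| := by
          rw [hs2]; gcongr; linarith
        refine h10.trans (h5.trans ((add_le_add h6 h7).trans ?_))
        rw [h8]
        apply le_of_eq; ring
      have h11 := le_of_mul_le_mul_left h9 (by positivity)
      rw [← mul_div_assoc, le_div_iff₀ (by positivity)] at h11
      have : (0 : ℝ) ≤ 5 * 3 ^ (j + 1) := by positivity
      linarith
    · have h5 := hsmall u hu
      have h6 : s ^ (j + 1) ≤ 3 ^ (j + 1) := by
        refine pow_le_pow_left₀ (by positivity) ?_ _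
        nlinarith
      have h7 : |rieszSum moebiusDiv 0 u| * s ^ (j + 1) ≤ 5 * 3 ^ (j + 1) :=
        mul_le_mul (by linarith) h6 (by positivity) (by norm_num)
      have : 0 ≤ 2 * (K + C * 2 ^ j * (8 + 3 * |c| + 2 * K)) := by positivity
      linarith

/-! ### Riesz means of the Dirichlet powers of `μ(n) / n` -/

theorem exists_integral_abs_rieszSum_moebiusDiv_le {θ : ℝ} (hθ : 0 < θ)
    (h : LevelOfDistribution θ) :
    ∃ J : ℝ, 0 ≤ J ∧ ∀ u : ℝ, 0 ≤ u →
      ∫ v in (0 : ℝ)..u, |rieszSum moebiusDiv 0 v| * (1 + v) ≤ J := by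
  -- `√(1 + v)^6 = (1 + v)^3` leaves the integrable `(1 + v)^(-2)`.
  obtain ⟨C, hC0, hC⟩ := exists_abs_rieszSum_moebiusDiv_le hθ h 6
  refine ⟨C, hC0, fun u hu => ?_⟩
  have h1 : ∀ v ∈ Set.Icc 0 u, |rieszSum moebiusDiv 0 v| * (1 + v) ≤ C * (1 / (1 + v) ^ 2) := by
    intro v hv
    have hv1 : 0 < 1 + v := by linarith [hv.1]
    have h2 := hC v hv.1
    rw [show √(1 + v) ^ 6 = (1 + v) ^ 3 by
      rw [show 6 = 2 * 3 by norm_num, pow_mul, Real.sq_sqrt hv1.le]] at h2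
    calc _ ≤ C / (1 + v) ^ 3 * (1 + v) := by gcongr
      _ = _ := by field_simp
  have hcont : ContinuousOn (fun v : ℝ => C * (1 / (1 + v) ^ 2)) (Set.uIcc 0 u) := by
    rw [Set.uIcc_of_le hu]
    refine ContinuousOn.const_mul ?_ _ |>.congr fun _ _ => rfl
    refine ContinuousOn.div (by fun_prop) (by fun_prop) fun v hv => ?_
    have : 0 < 1 + v := by linarith [hv.1]
    positivity
  have hint := (intervalIntegrable_rieszSum moebiusDiv 0 hu).abs.mul_continuousOn
    (g := fun v => 1 + v) (by fun_prop)
  refine (intervalIntegral.integral_mono_on hu hint hcont.intervalIntegrable h1).trans ?_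
  have hder : ∀ v ∈ Set.uIcc 0 u, HasDerivAt (fun v : ℝ => C * (1 - (1 + v)⁻¹))
      (C * (1 / (1 + v) ^ 2)) v := by
    intro v hv
    rw [Set.uIcc_of_le hu] at hv
    have hv1 : 1 + v ≠ 0 := by linarith [hv.1]
    have h3 := (((hasDerivAt_id v).const_add 1).inv hv1).const_sub 1 |>.const_mul C
    rw [neg_div, neg_neg] at h3
    exact h3
  rw [intervalIntegral.integral_eq_sub_of_hasDerivAt hder hcont.intervalIntegrable]
  have : 0 ≤ (1 + u)⁻¹ := by positivity
  simp
  nlinarith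

theorem abs_integral_mul_le {F G : ℝ → ℝ} {u J B : ℝ} (hu : 0 ≤ u) (hB : 0 ≤ B)
    (hF : IntervalIntegrable F volume 0 u)
    (hJ : ∫ v in (0 : ℝ)..u, |F v| * (1 + v) ≤ J)
    (hG : ∀ v, 0 ≤ v → v ≤ u → |G v| ≤ B * (1 + v)) :
    |∫ v in (0 : ℝ)..u, F v * G v| ≤ J * B := by
  have h1 := intervalIntegral.norm_integral_le_of_norm_le (a := 0) (b := u) (μ := volume)
    (f := fun v => F v * G v) (g := fun v => |F v| * (1 + v) * B) hu
    (Filter.Eventually.of_forall fun v hv => by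
      rw [Real.norm_eq_abs, abs_mul, mul_assoc, mul_comm (1 + v)]
      exact mul_le_mul_of_nonneg_left (hG v hv.1.le hv.2) (abs_nonneg _))
    ((hF.abs.mul_continuousOn (by fun_prop)).mul_const B)
  rw [intervalIntegral.integral_mul_const] at h1
  exact h1.trans (mul_le_mul_of_nonneg_right hJ hB)

/-- The integral `∫_0^u ∑_{n ≤ e^v} μ(n)/n dv` is `1 + O(1/u)`: convolve with the partial sums of
the harmonic series. -/
theorem exists_abs_integral_rieszSum_moebiusDiv_sub_one_le {θ : ℝ} (hθ : 0 < θ)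
    (h : LevelOfDistribution θ) :
    ∃ J : ℝ, 0 ≤ J ∧ ∀ u : ℝ, 0 ≤ u →
      u * |(∫ v in (0 : ℝ)..u, rieszSum moebiusDiv 0 v) - 1| ≤ J := by
  obtain ⟨J, hJ0, hJ⟩ := exists_integral_abs_rieszSum_moebiusDiv_le hθ h
  refine ⟨J, hJ0, fun u hu => ?_⟩
  have h1 : ∫ v in (0 : ℝ)..u, rieszSum moebiusDiv 0 v * rieszSum invArith 0 (u - v) = u := by
    rw [← rieszSum_mul_succ _ _ _ hu, moebiusDiv_mul_invArith, rieszSum_one _ hu]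
    simp
  have hA := intervalIntegrable_rieszSum moebiusDiv 0 hu
  have hH : IntervalIntegrable (fun v => rieszSum moebiusDiv 0 v * rieszSum invArith 0 (u - v))
      volume 0 u := by
    rw [intervalIntegrable_iff_integrableOn_Ioc_of_le hu] at hA ⊢
    refine Integrable.mul_bdd (c := 1 + u) hA
      ((measurable_rieszSum invArith 0).comp (by fun_prop)).aestronglyMeasurable ?_
    refine (ae_restrict_iff' measurableSet_Ioc).2 (Filter.Eventually.of_forall fun v hv => ?_)
    have := abs_rieszSum_invArith_zero_sub (u := u - v) (by linarith [hv.2])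
    rw [abs_le] at this
    rw [Real.norm_eq_abs, abs_le]
    constructor <;> linarith [hv.1, hv.2]
  have h2 : u * ((∫ v in (0 : ℝ)..u, rieszSum moebiusDiv 0 v) - 1) =
      ∫ v in (0 : ℝ)..u, rieszSum moebiusDiv 0 v * (u - rieszSum invArith 0 (u - v)) := by
    simp_rw [mul_sub]
    rw [intervalIntegral.integral_sub (hA.mul_const u) hH, h1, intervalIntegral.integral_mul_const]
    ring
  rw [← abs_of_nonneg hu, ← abs_mul, abs_of_nonneg hu, h2]
  have h3 := abs_integral_mul_le (G := fun v => u - rieszSum invArith 0 (u - v)) hu zero_le_one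
    hA (hJ u hu) (fun v hv0 hvu => by
      have := abs_rieszSum_invArith_zero_sub (u := u - v) (by linarith)
      rw [abs_le] at this ⊢
      constructor <;> linarith)
  simpa using h3

/-- The Riesz means of order `κ + b` of the `κ`-th Dirichlet power of `μ(n) / n`. In the induction
on `κ`, the mean for `κ + 1` is the convolution of the one for `κ` with `A(v) = ∑_{n ≤ e^v} μ(n)/n`,
which acts as an approximate identity: `A` has total integral `1` and `A(v) (1 + v)` is integrable.
-/
theorem exists_abs_rieszSum_moebiusDiv_pow_sub_le {θ : ℝ} (hθ : 0 < θ)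
    (h : LevelOfDistribution θ) (κ : ℕ) {b : ℕ} (hb : 1 ≤ b) :
    ∃ C : ℝ, 0 ≤ C ∧ ∀ u : ℝ, 0 ≤ u →
      |rieszSum (moebiusDiv ^ κ) (κ + b) u - u ^ b / (b ! : ℝ)| ≤ C * (1 + u) ^ (b - 1) := by
  obtain ⟨J, hJ0, hJ⟩ := exists_integral_abs_rieszSum_moebiusDiv_le hθ h
  obtain ⟨J', hJ'0, hJ'⟩ := exists_abs_integral_rieszSum_moebiusDiv_sub_one_le hθ h
  induction κ with
  | zero => exact ⟨0, le_rfl, fun u hu => by simp [rieszSum_one b hu]⟩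
  | succ κ ih =>
    obtain ⟨C, hC0, hC⟩ := ih
    refine ⟨J * (C + 1) + J', by positivity, fun u hu => ?_⟩
    have hfac : (1 : ℝ) ≤ (b ! : ℝ) := by
      exact_mod_cast Nat.one_le_iff_ne_zero.2 (Nat.factorial_ne_zero b)
    have hbf : (b : ℝ) / (b ! : ℝ) ≤ 1 := by
      rw [div_le_one (by linarith)]; exact_mod_cast Nat.self_le_factorial b
    have hA := intervalIntegrable_rieszSum moebiusDiv 0 hu
    set D := (C + 1) * (1 + u) ^ (b - 1) with hD
    have hpt : ∀ v, 0 ≤ v → v ≤ u →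
        |rieszSum (moebiusDiv ^ κ) (κ + b) (u - v) - u ^ b / (b ! : ℝ)| ≤ D * (1 + v) := by
      intro v hv0 hvu
      have h1 := hC (u - v) (by linarith)
      have h2 : C * (1 + (u - v)) ^ (b - 1) ≤ C * (1 + u) ^ (b - 1) := by
        have : 0 ≤ 1 + (u - v) := by linarith
        gcongr; linarith
      have h3 : |(u - v) ^ b / (b ! : ℝ) - u ^ b / (b ! : ℝ)| ≤ v * (1 + u) ^ (b - 1) := by
        rw [← sub_div, abs_div, abs_of_pos (show (0 : ℝ) < (b ! : ℝ) by linarith), abs_sub_comm,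
          abs_of_nonneg (sub_nonneg.2 (pow_le_pow_left₀ (by linarith) (by linarith) _))]
        have h6 := pow_sub_pow_le_mul (y := u - v) (by linarith) (by linarith) b (u := u)
        calc _ ≤ (b * (u - (u - v)) * u ^ (b - 1)) / (b ! : ℝ) := by gcongr
          _ = (b / (b ! : ℝ)) * (v * u ^ (b - 1)) := by ring
          _ ≤ 1 * (v * (1 + u) ^ (b - 1)) := by gcongr; linarith
          _ = _ := one_mul _
      have hp : 0 ≤ (1 + u) ^ (b - 1) := by positivity
      refine ((abs_sub_le _ _ _).trans (add_le_add (h1.trans h2) h3)).trans ?_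
      rw [hD]
      nlinarith [mul_nonneg hC0 (mul_nonneg hv0 hp)]
    have hG : IntervalIntegrable (fun v => rieszSum moebiusDiv 0 v *
        rieszSum (moebiusDiv ^ κ) (κ + b) (u - v)) volume 0 u := by
      rw [intervalIntegrable_iff_integrableOn_Ioc_of_le hu] at hA ⊢
      refine Integrable.mul_bdd (c := D * (1 + u) + u ^ b / (b ! : ℝ)) hA
        ((measurable_rieszSum _ _).comp (by fun_prop)).aestronglyMeasurable ?_
      refine (ae_restrict_iff' measurableSet_Ioc).2 (Filter.Eventually.of_forall fun v hv => ?_)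
      have h1 := hpt v hv.1.le hv.2
      have h2 : D * (1 + v) ≤ D * (1 + u) := by
        have : 0 ≤ D := by positivity
        gcongr; exact hv.2
      have h3 : 0 ≤ u ^ b / (b ! : ℝ) := by positivity
      rw [abs_le] at h1
      rw [Real.norm_eq_abs, abs_le]
      constructor <;> linarith
    have e1 : rieszSum (moebiusDiv ^ (κ + 1)) (κ + 1 + b) u - u ^ b / (b ! : ℝ) =
        (∫ v in (0 : ℝ)..u, rieszSum moebiusDiv 0 v *
          (rieszSum (moebiusDiv ^ κ) (κ + b) (u - v) - u ^ b / (b ! : ℝ))) +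
        u ^ b / (b ! : ℝ) * ((∫ v in (0 : ℝ)..u, rieszSum moebiusDiv 0 v) - 1) := by
      rw [show κ + 1 + b = κ + b + 1 by ring, pow_succ', rieszSum_mul_succ _ _ _ hu]
      simp_rw [mul_sub]
      rw [intervalIntegral.integral_sub hG (hA.mul_const _), intervalIntegral.integral_mul_const]
      ring
    have b1 := abs_integral_mul_le (G := fun v =>
      rieszSum (moebiusDiv ^ κ) (κ + b) (u - v) - u ^ b / (b ! : ℝ)) hu (B := D) (by positivity)
      hA (hJ u hu) hpt
    have b2 : |u ^ b / (b ! : ℝ) * ((∫ v in (0 : ℝ)..u, rieszSum moebiusDiv 0 v) - 1)| ≤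
        J' * (1 + u) ^ (b - 1) := by
      rw [abs_mul, abs_of_nonneg (by positivity)]
      have h3 : u ^ b / (b ! : ℝ) ≤ (1 + u) ^ (b - 1) * u := by
        calc _ ≤ u ^ b := div_le_self (by positivity) hfac
          _ = u ^ (b - 1) * u := by rw [← pow_succ]; congr 1; omega
          _ ≤ _ := by gcongr; linarith
      calc _ ≤ (1 + u) ^ (b - 1) * u * |(∫ v in (0 : ℝ)..u, rieszSum moebiusDiv 0 v) - 1| := by
            gcongr
        _ ≤ (1 + u) ^ (b - 1) * J' := by rw [mul_assoc]; gcongr; exact hJ' u hu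
        _ = _ := mul_comm _ _
    rw [e1]
    refine ((abs_add_le _ _).trans (add_le_add b1 b2)).trans (le_of_eq ?_)
    rw [hD]; ring

/-! ### Multiplicative functions close to Dirichlet powers of `1 / n` and `μ(n) / n` -/

/-- The multiplicative function supported on squarefree integers with value `t p` at primes. -/
noncomputable def sqfreeMul (t : ℕ → ℝ) : ArithmeticFunction ℝ :=
  ⟨fun n => if Squarefree n then ∏ p ∈ n.primeFactors, t p else 0, by simp⟩

theorem sqfreeMul_apply (t : ℕ → ℝ) (n : ℕ) :
    sqfreeMul t n = if Squarefree n then ∏ p ∈ n.primeFactors, t p else 0 := rfl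

theorem isMultiplicative_sqfreeMul (t : ℕ → ℝ) : (sqfreeMul t).IsMultiplicative := by
  refine ⟨by simp [sqfreeMul_apply], fun {m n} h => ?_⟩
  rw [sqfreeMul_apply, sqfreeMul_apply, sqfreeMul_apply]
  have hs := Nat.squarefree_mul h
  by_cases hm : Squarefree m <;> by_cases hn : Squarefree n <;> simp [hs, hm, hn]
  rw [h.primeFactors_mul, prod_union h.disjoint_primeFactors]

theorem sqfreeMul_prime (t : ℕ → ℝ) {p : ℕ} (hp : p.Prime) : sqfreeMul t p = t p := by
  rw [sqfreeMul_apply, if_pos hp.prime.squarefree, hp.primeFactors, prod_singleton]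

theorem sqfreeMul_prime_pow (t : ℕ → ℝ) {p : ℕ} (hp : p.Prime) (j : ℕ) :
    sqfreeMul t (p ^ (j + 2)) = 0 := by
  rw [sqfreeMul_apply, if_neg]
  rw [Nat.squarefree_pow_iff hp.ne_one (by omega)]
  omega

theorem mul_apply_prime_pow (f g : ArithmeticFunction ℝ) {p : ℕ} (hp : p.Prime) (j : ℕ) :
    (f * g) (p ^ j) = ∑ i ∈ range (j + 1), f (p ^ i) * g (p ^ (j - i)) := by
  rw [mul_apply, Nat.sum_divisorsAntidiagonal (f := fun a b => f a * g b),
    Nat.sum_divisors_prime_pow hp]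
  refine sum_congr rfl fun i hi => ?_
  rw [Nat.pow_div (by rw [mem_range] at hi; omega) hp.pos]

theorem sqfreeMul_mul_prime_pow_succ (t : ℕ → ℝ) (β : ArithmeticFunction ℝ) {p : ℕ}
    (hp : p.Prime) (j : ℕ) :
    (sqfreeMul t * β) (p ^ (j + 1)) = β (p ^ (j + 1)) + t p * β (p ^ j) := by
  rw [mul_apply_prime_pow _ _ hp, sum_range_succ', sum_range_succ']
  have h : ∑ k ∈ range j, sqfreeMul t (p ^ (k + 1 + 1)) * β (p ^ (j + 1 - (k + 1 + 1))) = 0 :=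
    sum_eq_zero fun k _ => by rw [sqfreeMul_prime_pow t hp, zero_mul]
  rw [h]
  simp [sqfreeMul_prime t hp, (isMultiplicative_sqfreeMul t).map_one, add_comm]

theorem isMultiplicative_moebiusDiv : moebiusDiv.IsMultiplicative := by
  refine ⟨by simp [moebiusDiv_apply], fun {m n} h => ?_⟩
  simp only [moebiusDiv_apply, isMultiplicative_moebius.map_mul_of_coprime h]
  push_cast
  rw [mul_div_mul_comm]

theorem isMultiplicative_invArith : invArith.IsMultiplicative := by
  refine ⟨by simp [invArith_apply], fun {m n} _ => ?_⟩
  simp only [invArith_apply]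
  push_cast
  rw [mul_inv]

theorem invArith_pow_nonneg (κ n : ℕ) : 0 ≤ (invArith ^ κ) n := by
  induction κ generalizing n with
  | zero => rw [pow_zero, one_apply]; split_ifs <;> norm_num
  | succ κ ih =>
    rw [pow_succ', mul_apply]
    exact sum_nonneg fun x _ => mul_nonneg (by rw [invArith_apply]; positivity) (ih _)

theorem abs_moebiusDiv_pow_le (κ n : ℕ) : |(moebiusDiv ^ κ) n| ≤ (invArith ^ κ) n := by
  induction κ generalizing n with
  | zero => rw [pow_zero, pow_zero, one_apply]; split_ifs <;> simp
  | succ κ ih =>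
    rw [pow_succ', pow_succ', mul_apply, mul_apply]
    refine (abs_sum_le_sum_abs _ _).trans (sum_le_sum fun x _ => ?_)
    rw [abs_mul]
    exact mul_le_mul (abs_moebiusDiv_le _) (ih _) (abs_nonneg _)
      (by rw [invArith_apply]; positivity)

theorem invArith_pow_prime_pow_le (κ : ℕ) {p : ℕ} (hp : p.Prime) (j : ℕ) :
    (invArith ^ κ) (p ^ j) ≤ ((j : ℝ) + 1) ^ κ / (p : ℝ) ^ j := by
  have hp0 : (0 : ℝ) < p := by exact_mod_cast hp.pos
  induction κ generalizing j with
  | zero =>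
    rw [pow_zero, pow_zero, one_apply]
    rcases j with _ | j
    · simp
    · rw [if_neg (by simp [hp.ne_one])]; positivity
  | succ κ ih =>
    rw [pow_succ', mul_apply_prime_pow _ _ hp]
    calc _ ≤ ∑ i ∈ range (j + 1), ((j : ℝ) + 1) ^ κ / (p : ℝ) ^ j := by
          refine sum_le_sum fun i hi => ?_
          have hi' : i ≤ j := by rw [mem_range] at hi; omega
          rw [invArith_apply]
          calc _ ≤ (((p ^ i : ℕ) : ℝ))⁻¹ * ((((j - i : ℕ) : ℝ) + 1) ^ κ / (p : ℝ) ^ (j - i)) :=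
                mul_le_mul_of_nonneg_left (ih _) (by positivity)
            _ = (((j - i : ℕ) : ℝ) + 1) ^ κ / (p : ℝ) ^ j := by
                have e : (p : ℝ) ^ j = (p : ℝ) ^ i * (p : ℝ) ^ (j - i) := by
                  rw [← pow_add, Nat.add_sub_cancel' hi']
                rw [e, Nat.cast_pow]
                field_simp
            _ ≤ _ := by
                gcongr
                exact_mod_cast Nat.sub_le j i
      _ = _ := by
          rw [sum_const, card_range, nsmul_eq_mul, pow_succ]
          push_cast
          ring

theorem invArith_pow_prime (κ : ℕ) {p : ℕ} (hp : p.Prime) : (invArith ^ κ) p = κ / p := by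
  induction κ with
  | zero => rw [pow_zero, one_apply_ne hp.ne_one]; simp
  | succ κ ih =>
    have := mul_apply_prime_pow invArith (invArith ^ κ) hp 1
    rw [pow_one] at this
    rw [pow_succ', this, sum_range_succ, sum_range_one]
    simp [ih, (isMultiplicative_invArith.pow (k := κ)).map_one, invArith_apply]
    ring

theorem moebiusDiv_pow_prime (κ : ℕ) {p : ℕ} (hp : p.Prime) : (moebiusDiv ^ κ) p = -(κ / p) := by
  induction κ with
  | zero => rw [pow_zero, one_apply_ne hp.ne_one]; simp
  | succ κ ih =>
    have := mul_apply_prime_pow moebiusDiv (moebiusDiv ^ κ) hp 1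
    rw [pow_one] at this
    rw [pow_succ', this, sum_range_succ, sum_range_one]
    simp [ih, (isMultiplicative_moebiusDiv.pow (k := κ)).map_one, moebiusDiv_apply,
      moebius_apply_prime hp]
    ring

/-- A nonnegative multiplicative function is summable once its partial Euler products are
bounded. -/
theorem tsum_le_of_prod_primesBelow_le {f : ℕ → ℝ} {B : ℝ} (hf0 : ∀ n, 0 ≤ f n) (hfz : f 0 = 0)
    (hf1 : f 1 = 1) (hfmul : ∀ {m n : ℕ}, m.Coprime n → f (m * n) = f m * f n)
    (hsp : ∀ {p : ℕ}, p.Prime → Summable fun j : ℕ => ‖f (p ^ j)‖)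
    (hprod : ∀ N : ℕ, ∏ p ∈ N.primesBelow, ∑' j : ℕ, f (p ^ j) ≤ B) :
    Summable f ∧ ∑' n, f n ≤ B := by
  have hfin : ∀ s : Finset ℕ, ∑ n ∈ s, f n ≤ B := by
    intro s
    set N := s.sup id + 1 with hN
    obtain ⟨-, hsum⟩ := EulerProduct.summable_and_hasSum_smoothNumbers_prod_primesBelow_tsum
      hf1 hfmul hsp N
    have hsum' : HasSum (N.smoothNumbers.indicator f) (∏ p ∈ N.primesBelow, ∑' j : ℕ, f (p ^ j)) :=
      hasSum_subtype_iff_indicator.1 hsum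
    have hind : ∀ n, 0 ≤ N.smoothNumbers.indicator f n :=
      fun n => Set.indicator_nonneg (fun n _ => hf0 n) n
    have h1 : ∑ n ∈ s, N.smoothNumbers.indicator f n ≤ B :=
      (sum_le_hasSum s (fun n _ => hind n) hsum').trans (hprod N)
    refine (sum_le_sum fun n hn => ?_).trans h1
    rcases Nat.eq_zero_or_pos n with rfl | hpos
    · rw [hfz]; exact hind 0
    · rw [Set.indicator_of_mem]
      refine Nat.mem_smoothNumbers_of_lt hpos ?_
      have := Finset.le_sup (f := id) hn
      simp only [id] at this
      omega
  have hs : Summable f := summable_of_sum_le hf0 hfin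
  exact ⟨hs, hs.tsum_le_of_sum_le hfin⟩

/-- Rankin's trick for a multiplicative function `r` with `r(p^j) ≪ (j+1)^q p^{-j}`: only the
primes at which `r(p)` is not `O(p^{-2})` contribute significantly. -/
theorem exists_tsum_abs_mul_rpow_le (D : ℝ) (hD : 0 ≤ D) (q : ℕ) :
    ∃ D' : ℝ, 0 ≤ D' ∧ ∀ (r : ArithmeticFunction ℝ) (bad : Finset ℕ) (η : ℝ),
      r.IsMultiplicative → 0 ≤ η → η ≤ 1 / 4 →
      (∀ p : ℕ, p.Prime → ∀ j : ℕ, 1 ≤ j → |r (p ^ j)| ≤ D * ((j : ℝ) + 1) ^ q / (p : ℝ) ^ j) →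
      (∀ p : ℕ, p.Prime → p ∉ bad → |r p| ≤ D / (p : ℝ) ^ 2) →
      Summable (fun n : ℕ => |r n| * (n : ℝ) ^ η) ∧
      ∑' n : ℕ, |r n| * (n : ℝ) ^ η ≤ Real.exp (D' * (1 + ∑ p ∈ bad, (p : ℝ) ^ (η - 1))) := by
  -- For `η ≤ 1/4` one has `p^(η - 1) ≤ p^(-3/4) ≤ z`, so that the powers `p^j`, `j ≥ 2`, contribute
  -- at most a convergent geometric series times `p^(-3/2)`.
  set z : ℝ := 2 ^ (-(3 / 4) : ℝ) with hz
  have hz0 : 0 < z := by positivity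
  have hz1 : z < 1 := Real.rpow_lt_one_of_one_lt_of_neg (by norm_num) (by norm_num)
  have hQs : Summable fun i : ℕ => ((i : ℝ) + 3) ^ q * z ^ i := by
    have h1 : Summable fun n : ℕ => (n : ℝ) ^ q * z ^ n :=
      summable_pow_mul_geometric_of_norm_lt_one q (by rwa [Real.norm_of_nonneg hz0.le])
    have h2 := ((summable_nat_add_iff 3).2 h1).mul_right (z ^ 3)⁻¹
    refine h2.congr fun i => ?_
    push_cast
    rw [pow_add]
    field_simp
  set Q := ∑' i : ℕ, ((i : ℝ) + 3) ^ q * z ^ i with hQ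
  have hQ0 : 0 ≤ Q := tsum_nonneg fun i => by positivity
  have hZs : Summable fun n : ℕ => (n : ℝ) ^ (-(3 / 2) : ℝ) :=
    Real.summable_nat_rpow.2 (by norm_num)
  set Z := ∑' n : ℕ, (n : ℝ) ^ (-(3 / 2) : ℝ) with hZ
  have hZ0 : 0 ≤ Z := tsum_nonneg fun i => by positivity
  refine ⟨D * (Q + 1) * Z + D * 2 ^ q, by positivity, ?_⟩
  intro r bad η hr hη0 hη1 hrp hgood
  set f : ℕ → ℝ := fun n => |r n| * (n : ℝ) ^ η with hf
  have hf0 : ∀ n, 0 ≤ f n := fun n => by positivity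
  have hf1 : f 1 = 1 := by simp [hf, hr.map_one]
  have hfmul : ∀ {m n : ℕ}, m.Coprime n → f (m * n) = f m * f n := by
    intro m n h
    simp only [hf, hr.map_mul_of_coprime h, abs_mul]
    push_cast
    rw [Real.mul_rpow (by positivity) (by positivity)]
    ring
  have hfp : ∀ p : ℕ, p.Prime → ∀ j : ℕ, 1 ≤ j →
      f (p ^ j) ≤ D * ((j : ℝ) + 1) ^ q * ((p : ℝ) ^ (η - 1)) ^ j := by
    intro p hp j hj
    have hp0 : (0 : ℝ) < p := by exact_mod_cast hp.pos
    have e : (((p ^ j : ℕ) : ℝ)) ^ η = ((p : ℝ) ^ (η - 1)) ^ j * (p : ℝ) ^ j := by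
      rw [← mul_pow, ← Real.rpow_add_one hp0.ne', sub_add_cancel]
      push_cast
      rw [← Real.rpow_natCast, ← Real.rpow_natCast, ← Real.rpow_mul hp0.le, ← Real.rpow_mul hp0.le,
        mul_comm]
    simp only [hf]
    rw [e]
    calc _ ≤ D * ((j : ℝ) + 1) ^ q / (p : ℝ) ^ j * (((p : ℝ) ^ (η - 1)) ^ j * (p : ℝ) ^ j) := by
          gcongr; exact hrp p hp j hj
      _ = _ := by field_simp
  have htail : ∀ p : ℕ, p.Prime → ∀ i : ℕ,
      f (p ^ (i + 2)) ≤ D * (p : ℝ) ^ (-(3 / 2) : ℝ) * (((i : ℝ) + 3) ^ q * z ^ i) := by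
    intro p hp i
    have hp0 : (0 : ℝ) < p := by exact_mod_cast hp.pos
    have hp1 : (1 : ℝ) ≤ p := by exact_mod_cast hp.one_le
    have hp2 : (2 : ℝ) ≤ p := by exact_mod_cast hp.two_le
    have h1 : ((p : ℝ) ^ (η - 1)) ^ 2 ≤ (p : ℝ) ^ (-(3 / 2) : ℝ) := by
      rw [← Real.rpow_natCast, ← Real.rpow_mul hp0.le]
      exact Real.rpow_le_rpow_of_exponent_le hp1 (by push_cast; linarith)
    have h2 : (p : ℝ) ^ (η - 1) ≤ z := by
      calc _ ≤ (p : ℝ) ^ (-(3 / 4) : ℝ) := Real.rpow_le_rpow_of_exponent_le hp1 (by linarith)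
        _ ≤ _ := Real.rpow_le_rpow_of_nonpos (by norm_num) hp2 (by norm_num)
    refine (hfp p hp (i + 2) (by omega)).trans ?_
    have h3 : ((p : ℝ) ^ (η - 1)) ^ i ≤ z ^ i := pow_le_pow_left₀ (by positivity) h2 i
    calc _ = D * (((i + 2 : ℕ) : ℝ) + 1) ^ q * (((p : ℝ) ^ (η - 1)) ^ i * ((p : ℝ) ^ (η - 1)) ^ 2) := by
          rw [pow_add]
      _ ≤ D * (((i + 2 : ℕ) : ℝ) + 1) ^ q * (z ^ i * (p : ℝ) ^ (-(3 / 2) : ℝ)) := by gcongr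
      _ = _ := by push_cast; ring
  have hsp : ∀ {p : ℕ}, p.Prime → Summable fun j : ℕ => ‖f (p ^ j)‖ := by
    intro p hp
    rw [← summable_nat_add_iff 2]
    refine Summable.of_nonneg_of_le (fun _ => norm_nonneg _) (fun i => ?_)
      (hQs.mul_left (D * (p : ℝ) ^ (-(3 / 2) : ℝ)))
    rw [Real.norm_of_nonneg (hf0 _)]
    exact htail p hp i
  set ρ : ℕ → ℝ := fun p => D * (Q + 1) * (p : ℝ) ^ (-(3 / 2) : ℝ) +
    if p ∈ bad then D * 2 ^ q * (p : ℝ) ^ (η - 1) else 0 with hρ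
  have hloc : ∀ p : ℕ, p.Prime → ∑' j : ℕ, f (p ^ j) ≤ Real.exp (ρ p) := by
    intro p hp
    have hp0 : (0 : ℝ) < p := by exact_mod_cast hp.pos
    have hp1 : (1 : ℝ) ≤ p := by exact_mod_cast hp.one_le
    have hs : Summable fun j : ℕ => f (p ^ j) := (hsp hp).of_norm
    rw [← hs.sum_add_tsum_nat_add 2]
    have h1 : ∑' i : ℕ, f (p ^ (i + 2)) ≤ D * (p : ℝ) ^ (-(3 / 2) : ℝ) * Q := by
      rw [hQ, ← tsum_mul_left]
      exact ((summable_nat_add_iff 2).2 hs).tsum_le_tsum (htail p hp) (hQs.mul_left _)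
    have h2 : f p ≤ D * (p : ℝ) ^ (-(3 / 2) : ℝ) +
        if p ∈ bad then D * 2 ^ q * (p : ℝ) ^ (η - 1) else 0 := by
      have h0 : 0 ≤ D * (p : ℝ) ^ (-(3 / 2) : ℝ) := by positivity
      split_ifs with hb
      · have := hfp p hp 1 le_rfl
        rw [pow_one, pow_one] at this
        norm_num at this
        linarith
      · have h3 := hgood p hp hb
        have e : (p : ℝ) ^ η ≤ (p : ℝ) ^ (-(3 / 2) : ℝ) * (p : ℝ) ^ 2 := by
          rw [← Real.rpow_natCast (p : ℝ) 2, ← Real.rpow_add hp0]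
          exact Real.rpow_le_rpow_of_exponent_le hp1 (by push_cast; linarith)
        rw [add_zero]
        calc f p ≤ D / (p : ℝ) ^ 2 * ((p : ℝ) ^ (-(3 / 2) : ℝ) * (p : ℝ) ^ 2) := by
              simp only [hf]; gcongr
          _ = _ := by field_simp
    have h4 := Real.add_one_le_exp (ρ p)
    refine le_trans ?_ h4
    rw [sum_range_succ, sum_range_one, pow_zero, pow_one, hf1]
    simp only [hρ]
    linarith
  have hprod : ∀ N : ℕ, ∏ p ∈ N.primesBelow, ∑' j : ℕ, f (p ^ j) ≤
      Real.exp ((D * (Q + 1) * Z + D * 2 ^ q) * (1 + ∑ p ∈ bad, (p : ℝ) ^ (η - 1))) := by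
    intro N
    have hE0 : 0 ≤ ∑ p ∈ bad, (p : ℝ) ^ (η - 1) := sum_nonneg fun p _ => by positivity
    calc _ ≤ ∏ p ∈ N.primesBelow, Real.exp (ρ p) :=
          prod_le_prod (fun p _ => tsum_nonneg fun j => hf0 _)
            (fun p hp => hloc p (Nat.prime_of_mem_primesBelow hp))
      _ = Real.exp (∑ p ∈ N.primesBelow, ρ p) := (Real.exp_sum _ _).symm
      _ ≤ _ := by
          apply Real.exp_le_exp.2
          have h1 : ∑ p ∈ N.primesBelow, (p : ℝ) ^ (-(3 / 2) : ℝ) ≤ Z :=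
            hZs.sum_le_tsum _ fun n _ => by positivity
          have h2 : ∑ p ∈ N.primesBelow, (if p ∈ bad then D * 2 ^ q * (p : ℝ) ^ (η - 1) else 0) ≤
              D * 2 ^ q * ∑ p ∈ bad, (p : ℝ) ^ (η - 1) := by
            rw [← sum_filter, mul_sum]
            refine sum_le_sum_of_subset_of_nonneg (fun p hp => (mem_filter.1 hp).2)
              fun p _ _ => by positivity
          simp only [hρ]
          rw [sum_add_distrib, ← mul_sum]
          have h3 : D * (Q + 1) * ∑ p ∈ N.primesBelow, (p : ℝ) ^ (-(3 / 2) : ℝ) ≤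
              D * (Q + 1) * Z := by gcongr
          have h4 : 0 ≤ D * (Q + 1) * Z := by positivity
          have h5 : 0 ≤ D * 2 ^ q := by positivity
          nlinarith [mul_nonneg h4 hE0]
  exact tsum_le_of_prod_primesBelow_le hf0 (by simp [hf]) hf1 hfmul hsp hprod

/-! ### Sums over primes and the weight of the exceptional primes -/

theorem rieszSum_divId_vonMangoldt_le {v : ℝ} (hv : 0 ≤ v) :
    rieszSum (divId vonMangoldt) 0 v ≤ 6 * (1 + v) := by
  have h1 : ∀ w : ℝ, Chebyshev.psi (Real.exp w) * Real.exp (-w) ≤ 6 := by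
    intro w
    have h2 := Chebyshev.psi_le_const_mul_self (x := Real.exp w) (Real.exp_pos w).le
    have h4 : Real.log 4 ≤ 2 := by
      rw [show (4 : ℝ) = 2 ^ 2 by norm_num, Real.log_pow]
      push_cast
      linarith [Real.log_two_lt_d9]
    calc _ ≤ (Real.log 4 + 4) * Real.exp w * Real.exp (-w) := by gcongr
      _ = Real.log 4 + 4 := by rw [mul_assoc, ← Real.exp_add]; simp
      _ ≤ 6 := by linarith
  rw [rieszSum_divId_vonMangoldt hv]
  have h3 := intervalIntegral.norm_integral_le_of_norm_le_const (a := 0) (b := v)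
    (f := fun w => Chebyshev.psi (Real.exp w) * Real.exp (-w)) (C := 6) (fun w _ => by
      rw [Real.norm_of_nonneg (mul_nonneg (Chebyshev.psi_nonneg _) (Real.exp_pos _).le)]
      exact h1 w)
  rw [Real.norm_eq_abs, sub_zero, abs_of_nonneg hv] at h3
  have := (le_abs_self _).trans h3
  linarith [h1 v]

/-- Chebyshev's bound gives `O(1)` for the sum of `1 / p` over each block `(e^(2^n), e^(2^(n+1))]`.
-/
theorem sum_primes_inv_le_of_log_le_two_pow (n : ℕ) :
    ∑ p ∈ (Ioc 0 ⌊Real.exp (2 ^ n)⌋₊).filter Nat.Prime, (p : ℝ)⁻¹ ≤ 18 * n + 2 := by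
  induction n with
  | zero =>
    have h3 : ⌊Real.exp (2 ^ 0)⌋₊ ≤ 3 := by
      have := Real.exp_one_lt_d9
      rw [pow_zero]
      exact Nat.floor_le_of_le (by norm_num; linarith)
    calc _ ≤ ∑ p ∈ Ioc (0 : ℕ) 3, ((p : ℕ) : ℝ)⁻¹ := by
          refine sum_le_sum_of_subset_of_nonneg ?_ fun p _ _ => by positivity
          exact (filter_subset _ _).trans (Ioc_subset_Ioc_right h3)
      _ ≤ _ := by norm_num [Finset.sum_Ioc_succ_top]
  | succ n ih =>
    have hmono : ⌊Real.exp (2 ^ n)⌋₊ ≤ ⌊Real.exp (2 ^ (n + 1))⌋₊ :=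
      Nat.floor_mono (Real.exp_le_exp.2 (pow_le_pow_right₀ (by norm_num) (by omega)))
    have hd : Disjoint ((Ioc 0 ⌊Real.exp (2 ^ n)⌋₊).filter Nat.Prime)
      ((Ioc ⌊Real.exp (2 ^ n)⌋₊ ⌊Real.exp (2 ^ (n + 1))⌋₊).filter Nat.Prime) :=
      disjoint_filter_filter (Ioc_disjoint_Ioc_of_le le_rfl)
    rw [← Ioc_union_Ioc_eq_Ioc (Nat.zero_le _) hmono, filter_union, sum_union hd]
    have h1 : ∑ p ∈ (Ioc ⌊Real.exp (2 ^ n)⌋₊ ⌊Real.exp (2 ^ (n + 1))⌋₊).filter Nat.Prime,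
        (p : ℝ)⁻¹ ≤ (2 ^ n)⁻¹ * (6 * (1 + 2 ^ (n + 1))) := by
      refine le_trans ?_ (mul_le_mul_of_nonneg_left
        (rieszSum_divId_vonMangoldt_le (v := 2 ^ (n + 1)) (by positivity)) (by positivity))
      rw [rieszSum, mul_sum]
      refine le_trans ?_ (sum_le_sum_of_subset_of_nonneg ((filter_subset Nat.Prime _).trans
        (Ioc_subset_Ioc_left (Nat.zero_le ⌊Real.exp (2 ^ n)⌋₊))) ?_)
      · refine sum_le_sum fun p hp => ?_
        rw [mem_filter, mem_Ioc] at hp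
        have hp0 : (0 : ℝ) < p := by exact_mod_cast hp.2.pos
        have hlog : (2 : ℝ) ^ n ≤ Real.log p := by
          by_contra hcon
          have := (le_floor_exp_iff hp.2.pos (2 ^ n)).2 (not_le.1 hcon).le
          omega
        rw [divId_apply, vonMangoldt_apply_prime hp.2]
        simp only [pow_zero, Nat.factorial_zero, Nat.cast_one, div_one, mul_one]
        rw [div_eq_mul_inv, ← mul_assoc]
        refine le_mul_of_one_le_left (by positivity) ?_
        rw [inv_mul_eq_div, one_le_div (by positivity)]
        exact hlog
      · intro p _ _
        have : 0 ≤ divId vonMangoldt p := by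
          rw [divId_apply]; exact div_nonneg vonMangoldt_nonneg (Nat.cast_nonneg _)
        simp only [pow_zero, Nat.factorial_zero, Nat.cast_one, div_one, mul_one]
        positivity
    have h2 : (2 ^ n : ℝ)⁻¹ * (6 * (1 + 2 ^ (n + 1))) ≤ 18 := by
      rw [inv_mul_le_iff₀ (by positivity), pow_succ]
      have : (1 : ℝ) ≤ 2 ^ n := one_le_pow₀ (by norm_num)
      linarith
    push_cast
    linarith

theorem sum_primes_inv_le {v : ℝ} (hv : 1 ≤ v) :
    ∑ p ∈ (Ioc 0 ⌊Real.exp v⌋₊).filter Nat.Prime, (p : ℝ)⁻¹ ≤ 36 * Real.log v + 20 := by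
  set n := ⌈Real.log v / Real.log 2⌉₊ with hn
  have hl2 : 1 / 2 < Real.log 2 := by linarith [Real.log_two_gt_d9]
  have hlv : 0 ≤ Real.log v := Real.log_nonneg hv
  have h1 : v ≤ 2 ^ n := by
    have := Nat.le_ceil (Real.log v / Real.log 2)
    rw [div_le_iff₀ (by linarith)] at this
    rw [← Real.log_le_log_iff (by linarith) (by positivity), Real.log_pow]
    exact this
  have h2 : (n : ℝ) ≤ 2 * Real.log v + 1 := by
    have h3 := (Nat.ceil_lt_add_one (a := Real.log v / Real.log 2) (by positivity)).le
    have h4 : Real.log v / Real.log 2 ≤ 2 * Real.log v := by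
      rw [div_le_iff₀ (by linarith)]; nlinarith
    linarith
  calc _ ≤ ∑ p ∈ (Ioc 0 ⌊Real.exp (2 ^ n)⌋₊).filter Nat.Prime, (p : ℝ)⁻¹ := by
        refine sum_le_sum_of_subset_of_nonneg (filter_subset_filter _ (Ioc_subset_Ioc_right
          (Nat.floor_mono (Real.exp_le_exp.2 h1)))) fun p _ _ => by positivity
    _ ≤ _ := sum_primes_inv_le_of_log_le_two_pow n
    _ ≤ _ := by linarith

/-- The primes that are at most `e^v` or divide `m`. -/
noncomputable def badPrimes (v : ℝ) (m : ℕ) : Finset ℕ :=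
  (Ioc 0 ⌊Real.exp v⌋₊).filter Nat.Prime ∪ m.primeFactors

/-- The weight of the exceptional primes with the Rankin exponent `η = 1 / v`. -/
theorem sum_badPrimes_rpow_le {v : ℝ} (hv : 4 ≤ v) {m : ℕ} (hm : m ≠ 0)
    (hmv : Real.log m ≤ Real.exp v) :
    ∑ p ∈ badPrimes v m, (p : ℝ) ^ (1 / v - 1) ≤ 3 * (36 * Real.log v + 22) := by
  have hv0 : 0 < v := by linarith
  have he3 : Real.exp 1 ≤ 3 := by linarith [Real.exp_one_lt_d9]
  have hsplit : badPrimes v m ⊆ (Ioc 0 ⌊Real.exp v⌋₊).filter Nat.Prime ∪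
      m.primeFactors.filter (fun p => ⌊Real.exp v⌋₊ < p) := by
    intro p hp
    rw [badPrimes, mem_union] at hp
    rw [mem_union]
    rcases hp with hp | hp
    · exact Or.inl hp
    · have hpp := Nat.prime_of_mem_primeFactors hp
      rcases le_or_gt p ⌊Real.exp v⌋₊ with h | h
      · exact Or.inl (mem_filter.2 ⟨mem_Ioc.2 ⟨hpp.pos, h⟩, hpp⟩)
      · exact Or.inr (mem_filter.2 ⟨hp, h⟩)
  refine (sum_le_sum_of_subset_of_nonneg hsplit fun p _ _ => by positivity).trans ?_
  refine (sum_union_inter (s₁ := (Ioc 0 ⌊Real.exp v⌋₊).filter Nat.Prime)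
    (s₂ := m.primeFactors.filter (fun p => ⌊Real.exp v⌋₊ < p))
    (f := fun p : ℕ => (p : ℝ) ^ (1 / v - 1)) ▸ le_add_of_nonneg_right
      (sum_nonneg fun p _ => by positivity)).trans ?_
  -- For `p ≤ e^v` the Rankin factor `p^{1/v}` is at most `e`.
  have h1 : ∑ p ∈ (Ioc 0 ⌊Real.exp v⌋₊).filter Nat.Prime, (p : ℝ) ^ (1 / v - 1) ≤
      3 * (36 * Real.log v + 20) := by
    refine le_trans ?_ (mul_le_mul_of_nonneg_left (sum_primes_inv_le (by linarith)) (by norm_num))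
    rw [mul_sum]
    refine sum_le_sum fun p hp => ?_
    rw [mem_filter, mem_Ioc] at hp
    have hp0 : (0 : ℝ) < p := by exact_mod_cast hp.2.pos
    have hlog := (le_floor_exp_iff hp.2.pos v).1 hp.1.2
    rw [Real.rpow_sub hp0, Real.rpow_one, div_eq_mul_inv]
    refine mul_le_mul_of_nonneg_right (le_trans ?_ he3) (by positivity)
    rw [Real.rpow_def_of_pos hp0]
    apply Real.exp_le_exp.2
    rw [mul_one_div, div_le_one hv0]
    exact hlog
  -- There are at most `log m / log 2` prime factors beyond `e^v`.
  have h2 : ∑ p ∈ m.primeFactors.filter (fun p => ⌊Real.exp v⌋₊ < p), (p : ℝ) ^ (1 / v - 1) ≤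
      3 * 2 := by
    have hcard : ((m.primeFactors.filter (fun p => ⌊Real.exp v⌋₊ < p)).card : ℝ) ≤
        2 * Real.exp v := by
      have h3 : 2 ^ m.primeFactors.card ≤ m := by
        calc 2 ^ m.primeFactors.card ≤ ∏ p ∈ m.primeFactors, p :=
              pow_card_le_prod _ _ _ fun p hp => (Nat.prime_of_mem_primeFactors hp).two_le
          _ ≤ m := Nat.le_of_dvd (Nat.pos_of_ne_zero hm) (Nat.prod_primeFactors_dvd m)
      have h4 : (m.primeFactors.card : ℝ) * Real.log 2 ≤ Real.log m := by
        rw [← Real.log_pow]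
        exact Real.log_le_log (by positivity) (by exact_mod_cast h3)
      have h5 : ((m.primeFactors.filter (fun p => ⌊Real.exp v⌋₊ < p)).card : ℝ) ≤
          m.primeFactors.card := by exact_mod_cast card_filter_le _ _
      nlinarith [Real.log_two_gt_d9]
    calc _ ≤ ∑ p ∈ m.primeFactors.filter (fun p => ⌊Real.exp v⌋₊ < p), 3 * Real.exp (-v) := by
          refine sum_le_sum fun p hp => ?_
          rw [mem_filter] at hp
          have hp0 : (0 : ℝ) < p := by
            exact_mod_cast (Nat.prime_of_mem_primeFactors hp.1).pos
          have hlog : Real.exp v ≤ p := (Nat.lt_of_floor_lt hp.2).le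
          calc (p : ℝ) ^ (1 / v - 1) ≤ (Real.exp v) ^ (1 / v - 1) :=
                Real.rpow_le_rpow_of_nonpos (Real.exp_pos v) hlog (by
                  rw [sub_nonpos, div_le_one hv0]; linarith)
            _ = Real.exp 1 * Real.exp (-v) := by
                rw [← Real.exp_mul, ← Real.exp_add]; congr 1; field_simp; ring
            _ ≤ _ := by gcongr
      _ = ((m.primeFactors.filter (fun p => ⌊Real.exp v⌋₊ < p)).card : ℝ) * (3 * Real.exp (-v)) := by
          rw [sum_const, nsmul_eq_mul]
      _ ≤ 2 * Real.exp v * (3 * Real.exp (-v)) := by gcongr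
      _ = 3 * 2 * (Real.exp v * Real.exp (-v)) := by ring
      _ = _ := by rw [← Real.exp_add]; simp
  linarith

/-- The convergence bound needed to compare Riesz means: with exceptional primes those up to `e^v`
and those dividing `m`, the sum `∑ |r(n)| (1 + log n)` is at most a fixed power of `v`. -/
theorem exists_tsum_abs_mul_one_add_log_le (D : ℝ) (hD : 0 ≤ D) (q : ℕ) :
    ∃ B : ℕ, ∀ (r : ArithmeticFunction ℝ) (v : ℝ) (m : ℕ),
      r.IsMultiplicative → 4 ≤ v → m ≠ 0 → Real.log m ≤ Real.exp v →
      (∀ p : ℕ, p.Prime → ∀ j : ℕ, 1 ≤ j → |r (p ^ j)| ≤ D * ((j : ℝ) + 1) ^ q / (p : ℝ) ^ j) →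
      (∀ p : ℕ, p.Prime → Real.exp v < p → ¬ p ∣ m → |r p| ≤ D / (p : ℝ) ^ 2) →
      Summable (fun n : ℕ => |r n| * (1 + Real.log n)) ∧
      ∑' n : ℕ, |r n| * (1 + Real.log n) ≤ v ^ B := by
  obtain ⟨D', hD'0, hD'⟩ := exists_tsum_abs_mul_rpow_le D hD q
  -- `1 + 3 (36 log v + 22) ≤ 176 log v` as `log v ≥ 1`; two more powers pay for `1 + v ≤ v^2`.
  refine ⟨⌈176 * D'⌉₊ + 2, fun r v m hr hv hm hmv hrp hgood => ?_⟩
  have hv0 : 0 < v := by linarith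
  obtain ⟨hs, ht⟩ := hD' r (badPrimes v m) (1 / v) hr (by positivity)
    (one_div_le_one_div_of_le (by norm_num) hv) hrp (fun p hp hb => by
      rw [badPrimes, mem_union, not_or, mem_filter, mem_Ioc, Nat.mem_primeFactors] at hb
      refine hgood p hp ?_ fun h => hb.2 ⟨hp, h, hm⟩
      by_contra hcon
      exact hb.1 ⟨⟨hp.pos, (Nat.le_floor_iff (Real.exp_pos v).le).2 (not_lt.1 hcon)⟩, hp⟩)
  have hpt : ∀ n : ℕ, |r n| * (1 + Real.log n) ≤ (1 + v) * (|r n| * (n : ℝ) ^ (1 / v)) := by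
    intro n
    rcases Nat.eq_zero_or_pos n with rfl | hn
    · simp
    have hn1 : (1 : ℝ) ≤ n := by exact_mod_cast hn
    have h1 : Real.log n ≤ (n : ℝ) ^ (1 / v) * v := by
      have := Real.log_le_rpow_div (x := n) (by positivity) (ε := 1 / v) (by positivity)
      rwa [div_div_eq_mul_div, div_one] at this
    have h2 : 1 ≤ (n : ℝ) ^ (1 / v) := Real.one_le_rpow hn1 (by positivity)
    have h3 : 1 + Real.log n ≤ (1 + v) * (n : ℝ) ^ (1 / v) := by linarith
    calc _ ≤ |r n| * ((1 + v) * (n : ℝ) ^ (1 / v)) := by gcongr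
      _ = _ := by ring
  have hs' : Summable (fun n : ℕ => |r n| * (1 + Real.log n)) :=
    Summable.of_nonneg_of_le (fun n => mul_nonneg (abs_nonneg _)
      (by linarith [Real.log_natCast_nonneg n])) hpt (hs.mul_left _)
  refine ⟨hs', (hs'.tsum_le_tsum hpt (hs.mul_left _)).trans ?_⟩
  rw [tsum_mul_left]
  have hlogv : 1 ≤ Real.log v := by
    rw [Real.le_log_iff_exp_le hv0]; linarith [Real.exp_one_lt_d9]
  have hE := sum_badPrimes_rpow_le hv hm hmv
  have h4 : Real.exp (D' * (1 + ∑ p ∈ badPrimes v m, (p : ℝ) ^ (1 / v - 1))) ≤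
      v ^ ⌈176 * D'⌉₊ := by
    calc _ ≤ Real.exp (Real.log v * (⌈176 * D'⌉₊ : ℝ)) := by
          apply Real.exp_le_exp.2
          calc _ ≤ D' * (176 * Real.log v) := by
                gcongr
                linarith
            _ = Real.log v * (176 * D') := by ring
            _ ≤ _ := by gcongr; exact Nat.le_ceil _
      _ = _ := by rw [← Real.rpow_def_of_pos hv0, Real.rpow_natCast]
  calc _ ≤ (1 + v) * v ^ ⌈176 * D'⌉₊ := by
        gcongr
        exact ht.trans h4
    _ ≤ v ^ 2 * v ^ ⌈176 * D'⌉₊ := by gcongr; nlinarith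
    _ = _ := by rw [← pow_add, add_comm]

/-! ### Euler factors -/

/-- The Euler factor of `f` at `p` converges absolutely, to `c`. -/
def HasEulerFactor (f : ArithmeticFunction ℝ) (p : ℕ) (c : ℝ) : Prop :=
  Summable (fun e : ℕ => ‖f (p ^ e)‖) ∧ ∑' e : ℕ, f (p ^ e) = c

theorem HasEulerFactor.mul {f g : ArithmeticFunction ℝ} {p : ℕ} {c d : ℝ} (hp : p.Prime)
    (hf : HasEulerFactor f p c) (hg : HasEulerFactor g p d) : HasEulerFactor (f * g) p (c * d) := by
  constructor
  · simp_rw [mul_apply_prime_pow f g hp]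
    exact summable_norm_sum_mul_range_of_summable_norm (f := fun e => f (p ^ e))
      (g := fun e => g (p ^ e)) hf.1 hg.1
  · simp_rw [mul_apply_prime_pow f g hp]
    rw [← hf.2, ← hg.2]
    exact (tsum_mul_tsum_eq_tsum_sum_range_of_summable_norm (f := fun e => f (p ^ e))
      (g := fun e => g (p ^ e)) hf.1 hg.1).symm

theorem hasEulerFactor_of_support {f : ArithmeticFunction ℝ} {p : ℕ}
    (hf : ∀ j : ℕ, f (p ^ (j + 2)) = 0) : HasEulerFactor f p (f 1 + f p) := by
  have h0 : ∀ e, e ∉ range 2 → f (p ^ e) = 0 := by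
    intro e he
    rw [mem_range, not_lt] at he
    obtain ⟨j, rfl⟩ := Nat.exists_eq_add_of_le' he
    exact hf j
  refine ⟨summable_of_ne_finset_zero (s := range 2) fun e he => by rw [h0 e he, norm_zero], ?_⟩
  rw [tsum_eq_sum h0, sum_range_succ, sum_range_one, pow_zero, pow_one]

theorem hasEulerFactor_sqfreeMul (t : ℕ → ℝ) {p : ℕ} (hp : p.Prime) :
    HasEulerFactor (sqfreeMul t) p (1 + t p) := by
  have := hasEulerFactor_of_support (sqfreeMul_prime_pow t hp)
  rwa [(isMultiplicative_sqfreeMul t).map_one, sqfreeMul_prime t hp] at this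

theorem hasEulerFactor_moebiusDiv {p : ℕ} (hp : p.Prime) :
    HasEulerFactor moebiusDiv p (1 - 1 / p) := by
  have := hasEulerFactor_of_support (f := moebiusDiv) (p := p) (fun j => by
    rw [moebiusDiv_apply, moebius_eq_zero_of_not_squarefree]
    · simp
    · rw [Nat.squarefree_pow_iff hp.ne_one (by omega)]; omega)
  rw [isMultiplicative_moebiusDiv.map_one, moebiusDiv_apply, moebius_apply_prime hp] at this
  convert this using 1
  push_cast; ring

theorem hasEulerFactor_invArith {p : ℕ} (hp : p.Prime) :
    HasEulerFactor invArith p (1 - 1 / p)⁻¹ := by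
  have hp1 : (1 : ℝ) < p := by exact_mod_cast hp.one_lt
  have h : ∀ e : ℕ, invArith (p ^ e) = (1 / (p : ℝ)) ^ e := fun e => by
    rw [invArith_apply, Nat.cast_pow, one_div, inv_pow]
  have h1 : ‖(1 / (p : ℝ))‖ < 1 := by
    rw [Real.norm_of_nonneg (by positivity), div_lt_one (by linarith)]; exact hp1
  constructor
  · simp_rw [h, norm_pow]
    exact summable_geometric_of_lt_one (norm_nonneg _) h1
  · simp_rw [h]
    exact tsum_geometric_of_norm_lt_one h1

theorem HasEulerFactor.pow {f : ArithmeticFunction ℝ} {p : ℕ} {c : ℝ} (hp : p.Prime)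
    (hf : HasEulerFactor f p c) (κ : ℕ) : HasEulerFactor (f ^ κ) p (c ^ κ) := by
  induction κ with
  | zero =>
    have := hasEulerFactor_of_support (f := 1) (p := p) (fun j => one_apply_ne (by
      simp [hp.ne_one]))
    rw [one_one, one_apply_ne hp.ne_one, add_zero] at this
    simpa using this
  | succ κ ih => rw [pow_succ, pow_succ]; exact ih.mul hp hf

/-! ### Riesz means of multiplicative functions supported on squarefree integers -/

/-- If `β` cancels `t` to first order at the primes beyond `e^v` not dividing `m`, the Dirichlet
product `sqfreeMul t * β` is absolutely summable against `1 + log n`, with sum at most a power of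
`v`. -/
theorem exists_tsum_abs_sqfreeMul_mul_le (κ : ℕ) {D : ℝ} (hD : 0 ≤ D) :
    ∃ B : ℕ, ∀ (t : ℕ → ℝ) (β : ArithmeticFunction ℝ) (v : ℝ) (m : ℕ),
      β.IsMultiplicative →
      (∀ p : ℕ, p.Prime → ∀ j : ℕ, |β (p ^ j)| ≤ ((j : ℝ) + 1) ^ κ / (p : ℝ) ^ j) →
      4 ≤ v → m ≠ 0 → Real.log m ≤ Real.exp v →
      (∀ p : ℕ, p.Prime → |t p| ≤ D / p) →
      (∀ p : ℕ, p.Prime → Real.exp v < p → ¬ p ∣ m → |t p + β p| ≤ D / (p : ℝ) ^ 2) →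
      Summable (fun n : ℕ => |(sqfreeMul t * β) n| * (1 + Real.log n)) ∧
      ∑' n : ℕ, |(sqfreeMul t * β) n| * (1 + Real.log n) ≤ v ^ B := by
  obtain ⟨B, hB⟩ := exists_tsum_abs_mul_one_add_log_le (1 + D) (by linarith) κ
  refine ⟨B, fun t β v m hβ hβp hv hm hmv ht htg => ?_⟩
  refine hB _ v m ((isMultiplicative_sqfreeMul t).mul hβ) hv hm hmv ?_ ?_
  · intro p hp j hj
    have hp0 : (0 : ℝ) < p := by exact_mod_cast hp.pos
    obtain ⟨i, rfl⟩ := Nat.exists_eq_add_of_le' hj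
    rw [sqfreeMul_mul_prime_pow_succ t β hp]
    refine (abs_add_le _ _).trans ?_
    rw [abs_mul]
    calc _ ≤ (((i + 1 : ℕ) : ℝ) + 1) ^ κ / (p : ℝ) ^ (i + 1) +
          D / p * (((i : ℝ) + 1) ^ κ / (p : ℝ) ^ i) := by
          gcongr
          · exact hβp p hp (i + 1)
          · exact ht p hp
          · exact hβp p hp i
      _ ≤ (((i + 1 : ℕ) : ℝ) + 1) ^ κ / (p : ℝ) ^ (i + 1) +
          D / p * ((((i + 1 : ℕ) : ℝ) + 1) ^ κ / (p : ℝ) ^ i) := by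
          gcongr
          linarith
      _ = _ := by rw [pow_succ]; field_simp
  · intro p hp hpv hpm
    have h := sqfreeMul_mul_prime_pow_succ t β hp 0
    rw [zero_add, pow_one, pow_zero, hβ.map_one, mul_one] at h
    rw [h, add_comm]
    refine (htg p hp hpv hpm).trans ?_
    gcongr
    linarith

theorem rieszSum_invArith_pow_zero_le (κ : ℕ) {u : ℝ} (hu : 0 ≤ u) :
    rieszSum (invArith ^ κ) 0 u ≤ (1 + u) ^ κ := by
  induction κ generalizing u with
  | zero => simp [rieszSum_one 0 hu]
  | succ κ ih =>
    rw [pow_succ', rieszSum_mul, pow_succ']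
    refine le_trans ?_ (mul_le_mul_of_nonneg_right (rieszSum_invArith_zero_le hu) (by positivity))
    rw [rieszSum, sum_mul]
    refine sum_le_sum fun d hd => ?_
    rw [mem_Ioc] at hd
    have hd2 := (le_floor_exp_iff hd.1 u).1 hd.2
    have hl : 0 ≤ Real.log d := Real.log_natCast_nonneg d
    simp only [pow_zero, Nat.factorial_zero, Nat.cast_one, div_one, mul_one]
    refine mul_le_mul_of_nonneg_left ?_ (by rw [invArith_apply]; positivity)
    refine (ih (by linarith)).trans ?_
    have : 0 ≤ 1 + (u - Real.log d) := by linarith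
    gcongr
    linarith

theorem rieszSum_invArith_pow_nonneg (κ a : ℕ) (u : ℝ) : 0 ≤ rieszSum (invArith ^ κ) a u := by
  rw [rieszSum_eq_sum_truncPow _ _ le_rfl]
  exact sum_nonneg fun n _ => mul_nonneg (invArith_pow_nonneg κ n) (truncPow_nonneg _ _)

theorem invArith_mul_moebiusDiv_pow (κ : ℕ) : invArith ^ κ * moebiusDiv ^ κ = 1 := by
  rw [← mul_pow, mul_comm, moebiusDiv_mul_invArith, one_pow]

theorem abs_tsum_le_of_tsum_abs_mul_le {r : ArithmeticFunction ℝ} {K : ℝ}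
    (hs : Summable fun n => |r n| * (1 + Real.log n))
    (hK : ∑' n, |r n| * (1 + Real.log n) ≤ K) : Summable (fun n => ‖r n‖) ∧ ∑' n, |r n| ≤ K := by
  have hpt : ∀ n : ℕ, |r n| ≤ |r n| * (1 + Real.log n) := fun n =>
    le_mul_of_one_le_right (abs_nonneg _) (by linarith [Real.log_natCast_nonneg n])
  have h1 : Summable fun n => |r n| := Summable.of_nonneg_of_le (fun n => abs_nonneg _) hpt hs
  exact ⟨h1, (h1.tsum_le_tsum hpt hs).trans hK⟩

/-- Riesz means of a multiplicative function supported on squarefree integers that behaves like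
`-κ/p` at all primes beyond `e^v` not dividing `m`. The hypothesis on the
powers of `μ(n)/n` carries the information on primes. -/
theorem exists_rieszSum_sqfreeMul_neg (κ : ℕ) {D : ℝ} (hD : 0 ≤ D) :
    ∃ B : ℕ, ∀ (t : ℕ → ℝ) (v : ℝ) (m : ℕ), 4 ≤ v → m ≠ 0 → Real.log m ≤ Real.exp v →
      (∀ p : ℕ, p.Prime → |t p| ≤ D / p) →
      (∀ p : ℕ, p.Prime → Real.exp v < p → ¬ p ∣ m → |t p + κ / p| ≤ D / (p : ℝ) ^ 2) →
      ∃ S : ℝ, HasProd (fun p : Nat.Primes => (1 + t p) * ((1 - 1 / ((p : ℕ) : ℝ)) ^ κ)⁻¹) S ∧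
        |S| ≤ v ^ B ∧
        ∀ (b : ℕ) (C : ℝ), 1 ≤ b → 0 ≤ C →
          (∀ u : ℝ, 0 ≤ u → |rieszSum (moebiusDiv ^ κ) (κ + b) u - u ^ b / (b ! : ℝ)| ≤
            C * (1 + u) ^ (b - 1)) →
          ∀ u : ℝ, 0 ≤ u → |rieszSum (sqfreeMul t) (κ + b) u - S * (u ^ b / (b ! : ℝ))| ≤
            (C + 1) * v ^ B * (1 + u) ^ (b - 1) := by
  obtain ⟨B, hB⟩ := exists_tsum_abs_sqfreeMul_mul_le κ hD
  refine ⟨B, fun t v m hv hm hmv ht htg => ?_⟩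
  obtain ⟨hs, hle⟩ := hB t (invArith ^ κ) v m isMultiplicative_invArith.pow
    (fun p hp j => by
      rw [abs_of_nonneg (invArith_pow_nonneg κ _)]; exact invArith_pow_prime_pow_le κ hp j)
    hv hm hmv ht (fun p hp h1 h2 => by rw [invArith_pow_prime κ hp]; exact htg p hp h1 h2)
  set r := sqfreeMul t * invArith ^ κ with hr
  have hrt : sqfreeMul t = r * moebiusDiv ^ κ := by
    rw [hr, mul_assoc, invArith_mul_moebiusDiv_pow, mul_one]
  have hrm : r.IsMultiplicative := (isMultiplicative_sqfreeMul t).mul isMultiplicative_invArith.pow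
  obtain ⟨hs1, hle1⟩ := abs_tsum_le_of_tsum_abs_mul_le hs hle
  refine ⟨∑' n, r n, ?_, ?_, ?_⟩
  · have h := IsMultiplicative.eulerProduct_hasProd hrm hs1
    have e : (fun p : Nat.Primes => (1 + t p) * ((1 - 1 / ((p : ℕ) : ℝ)) ^ κ)⁻¹) =
        fun p : Nat.Primes => ∑' e : ℕ, r ((p : ℕ) ^ e) := by
      funext p
      rw [((hasEulerFactor_sqfreeMul t p.2).mul p.2 ((hasEulerFactor_invArith p.2).pow p.2 κ)).2,
        inv_pow]
    rw [e]; exact h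
  · rw [← Real.norm_eq_abs]
    exact (norm_tsum_le_tsum_norm hs1).trans hle1
  · intro b C hb hC hβ u hu
    rw [hrt]
    exact abs_rieszSum_mul_sub r _ hb hC hβ hs hle hu

/-- Riesz means of a multiplicative function supported on squarefree integers that behaves like
`κ/p` at all primes beyond `e^v`. -/
theorem exists_rieszSum_sqfreeMul_pos (κ : ℕ) {D : ℝ} (hD : 0 ≤ D) :
    ∃ B : ℕ, ∀ (t : ℕ → ℝ) (v : ℝ), 4 ≤ v →
      (∀ p : ℕ, p.Prime → |t p| ≤ D / p) →
      (∀ p : ℕ, p.Prime → Real.exp v < p → |t p - κ / p| ≤ D / (p : ℝ) ^ 2) →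
      (∀ u : ℝ, 0 ≤ u → |rieszSum (sqfreeMul t) 0 u| ≤ v ^ B * (1 + u) ^ κ) ∧
      ∃ S : ℝ, HasProd (fun p : Nat.Primes => (1 + t p) * (1 - 1 / ((p : ℕ) : ℝ)) ^ κ) S ∧
        ∀ a : ℕ, 1 ≤ a → ∀ u : ℝ, 0 ≤ u →
          |rieszSum (sqfreeMul t) a u - S * (u ^ (κ + a) / ((κ + a)! : ℝ))| ≤
            (κ + 1) * v ^ B * (1 + u) ^ (κ + a - 1) := by
  obtain ⟨B, hB⟩ := exists_tsum_abs_sqfreeMul_mul_le κ hD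
  refine ⟨B, fun t v hv ht htg => ?_⟩
  obtain ⟨hs, hle⟩ := hB t (moebiusDiv ^ κ) v 1 isMultiplicative_moebiusDiv.pow
    (fun p hp j => (abs_moebiusDiv_pow_le κ _).trans (invArith_pow_prime_pow_le κ hp j))
    hv one_ne_zero (by simpa using (Real.exp_pos v).le) ht
    (fun p hp h1 _ => by
      rw [moebiusDiv_pow_prime κ hp, ← sub_eq_add_neg]; exact htg p hp h1)
  set r := sqfreeMul t * moebiusDiv ^ κ with hr
  have hrt : sqfreeMul t = r * invArith ^ κ := by
    rw [hr, mul_assoc, mul_comm (moebiusDiv ^ κ), invArith_mul_moebiusDiv_pow, mul_one]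
  have hrm : r.IsMultiplicative := (isMultiplicative_sqfreeMul t).mul isMultiplicative_moebiusDiv.pow
  obtain ⟨hs1, hle1⟩ := abs_tsum_le_of_tsum_abs_mul_le hs hle
  refine ⟨fun u hu => ?_, ∑' n, r n, ?_, ?_⟩
  · rw [hrt, rieszSum_mul]
    refine (abs_sum_le_sum_abs _ _).trans ?_
    calc _ ≤ ∑ d ∈ Ioc 0 ⌊Real.exp u⌋₊, |r d| * (1 + u) ^ κ := by
          refine sum_le_sum fun d hd => ?_
          rw [mem_Ioc] at hd
          have hd2 := (le_floor_exp_iff hd.1 u).1 hd.2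
          have hl : 0 ≤ Real.log d := Real.log_natCast_nonneg d
          rw [abs_mul, abs_of_nonneg (rieszSum_invArith_pow_nonneg _ _ _)]
          refine mul_le_mul_of_nonneg_left ?_ (abs_nonneg _)
          refine (rieszSum_invArith_pow_zero_le κ (by linarith)).trans ?_
          have : 0 ≤ 1 + (u - Real.log d) := by linarith
          gcongr
          linarith
      _ ≤ _ := by
          rw [← sum_mul]
          gcongr
          exact (hs1.sum_le_tsum _ fun n _ => abs_nonneg _).trans hle1
  · have h := IsMultiplicative.eulerProduct_hasProd hrm hs1
    have e : (fun p : Nat.Primes => (1 + t p) * (1 - 1 / ((p : ℕ) : ℝ)) ^ κ) =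
        fun p : Nat.Primes => ∑' e : ℕ, r ((p : ℕ) ^ e) := by
      funext p
      rw [((hasEulerFactor_sqfreeMul t p.2).mul p.2 ((hasEulerFactor_moebiusDiv p.2).pow p.2 κ)).2]
    rw [e]; exact h
  · intro a ha u hu
    rw [hrt]
    exact abs_rieszSum_mul_sub r _ (by omega) (Nat.cast_nonneg κ)
      (fun u hu => abs_rieszSum_invArith_pow_sub κ ha hu) hs hle hu

/-! ### Diagonalization of the quadratic form -/

theorem sqfreeMul_mul_of_coprime (t : ℕ → ℝ) {m n : ℕ} (h : m.Coprime n) :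
    sqfreeMul t (m * n) = sqfreeMul t m * sqfreeMul t n :=
  (isMultiplicative_sqfreeMul t).map_mul_of_coprime h

theorem sqfreeMul_mul_sqfreeMul (s t : ℕ → ℝ) (n : ℕ) :
    sqfreeMul s n * sqfreeMul t n = sqfreeMul (fun p => s p * t p) n := by
  simp only [sqfreeMul_apply]
  split_ifs with h
  · rw [prod_mul_distrib]
  · simp

/-- The multiplicative form of `g = g (1 - g) + g²`. -/
theorem sqfreeMul_eq_sum_divisors (g : ℕ → ℝ) {D : ℕ} (hD : Squarefree D) :
    sqfreeMul g D =
      ∑ m ∈ D.divisors, sqfreeMul (fun p => g p * (1 - g p)) m * (sqfreeMul g (D / m)) ^ 2 := by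
  have h := (isMultiplicative_sqfreeMul fun p => g p * (1 - g p)).prodPrimeFactors_add_of_squarefree
    (isMultiplicative_sqfreeMul fun p => g p * g p) hD
  rw [mul_apply, Nat.sum_divisorsAntidiagonal (f := fun a b =>
    sqfreeMul (fun p => g p * (1 - g p)) a * sqfreeMul (fun p => g p * g p) b)] at h
  simp_rw [sq, sqfreeMul_mul_sqfreeMul]
  rw [← h, prodPrimeFactors_apply hD.ne_zero, sqfreeMul_apply, if_pos hD]
  refine prod_congr rfl fun p hp => ?_
  have hp' := Nat.prime_of_mem_primeFactors hp
  rw [ArithmeticFunction.add_apply, sqfreeMul_prime _ hp', sqfreeMul_prime _ hp']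
  ring

theorem sqfreeMul_lcm (g : ℕ → ℝ) {d₁ d₂ : ℕ} (h₁ : Squarefree d₁) (h₂ : Squarefree d₂) :
    sqfreeMul g (d₁.lcm d₂) = ∑ m ∈ (d₁.gcd d₂).divisors,
      sqfreeMul (fun p => g p * (1 - g p)) m * (sqfreeMul g (d₁ / m) * sqfreeMul g (d₂ / m)) := by
  set D := d₁.gcd d₂ with hD
  obtain ⟨x, hx⟩ := Nat.gcd_dvd_left d₁ d₂
  obtain ⟨y, hy⟩ := Nat.gcd_dvd_right d₁ d₂
  rw [← hD] at hx hy
  have hDpos : 0 < D := Nat.gcd_pos_of_pos_left _ h₁.ne_zero.bot_lt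
  have hDx : D.Coprime x := Nat.coprime_of_squarefree_mul (hx ▸ h₁)
  have hDy : D.Coprime y := Nat.coprime_of_squarefree_mul (hy ▸ h₂)
  have hxy : x.Coprime y := by
    have : D * x.gcd y = D * 1 := by
      rw [← Nat.gcd_mul_left, ← hx, ← hy, mul_one]
    exact Nat.eq_of_mul_eq_mul_left hDpos this
  have hDs : Squarefree D := h₁.squarefree_of_dvd (Nat.gcd_dvd_left _ _)
  have hlcm : d₁.lcm d₂ = D * (x * y) := by
    rw [Nat.lcm, ← hD, hx, hy]
    rw [show D * x * (D * y) = D * (D * (x * y)) by ring, Nat.mul_div_cancel_left _ hDpos]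
  rw [hlcm, sqfreeMul_mul_of_coprime _ (hDx.mul_right hDy), sqfreeMul_mul_of_coprime _ hxy,
    sqfreeMul_eq_sum_divisors g hDs, sum_mul]
  refine sum_congr rfl fun m hm => ?_
  obtain ⟨z, hz⟩ := Nat.dvd_of_mem_divisors hm
  have hmpos : 0 < m := Nat.pos_of_mem_divisors hm
  have e1 : d₁ / m = z * x := by
    rw [hx, hz, mul_assoc, Nat.mul_div_cancel_left _ hmpos]
  have e2 : d₂ / m = z * y := by
    rw [hy, hz, mul_assoc, Nat.mul_div_cancel_left _ hmpos]
  have e3 : D / m = z := by rw [hz, Nat.mul_div_cancel_left _ hmpos]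
  have hzD : z ∣ D := ⟨m, by rw [hz]; ring⟩
  rw [e1, e2, e3, sqfreeMul_mul_of_coprime _ (hDx.coprime_dvd_left hzD),
    sqfreeMul_mul_of_coprime _ (hDy.coprime_dvd_left hzD)]
  ring

/-- Diagonalization: `sqfreeMul_lcm` turns the form into a sum of squares over the common divisor
`m`. -/
theorem sum_lcm_eq_sum_sq (g w : ℕ → ℝ) (hw : ∀ d, ¬ Squarefree d → w d = 0) (N : ℕ) :
    ∑ d₁ ∈ Ioc 0 N, ∑ d₂ ∈ Ioc 0 N, w d₁ * w d₂ * sqfreeMul g (d₁.lcm d₂) =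
      ∑ m ∈ Ioc 0 N, sqfreeMul (fun p => g p * (1 - g p)) m *
        (∑ e ∈ Ioc 0 (N / m), w (m * e) * sqfreeMul g e) ^ 2 := by
  have h1 : ∀ d₁ ∈ Ioc 0 N, ∀ d₂ ∈ Ioc 0 N, w d₁ * w d₂ * sqfreeMul g (d₁.lcm d₂) =
      ∑ m ∈ Ioc 0 N, sqfreeMul (fun p => g p * (1 - g p)) m *
        ((if m ∣ d₁ then w d₁ * sqfreeMul g (d₁ / m) else 0) *
          (if m ∣ d₂ then w d₂ * sqfreeMul g (d₂ / m) else 0)) := by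
    intro d₁ hd₁ d₂ hd₂
    by_cases s₁ : Squarefree d₁
    swap
    · simp [hw d₁ s₁]
    by_cases s₂ : Squarefree d₂
    swap
    · simp [hw d₂ s₂]
    rw [mem_Ioc] at hd₁ hd₂
    rw [sqfreeMul_lcm g s₁ s₂, mul_sum]
    have hsub : (d₁.gcd d₂).divisors ⊆ Ioc 0 N := by
      intro m hm
      exact mem_Ioc.2 ⟨Nat.pos_of_mem_divisors hm, (Nat.le_of_dvd hd₁.1
        ((Nat.dvd_of_mem_divisors hm).trans (Nat.gcd_dvd_left _ _))).trans hd₁.2⟩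
    rw [← sum_subset hsub]
    · refine sum_congr rfl fun m hm => ?_
      have := Nat.dvd_of_mem_divisors hm
      rw [if_pos (this.trans (Nat.gcd_dvd_left _ _)), if_pos (this.trans (Nat.gcd_dvd_right _ _))]
      ring
    · intro m _ hm
      rw [Nat.mem_divisors, not_and_or] at hm
      have h3 : d₁.gcd d₂ ≠ 0 := (Nat.gcd_pos_of_pos_left _ hd₁.1).ne'
      have h4 : ¬ (m ∣ d₁ ∧ m ∣ d₂) := fun h => hm.elim (fun h' => h' (Nat.dvd_gcd h.1 h.2))
        (fun h' => h' h3)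
      rcases not_and_or.1 h4 with h | h
      · rw [if_neg h]; ring
      · rw [if_neg h]; ring
  rw [sum_congr rfl fun d₁ hd₁ => sum_congr rfl fun d₂ hd₂ => h1 d₁ hd₁ d₂ hd₂]
  have h2 : ∀ m ∈ Ioc 0 N, ∑ e ∈ Ioc 0 (N / m), w (m * e) * sqfreeMul g e =
      ∑ d ∈ Ioc 0 N, if m ∣ d then w d * sqfreeMul g (d / m) else 0 := by
    intro m hm
    rw [mem_Ioc] at hm
    rw [← sum_filter]
    refine sum_nbij' (fun e => m * e) (fun d => d / m) ?_ ?_ ?_ ?_ ?_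
    · intro e he
      rw [mem_Ioc] at he
      rw [mem_filter, mem_Ioc]
      refine ⟨⟨Nat.mul_pos hm.1 he.1, ?_⟩, dvd_mul_right _ _⟩
      rw [mul_comm]; exact (Nat.le_div_iff_mul_le hm.1).1 he.2
    · intro d hd
      rw [mem_filter, mem_Ioc] at hd
      exact mem_Ioc.2 ⟨Nat.div_pos (Nat.le_of_dvd hd.1.1 hd.2) hm.1, Nat.div_le_div_right hd.1.2⟩
    · intro e _
      exact Nat.mul_div_cancel_left _ hm.1
    · intro d hd
      exact Nat.mul_div_cancel' (mem_filter.1 hd).2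
    · intro e _
      rw [Nat.mul_div_cancel_left _ hm.1]
  have h3 : ∀ m ∈ Ioc 0 N, sqfreeMul (fun p => g p * (1 - g p)) m *
        (∑ e ∈ Ioc 0 (N / m), w (m * e) * sqfreeMul g e) ^ 2 =
      ∑ d₁ ∈ Ioc 0 N, ∑ d₂ ∈ Ioc 0 N, sqfreeMul (fun p => g p * (1 - g p)) m *
        ((if m ∣ d₁ then w d₁ * sqfreeMul g (d₁ / m) else 0) *
          (if m ∣ d₂ then w d₂ * sqfreeMul g (d₂ / m) else 0)) := by
    intro m hm
    rw [h2 m hm, sq, sum_mul_sum, mul_sum]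
    exact sum_congr rfl fun d₁ _ => by rw [mul_sum]
  rw [sum_congr rfl h3]
  symm
  rw [sum_comm]
  refine sum_congr rfl fun d₁ _ => ?_
  rw [sum_comm]

/-- The local densities of the sum over `e` coprime to `m`, with the sign of the Möbius function. -/
noncomputable def coprimeNeg (g : ℕ → ℝ) (m p : ℕ) : ℝ := if p ∣ m then 0 else -g p

theorem sqfreeMul_coprimeNeg (g : ℕ → ℝ) (m e : ℕ) :
    sqfreeMul (coprimeNeg g m) e = if m.Coprime e then (moebius e : ℝ) * sqfreeMul g e else 0 := by
  by_cases he : Squarefree e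
  swap
  · simp [sqfreeMul_apply, he]
  rw [sqfreeMul_apply, sqfreeMul_apply, if_pos he, if_pos he]
  split_ifs with h
  · have h1 : ∏ p ∈ e.primeFactors, coprimeNeg g m p = ∏ p ∈ e.primeFactors, -g p := by
      refine prod_congr rfl fun p hp => ?_
      rw [coprimeNeg, if_neg]
      intro hpm
      have := Nat.dvd_gcd hpm (Nat.dvd_of_mem_primeFactors hp)
      rw [h] at this
      exact (Nat.prime_of_mem_primeFactors hp).one_lt.ne' (Nat.dvd_one.1 this)
    rw [h1, prod_neg, moebius_apply_of_squarefree he,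
      ← (cardDistinctFactors_eq_cardFactors_iff_squarefree he.ne_zero).2 he, cardDistinctFactors_apply]
    push_cast
    rfl
  · obtain ⟨p, hp, hpm, hpe⟩ := Nat.Prime.not_coprime_iff_dvd.1 h
    exact prod_eq_zero (Nat.mem_primeFactors.2 ⟨hp, hpe, he.ne_zero⟩) (by rw [coprimeNeg, if_pos hpm])

theorem sieveWeight_of_not_squarefree (R : ℝ) {d : ℕ} (a : ℕ) (hd : ¬ Squarefree d) :
    sieveWeight R d a = 0 := by
  rw [sieveWeight, moebius_eq_zero_of_not_squarefree hd]
  simp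

theorem sum_sieveWeight_eq_rieszSum (g : ℕ → ℝ) (a : ℕ) {R : ℝ} (hR : 1 ≤ R) {m : ℕ} (hm : 0 < m) :
    ∑ e ∈ Ioc 0 (⌊R⌋₊ / m), sieveWeight R (m * e) a * sqfreeMul g e =
      moebius m * rieszSum (sqfreeMul (coprimeNeg g m)) a (Real.log R - Real.log m) := by
  have hR0 : 0 < R := by linarith
  rw [rieszSum, floor_exp_sub_log hm, Real.exp_log hR0, mul_sum]
  refine sum_congr rfl fun e he => ?_
  rw [mem_Ioc] at he
  have hm0 : (0 : ℝ) < m := by exact_mod_cast hm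
  have he0 : (0 : ℝ) < e := by exact_mod_cast he.1
  have hle : ((m * e : ℕ) : ℝ) ≤ R := by
    rw [← Nat.le_floor_iff hR0.le, mul_comm]
    exact (Nat.le_div_iff_mul_le hm).1 he.2
  rw [sieveWeight, if_pos hle, sqfreeMul_coprimeNeg]
  have hlog : Real.log (R / ((m * e : ℕ) : ℝ)) = Real.log R - Real.log m - Real.log e := by
    push_cast
    rw [Real.log_div hR0.ne' (by positivity), Real.log_mul hm0.ne' he0.ne', sub_sub]
  rw [hlog]
  split_ifs with h
  · rw [isMultiplicative_moebius.map_mul_of_coprime h]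
    push_cast
    ring
  · have : ¬ Squarefree (m * e) := fun h' => h (Nat.coprime_of_squarefree_mul h')
    rw [moebius_eq_zero_of_not_squarefree this]
    simp

/-- The diagonal form of the quadratic form of the sieve weights. -/
theorem sum_sieveWeight_lcm_eq (g : ℕ → ℝ) (a : ℕ) {R : ℝ} (hR : 1 ≤ R) :
    ∑ d₁ ∈ Ioc 0 ⌊R⌋₊, ∑ d₂ ∈ Ioc 0 ⌊R⌋₊,
        sieveWeight R d₁ a * sieveWeight R d₂ a * sqfreeMul g (d₁.lcm d₂) =
      ∑ m ∈ Ioc 0 ⌊R⌋₊, sqfreeMul (fun p => g p * (1 - g p)) m *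
        (rieszSum (sqfreeMul (coprimeNeg g m)) a (Real.log R - Real.log m)) ^ 2 := by
  rw [sum_lcm_eq_sum_sq g (fun d => sieveWeight R d a)
    (fun d hd => sieveWeight_of_not_squarefree R a hd)]
  refine sum_congr rfl fun m hm => ?_
  rw [mem_Ioc] at hm
  rw [sum_sieveWeight_eq_rieszSum g a hR hm.1]
  by_cases hs : Squarefree m
  · have : ((moebius m : ℤ) : ℝ) ^ 2 = 1 := by exact_mod_cast moebius_sq_eq_one_of_squarefree hs
    rw [mul_pow, this, one_mul]
  · rw [sqfreeMul_apply, if_neg hs, zero_mul, zero_mul]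

/-! ### Local densities -/

/-- The local density at `p` of the sieve problem: among the residue classes `n mod p` with `n + h`
invertible, for a fixed `h ∈ 𝓖`, the proportion of those for which `∏_{h' ∈ 𝓖} (n + h') = 0`. -/
noncomputable def localDensity (𝓖 : Finset ℕ) (p : ℕ) : ℝ :=
  (((Omega 𝓖 p).card : ℝ) - 1) / ((p : ℝ) - 1)

section

variable {𝓖 : Finset ℕ} {κ p : ℕ}

theorem one_le_card_omega (h𝓖 : 𝓖.card = κ + 1) (p : ℕ) : 1 ≤ (Omega 𝓖 p).card := by
  rw [Nat.one_le_iff_ne_zero, Finset.card_ne_zero, Omega, Finset.image_nonempty]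
  exact Finset.card_pos.1 (by omega)

theorem card_omega_le (h𝓖 : 𝓖.card = κ + 1) (p : ℕ) : (Omega 𝓖 p).card ≤ κ + 1 :=
  card_image_le.trans h𝓖.le

theorem card_omega_le_self (𝓖 : Finset ℕ) (hp : p.Prime) : (Omega 𝓖 p).card ≤ p := by
  have : NeZero p := ⟨hp.ne_zero⟩
  exact (card_le_univ _).trans (ZMod.card p).le

theorem localDensity_nonneg (h𝓖 : 𝓖.card = κ + 1) (hp : p.Prime) : 0 ≤ localDensity 𝓖 p := by
  have h1 : (1 : ℝ) ≤ (Omega 𝓖 p).card := by exact_mod_cast one_le_card_omega h𝓖 p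
  have h2 : (1 : ℝ) ≤ p := by exact_mod_cast hp.one_le
  exact div_nonneg (by linarith) (by linarith)

theorem localDensity_le_one (𝓖 : Finset ℕ) (hp : p.Prime) : localDensity 𝓖 p ≤ 1 := by
  have h1 : ((Omega 𝓖 p).card : ℝ) ≤ p := by exact_mod_cast card_omega_le_self 𝓖 hp
  have h2 : (1 : ℝ) < p := by exact_mod_cast hp.one_lt
  exact (div_le_one (by linarith)).2 (by linarith)

theorem localDensity_le (h𝓖 : 𝓖.card = κ + 1) (hp : p.Prime) : localDensity 𝓖 p ≤ 2 * κ / p := by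
  have h1 : ((Omega 𝓖 p).card : ℝ) ≤ κ + 1 := by exact_mod_cast card_omega_le h𝓖 p
  have h2 : (2 : ℝ) ≤ p := by exact_mod_cast hp.two_le
  rw [localDensity, div_le_div_iff₀ (by linarith) (by linarith)]
  have : (0 : ℝ) ≤ κ := Nat.cast_nonneg κ
  nlinarith

theorem localDensity_of_lt (h𝓖 : 𝓖.card = κ + 1) (hlt : ∀ h ∈ 𝓖, h < p) :
    localDensity 𝓖 p = κ / ((p : ℝ) - 1) := by
  rw [localDensity, omega_card_eq hlt, h𝓖]
  push_cast
  ring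

theorem abs_localDensity_sub_le (h𝓖 : 𝓖.card = κ + 1) (hp : p.Prime) (hlt : ∀ h ∈ 𝓖, h < p) :
    |localDensity 𝓖 p - κ / p| ≤ 2 * κ / (p : ℝ) ^ 2 := by
  have h2 : (2 : ℝ) ≤ p := by exact_mod_cast hp.two_le
  have h3 : (p : ℝ) - 1 ≠ 0 := by linarith
  have h4 : (p : ℝ) ≠ 0 := by linarith
  have hκ : (0 : ℝ) ≤ κ := Nat.cast_nonneg κ
  have e : localDensity 𝓖 p - κ / p = κ / (p * ((p : ℝ) - 1)) := by
    rw [localDensity_of_lt h𝓖 hlt]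
    field_simp
    ring
  have h5 : 0 < (p : ℝ) * ((p : ℝ) - 1) := mul_pos (by linarith) (by linarith)
  rw [e, abs_of_nonneg (by positivity), div_le_div_iff₀ h5 (by positivity)]
  have : (p : ℝ) ^ 2 ≤ 2 * (p * ((p : ℝ) - 1)) := by nlinarith
  nlinarith

theorem singularFactor_eq (h𝓖 : 𝓖.card = κ + 1) (hp : p.Prime) :
    singularFactor 𝓖 p = (1 - localDensity 𝓖 p) * ((1 - 1 / (p : ℝ)) ^ κ)⁻¹ := by
  have h2 : (2 : ℝ) ≤ p := by exact_mod_cast hp.two_le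
  have h3 : (p : ℝ) - 1 ≠ 0 := by linarith
  have h4 : (p : ℝ) ≠ 0 := by linarith
  have h5 : 1 - 1 / (p : ℝ) = ((p : ℝ) - 1) / p := by field_simp
  have h6 : 1 - 1 / (p : ℝ) ≠ 0 := by rw [h5]; positivity
  rw [singularFactor, h𝓖, pow_succ, mul_inv, ← mul_assoc, mul_right_comm]
  congr 1
  rw [h5, localDensity]
  field_simp
  ring

theorem localDensity_div_one_sub (hp : p.Prime) :
    localDensity 𝓖 p / (1 - localDensity 𝓖 p) =
      (((Omega 𝓖 p).card : ℝ) - 1) / ((p : ℝ) - (Omega 𝓖 p).card) := by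
  have h2 : (2 : ℝ) ≤ p := by exact_mod_cast hp.two_le
  have h3 : (p : ℝ) - 1 ≠ 0 := by linarith
  have e : 1 - localDensity 𝓖 p = ((p : ℝ) - (Omega 𝓖 p).card) / ((p : ℝ) - 1) := by
    rw [localDensity]; field_simp; ring
  rw [e, localDensity, div_div_div_cancel_right₀ h3]

theorem abs_localDensity_div_le (h𝓖 : 𝓖.card = κ + 1) (hp : p.Prime)
    (hne : localDensity 𝓖 p ≠ 1) :
    |localDensity 𝓖 p / (1 - localDensity 𝓖 p)| ≤ 2 * κ * (κ + 1) / p := by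
  have h0 := localDensity_nonneg h𝓖 hp
  have h1 := localDensity_le_one 𝓖 hp
  have hlt : (Omega 𝓖 p).card < p := by
    refine lt_of_le_of_ne (card_omega_le_self 𝓖 hp) fun h => hne ?_
    have h2 : (2 : ℝ) ≤ p := by exact_mod_cast hp.two_le
    rw [localDensity, h, div_self (by linarith)]
  rw [abs_of_nonneg (div_nonneg h0 (by linarith)), localDensity_div_one_sub hp]
  have a1 : ((Omega 𝓖 p).card : ℝ) ≤ κ + 1 := by exact_mod_cast card_omega_le h𝓖 p
  have a2 : ((Omega 𝓖 p).card : ℝ) + 1 ≤ p := by exact_mod_cast hlt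
  have a3 : (1 : ℝ) ≤ (Omega 𝓖 p).card := by exact_mod_cast one_le_card_omega h𝓖 p
  have hκ : (0 : ℝ) ≤ κ := Nat.cast_nonneg κ
  rw [div_le_div_iff₀ (by linarith) (by linarith)]
  rcases le_total (p : ℝ) (2 * (κ + 1)) with h | h
  · calc _ ≤ κ * (2 * ((κ : ℝ) + 1)) := by
          apply mul_le_mul <;> linarith
      _ = 2 * κ * (κ + 1) * 1 := by ring
      _ ≤ _ := by gcongr; linarith
  · calc _ ≤ (κ : ℝ) * p := by gcongr; linarith
      _ ≤ κ * ((κ + 1) * (2 * (p - (Omega 𝓖 p).card))) := by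
          gcongr
          nlinarith
      _ = _ := by ring

theorem abs_localDensity_div_sub_le (h𝓖 : 𝓖.card = κ + 1) (hp : p.Prime) (hlt : ∀ h ∈ 𝓖, h < p)
    (hκp : 2 * ((κ : ℝ) + 1) ≤ p) :
    |localDensity 𝓖 p / (1 - localDensity 𝓖 p) - κ / p| ≤ 2 * κ * (κ + 1) / (p : ℝ) ^ 2 := by
  have h2 : (2 : ℝ) ≤ p := by exact_mod_cast hp.two_le
  have hκ : (0 : ℝ) ≤ κ := Nat.cast_nonneg κ
  have h3 : (p : ℝ) - (κ + 1) ≠ 0 := by linarith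
  have h4 : (p : ℝ) ≠ 0 := by linarith
  have e : localDensity 𝓖 p / (1 - localDensity 𝓖 p) - κ / p =
      κ * (κ + 1) / (p * ((p : ℝ) - (κ + 1))) := by
    rw [localDensity_div_one_sub hp, omega_card_eq hlt, h𝓖]
    push_cast
    field_simp
    ring
  have h5 : 0 < (p : ℝ) * ((p : ℝ) - (κ + 1)) := mul_pos (by linarith) (by linarith)
  rw [e, abs_of_nonneg (by positivity), div_le_div_iff₀ h5 (by positivity)]
  have : (p : ℝ) ^ 2 ≤ 2 * (p * ((p : ℝ) - (κ + 1))) := by nlinarith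
  have h6 : 0 ≤ (κ : ℝ) * (κ + 1) := by positivity
  nlinarith

end

/-! ### Asymptotics of the quadratic form -/

theorem hasProd_primes_dvd (F : ℕ → ℝ) {m : ℕ} (hm : m ≠ 0) :
    HasProd (fun p : Nat.Primes => if (p : ℕ) ∣ m then F p else 1) (∏ p ∈ m.primeFactors, F p) := by
  have h : ∏ p ∈ m.primeFactors, F p =
      ∏ p ∈ m.primeFactors.subtype Nat.Prime, if (p : ℕ) ∣ m then F p else 1 := by
    rw [Finset.prod_subtype_of_mem (s := m.primeFactors) (p := Nat.Prime)
      (f := fun p => if p ∣ m then F p else 1) (fun p hp => Nat.prime_of_mem_primeFactors hp)]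
    exact prod_congr rfl fun p hp => (if_pos (Nat.dvd_of_mem_primeFactors hp)).symm
  rw [h]
  refine hasProd_prod_of_ne_finset_one fun p hp => if_neg fun hd => hp ?_
  exact Finset.mem_subtype.2 (Nat.mem_primeFactors.2 ⟨p.2, hd, hm⟩)

section

variable {𝓖 : Finset ℕ} {κ : ℕ}

theorem hasProd_singularSeries (h𝓖 : 𝓖.card = κ + 1) :
    HasProd (fun p : Nat.Primes =>
      (1 - localDensity 𝓖 p) * ((1 - 1 / ((p : ℕ) : ℝ)) ^ κ)⁻¹) (singularSeries 𝓖) := by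
  have h := (multipliable_singularFactor 𝓖).hasProd
  have e : (fun p : Nat.Primes => singularFactor 𝓖 (p : ℕ)) = fun p : Nat.Primes =>
      (1 - localDensity 𝓖 p) * ((1 - 1 / ((p : ℕ) : ℝ)) ^ κ)⁻¹ :=
    funext fun p => singularFactor_eq h𝓖 p.2
  rw [e] at h
  have e2 : singularSeries 𝓖 = ∏' p : Nat.Primes,
      (1 - localDensity 𝓖 p) * ((1 - 1 / ((p : ℕ) : ℝ)) ^ κ)⁻¹ := by
    rw [singularSeries, e]
  rw [e2]
  exact h

/-- The singular series with the factors at primes dividing `m` removed. -/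
theorem mul_prod_eq_singularSeries (h𝓖 : 𝓖.card = κ + 1) {m : ℕ} (hm : m ≠ 0) {S : ℝ}
    (hS : HasProd (fun p : Nat.Primes =>
      (1 + coprimeNeg (localDensity 𝓖) m p) * ((1 - 1 / ((p : ℕ) : ℝ)) ^ κ)⁻¹) S) :
    S * ∏ p ∈ m.primeFactors, (1 - localDensity 𝓖 p) = singularSeries 𝓖 := by
  have h := hS.mul (hasProd_primes_dvd (fun p => 1 - localDensity 𝓖 p) hm)
  refine HasProd.unique ?_ (hasProd_singularSeries h𝓖)
  convert h using 2 with p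
  unfold coprimeNeg
  split_ifs <;> ring

theorem localDensity_ne_one_of_singularSeries_ne_zero (h𝓖 : 𝓖.card = κ + 1)
    (h : singularSeries 𝓖 ≠ 0) {p : ℕ} (hp : p.Prime) : localDensity 𝓖 p ≠ 1 := by
  intro h1
  refine h (HasProd.unique (hasProd_singularSeries h𝓖) (hasProd_zero_of_exists_eq_zero ⟨⟨p, hp⟩, ?_⟩))
  simp [h1]

/-- The Euler product belonging to `g / (1 - g)` is the inverse of the singular series. -/
theorem singularSeries_mul_eq_one (h𝓖 : 𝓖.card = κ + 1) (h : singularSeries 𝓖 ≠ 0) {S : ℝ}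
    (hS : HasProd (fun p : Nat.Primes =>
      (1 + localDensity 𝓖 p / (1 - localDensity 𝓖 p)) * (1 - 1 / ((p : ℕ) : ℝ)) ^ κ) S) :
    singularSeries 𝓖 * S = 1 := by
  refine HasProd.unique ((hasProd_singularSeries h𝓖).mul hS) ?_
  convert hasProd_one using 2 with p
  have h1 := sub_ne_zero.2 (localDensity_ne_one_of_singularSeries_ne_zero h𝓖 h p.2).symm
  have hp1 : (1 : ℝ) < (p : ℕ) := by exact_mod_cast p.2.one_lt
  have h2 : (1 - 1 / ((p : ℕ) : ℝ)) ^ κ ≠ 0 := by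
    refine pow_ne_zero _ ?_
    rw [sub_ne_zero, ne_comm, Ne, div_eq_one_iff_eq (by linarith)]
    linarith
  generalize (1 - 1 / ((p : ℕ) : ℝ)) ^ κ = x at h2
  field_simp
  ring

/-- The coefficient of `m` in the main term of the diagonal form: one factor `1 - g(p)` of the
weight is missing to complete the square of the singular series. -/
theorem sqfreeMul_mul_sq_eq (h𝓖 : 𝓖.card = κ + 1) (h : singularSeries 𝓖 ≠ 0) {m : ℕ} (hm : m ≠ 0)
    {S : ℝ} (hS : HasProd (fun p : Nat.Primes =>
      (1 + coprimeNeg (localDensity 𝓖) m p) * ((1 - 1 / ((p : ℕ) : ℝ)) ^ κ)⁻¹) S) :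
    sqfreeMul (fun p => localDensity 𝓖 p * (1 - localDensity 𝓖 p)) m * S ^ 2 =
      singularSeries 𝓖 ^ 2 * sqfreeMul (fun p => localDensity 𝓖 p / (1 - localDensity 𝓖 p)) m := by
  have h1 := mul_prod_eq_singularSeries h𝓖 hm hS
  simp only [sqfreeMul_apply]
  split_ifs with hs
  swap
  · simp
  have h2 : ∏ p ∈ m.primeFactors, (1 - localDensity 𝓖 p) ≠ 0 :=
    prod_ne_zero_iff.2 fun p hp => sub_ne_zero.2
      (localDensity_ne_one_of_singularSeries_ne_zero h𝓖 h (Nat.prime_of_mem_primeFactors hp)).symm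
  rw [← h1, prod_mul_distrib, prod_div_distrib]
  field_simp

/-- If the singular series vanishes, either `m` has a prime factor with local density `1` or `S`
vanishes. -/
theorem sqfreeMul_mul_sq_eq_zero (h𝓖 : 𝓖.card = κ + 1) (h : singularSeries 𝓖 = 0) {m : ℕ}
    (hm : m ≠ 0) {S : ℝ} (hS : HasProd (fun p : Nat.Primes =>
      (1 + coprimeNeg (localDensity 𝓖) m p) * ((1 - 1 / ((p : ℕ) : ℝ)) ^ κ)⁻¹) S) :
    sqfreeMul (fun p => localDensity 𝓖 p * (1 - localDensity 𝓖 p)) m * S ^ 2 = 0 := by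
  have h1 := mul_prod_eq_singularSeries h𝓖 hm hS
  rw [sqfreeMul_apply]
  split_ifs with hs
  swap
  · simp
  rw [h] at h1
  rw [prod_mul_distrib]
  linear_combination (∏ p ∈ m.primeFactors, localDensity 𝓖 p) * S * h1

end

/-- The asymptotic evaluation of the quadratic form of the sieve weights, uniform in the tuple. The
parameter `e^v` bounds the elements of `𝓖` and `log R`, so that the primes beyond it are generic;
the exponent `B` depends on `κ` only. -/
theorem exists_abs_sum_sieveWeight_lcm_sub_le (κ : ℕ) {b : ℕ} (hb : 1 ≤ b) :
    ∃ B : ℕ, ∀ C : ℝ, 0 ≤ C →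
      (∀ u : ℝ, 0 ≤ u → |rieszSum (moebiusDiv ^ κ) (κ + b) u - u ^ b / (b ! : ℝ)| ≤
        C * (1 + u) ^ (b - 1)) →
      ∃ M : ℝ, 0 ≤ M ∧ ∀ (v R : ℝ) (𝓖 : Finset ℕ), 4 ≤ v → 2 * ((κ : ℝ) + 1) ≤ Real.exp v →
        𝓖.card = κ + 1 → (∀ h ∈ 𝓖, (h : ℝ) ≤ Real.exp v) → 1 ≤ R → Real.log R ≤ Real.exp v →
        |∑ d₁ ∈ Ioc 0 ⌊R⌋₊, ∑ d₂ ∈ Ioc 0 ⌊R⌋₊, sieveWeight R d₁ (κ + b) * sieveWeight R d₂ (κ + b) *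
            sqfreeMul (localDensity 𝓖) (d₁.lcm d₂) -
          singularSeries 𝓖 * ((2 * b).choose b : ℝ) *
            (Real.log R ^ (κ + 2 * b) / ((κ + 2 * b)! : ℝ))| ≤
          M * v ^ B * (1 + Real.log R) ^ (κ + 2 * b - 1) := by
  set D : ℝ := 2 * κ * (κ + 1) with hD
  have hκ : (0 : ℝ) ≤ κ := Nat.cast_nonneg κ
  have hD0 : 0 ≤ D := by positivity
  have hD2 : 2 * (κ : ℝ) ≤ D := by rw [hD]; nlinarith
  obtain ⟨B₁, hB₁⟩ := exists_rieszSum_sqfreeMul_neg κ hD0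
  obtain ⟨B₂, hB₂⟩ := exists_rieszSum_sqfreeMul_pos κ hD0
  refine ⟨2 * B₁ + B₂, fun C hC hβ => ⟨(C + 1) * (C + 3) + (2 * b).choose b * (κ + 1),
    by positivity, ?_⟩⟩
  intro v R 𝓖 hv hκv h𝓖 hle hR hRv
  set L := Real.log R with hL
  have hL0 : 0 ≤ L := Real.log_nonneg hR
  have hv0 : 0 < v := by linarith
  have hN : ⌊R⌋₊ = ⌊Real.exp L⌋₊ := by rw [hL, Real.exp_log (by linarith)]
  set g := localDensity 𝓖 with hg
  have hlt : ∀ p : ℕ, Real.exp v < p → ∀ h ∈ 𝓖, h < p := fun p hp h hh => by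
    exact_mod_cast (hle h hh).trans_lt hp
  have hmlog : ∀ m ∈ Ioc 0 ⌊R⌋₊, Real.log m ≤ L := fun m hm => by
    rw [mem_Ioc, hN] at hm
    exact (le_floor_exp_iff hm.1 L).1 hm.2
  have hDmono : ∀ x : ℝ, 0 ≤ x → 2 * (κ : ℝ) / x ≤ D / x := fun x hx => by gcongr
  -- The inner sums.
  have hneg : ∀ m : ℕ, m ≠ 0 → Real.log m ≤ L → ∃ S : ℝ,
      HasProd (fun p : Nat.Primes =>
        (1 + coprimeNeg g m p) * ((1 - 1 / ((p : ℕ) : ℝ)) ^ κ)⁻¹) S ∧ |S| ≤ v ^ B₁ ∧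
      ∀ u : ℝ, 0 ≤ u → |rieszSum (sqfreeMul (coprimeNeg g m)) (κ + b) u - S * (u ^ b / (b ! : ℝ))| ≤
        (C + 1) * v ^ B₁ * (1 + u) ^ (b - 1) := by
    intro m hm hml
    obtain ⟨S, h1, h2, h3⟩ := hB₁ (coprimeNeg g m) v m hv hm (hml.trans hRv)
      (fun p hp => by
        unfold coprimeNeg
        split_ifs
        · rw [abs_zero]; positivity
        · rw [abs_neg, abs_of_nonneg (localDensity_nonneg h𝓖 hp)]
          exact (localDensity_le h𝓖 hp).trans (hDmono _ (by positivity)))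
      (fun p hp hpv hpm => by
        rw [coprimeNeg, if_neg hpm, neg_add_eq_sub, abs_sub_comm]
        exact (abs_localDensity_sub_le h𝓖 hp (hlt p hpv)).trans (hDmono _ (by positivity)))
    exact ⟨S, h1, h2, h3 b C hb hC hβ⟩
  choose! S hS1 hS2 hS3 using hneg
  set w := sqfreeMul (fun p => g p * (1 - g p)) with hw
  have hw0 : ∀ m, 0 ≤ w m := fun m => by
    rw [hw, sqfreeMul_apply]
    split_ifs
    · exact prod_nonneg fun p hp => by
        have hp' := Nat.prime_of_mem_primeFactors hp
        exact mul_nonneg (localDensity_nonneg h𝓖 hp') (sub_nonneg.2 (localDensity_le_one 𝓖 hp'))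
    · exact le_rfl
  have hwg : ∀ m, w m ≤ sqfreeMul g m := fun m => by
    rw [hw, sqfreeMul_apply, sqfreeMul_apply]
    split_ifs
    · refine prod_le_prod (fun p hp => ?_) (fun p hp => ?_)
      · have hp' := Nat.prime_of_mem_primeFactors hp
        exact mul_nonneg (localDensity_nonneg h𝓖 hp') (sub_nonneg.2 (localDensity_le_one 𝓖 hp'))
      · have hp' := Nat.prime_of_mem_primeFactors hp
        have := localDensity_nonneg h𝓖 hp'
        exact mul_le_of_le_one_right this (by linarith)
    · exact le_rfl
  have hwsum : ∑ m ∈ Ioc 0 ⌊R⌋₊, w m ≤ v ^ B₂ * (1 + L) ^ κ := by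
    obtain ⟨h1, -⟩ := hB₂ g v hv
      (fun p hp => by
        rw [abs_of_nonneg (localDensity_nonneg h𝓖 hp)]
        exact (localDensity_le h𝓖 hp).trans (hDmono _ (by positivity)))
      (fun p hp hpv => (abs_localDensity_sub_le h𝓖 hp (hlt p hpv)).trans (hDmono _ (by positivity)))
    refine le_trans ?_ ((le_abs_self _).trans (h1 L hL0))
    rw [rieszSum, ← hN]
    refine sum_le_sum fun m _ => ?_
    simpa using hwg m
  rw [sum_sieveWeight_lcm_eq g (κ + b) hR]
  -- Replace each inner sum by its main term.
  set X : ℕ → ℝ := fun m => rieszSum (sqfreeMul (coprimeNeg g m)) (κ + b) (L - Real.log m) with hX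
  set Y : ℕ → ℝ := fun m => S m * ((L - Real.log m) ^ b / (b ! : ℝ)) with hY
  have hXY : ∀ m ∈ Ioc 0 ⌊R⌋₊, |X m ^ 2 - Y m ^ 2| ≤
      (C + 1) * (C + 3) * v ^ (2 * B₁) * (1 + L) ^ (2 * b - 1) := by
    intro m hm
    have hm0 : m ≠ 0 := (mem_Ioc.1 hm).1.ne'
    have hml := hmlog m hm
    have hl0 : 0 ≤ Real.log m := Real.log_natCast_nonneg m
    have h1 : |X m - Y m| ≤ (C + 1) * v ^ B₁ * (1 + L) ^ (b - 1) := by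
      refine (hS3 m hm0 hml (L - Real.log m) (by linarith)).trans ?_
      have : 0 ≤ 1 + (L - Real.log m) := by linarith
      gcongr
      linarith
    have h2 : |Y m| ≤ v ^ B₁ * (1 + L) ^ b := by
      simp only [hY]
      rw [abs_mul]
      have hfac : (1 : ℝ) ≤ (b ! : ℝ) := by
        exact_mod_cast Nat.one_le_iff_ne_zero.2 (Nat.factorial_ne_zero b)
      have h3 : 0 ≤ L - Real.log m := by linarith
      refine mul_le_mul (hS2 m hm0 hml) ?_ (abs_nonneg _) (by positivity)
      rw [abs_of_nonneg (by positivity)]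
      refine (div_le_self (by positivity) hfac).trans ?_
      gcongr
      linarith
    have h4 : (1 + L) ^ (b - 1) ≤ (1 + L) ^ b := pow_le_pow_right₀ (by linarith) (by omega)
    have h5 : |X m + Y m| ≤ (C + 3) * v ^ B₁ * (1 + L) ^ b := by
      have e : X m + Y m = (X m - Y m) + 2 * Y m := by ring
      rw [e]
      refine (abs_add_le _ _).trans ?_
      rw [abs_mul, abs_two]
      have h6 : (C + 1) * v ^ B₁ * (1 + L) ^ (b - 1) ≤ (C + 1) * v ^ B₁ * (1 + L) ^ b := by gcongr
      have h7 : (C + 3) * v ^ B₁ * (1 + L) ^ b =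
        (C + 1) * v ^ B₁ * (1 + L) ^ b + 2 * (v ^ B₁ * (1 + L) ^ b) := by ring
      linarith
    have e : X m ^ 2 - Y m ^ 2 = (X m - Y m) * (X m + Y m) := by ring
    rw [e, abs_mul]
    refine (mul_le_mul h1 h5 (abs_nonneg _) (by positivity)).trans (le_of_eq ?_)
    rw [show 2 * b - 1 = (b - 1) + b by omega, pow_add, two_mul, pow_add]
    ring
  have herr1 : |∑ m ∈ Ioc 0 ⌊R⌋₊, w m * X m ^ 2 - ∑ m ∈ Ioc 0 ⌊R⌋₊, w m * Y m ^ 2| ≤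
      (C + 1) * (C + 3) * v ^ (2 * B₁ + B₂) * (1 + L) ^ (κ + 2 * b - 1) := by
    rw [← sum_sub_distrib]
    refine (abs_sum_le_sum_abs _ _).trans ?_
    calc _ ≤ ∑ m ∈ Ioc 0 ⌊R⌋₊, w m * ((C + 1) * (C + 3) * v ^ (2 * B₁) * (1 + L) ^ (2 * b - 1)) := by
          refine sum_le_sum fun m hm => ?_
          rw [← mul_sub, abs_mul, abs_of_nonneg (hw0 m)]
          exact mul_le_mul_of_nonneg_left (hXY m hm) (hw0 m)
      _ ≤ (v ^ B₂ * (1 + L) ^ κ) * ((C + 1) * (C + 3) * v ^ (2 * B₁) * (1 + L) ^ (2 * b - 1)) := by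
          rw [← sum_mul]; gcongr
      _ = _ := by
          rw [show κ + 2 * b - 1 = κ + (2 * b - 1) by omega, pow_add, pow_add]; ring
  have hmain : |∑ m ∈ Ioc 0 ⌊R⌋₊, w m * Y m ^ 2 - singularSeries 𝓖 * ((2 * b).choose b : ℝ) *
      (L ^ (κ + 2 * b) / ((κ + 2 * b)! : ℝ))| ≤
      (2 * b).choose b * (κ + 1) * v ^ (2 * B₁ + B₂) * (1 + L) ^ (κ + 2 * b - 1) := by
    by_cases hzero : singularSeries 𝓖 = 0
    · have h1 : ∑ m ∈ Ioc 0 ⌊R⌋₊, w m * Y m ^ 2 = 0 := by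
        refine sum_eq_zero fun m hm => ?_
        have hm0 : m ≠ 0 := (mem_Ioc.1 hm).1.ne'
        have := sqfreeMul_mul_sq_eq_zero h𝓖 hzero hm0 (hS1 m hm0 (hmlog m hm))
        simp only [hY]
        rw [mul_pow, ← mul_assoc, this, zero_mul]
      rw [h1, hzero]
      simp only [zero_mul, sub_zero, abs_zero]
      positivity
    · obtain ⟨-, T, hT1, hT2⟩ := hB₂ (fun p => g p / (1 - g p)) v hv
        (fun p hp => abs_localDensity_div_le h𝓖 hp
          (localDensity_ne_one_of_singularSeries_ne_zero h𝓖 hzero hp))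
        (fun p hp hpv => abs_localDensity_div_sub_le h𝓖 hp (hlt p hpv) (hκv.trans hpv.le))
      have hST := singularSeries_mul_eq_one h𝓖 hzero hT1
      have hSabs : |singularSeries 𝓖| ≤ v ^ B₁ := by
        have h1 := mul_prod_eq_singularSeries h𝓖 one_ne_zero (hS1 1 one_ne_zero (by simpa using hL0))
        rw [← h1]
        simpa using hS2 1 one_ne_zero (by simpa using hL0)
      have hch : (((2 * b)! : ℕ) : ℝ) / (((b ! : ℕ) : ℝ) ^ 2) = ((2 * b).choose b : ℝ) := by
        rw [Nat.cast_choose ℝ (show b ≤ 2 * b by omega), show 2 * b - b = b by omega, sq]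
      have h1 : ∑ m ∈ Ioc 0 ⌊R⌋₊, w m * Y m ^ 2 = singularSeries 𝓖 ^ 2 * ((2 * b).choose b : ℝ) *
          rieszSum (sqfreeMul fun p => g p / (1 - g p)) (2 * b) L := by
        rw [rieszSum, ← hN, mul_sum]
        refine sum_congr rfl fun m hm => ?_
        have hm0 : m ≠ 0 := (mem_Ioc.1 hm).1.ne'
        have := sqfreeMul_mul_sq_eq h𝓖 hzero hm0 (hS1 m hm0 (hmlog m hm))
        have hf1 : ((b ! : ℕ) : ℝ) ≠ 0 := by exact_mod_cast Nat.factorial_ne_zero b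
        have hf2 : (((2 * b)! : ℕ) : ℝ) ≠ 0 := by exact_mod_cast Nat.factorial_ne_zero (2 * b)
        simp only [hY]
        rw [mul_pow, ← mul_assoc, this, ← hch, div_pow, ← pow_mul, mul_comm b 2]
        field_simp
        exact mul_comm _ _
      have e : singularSeries 𝓖 ^ 2 * ((2 * b).choose b : ℝ) *
            rieszSum (sqfreeMul fun p => g p / (1 - g p)) (2 * b) L -
          singularSeries 𝓖 * ((2 * b).choose b : ℝ) * (L ^ (κ + 2 * b) / ((κ + 2 * b)! : ℝ)) =
          singularSeries 𝓖 ^ 2 * ((2 * b).choose b : ℝ) *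
            (rieszSum (sqfreeMul fun p => g p / (1 - g p)) (2 * b) L -
              T * (L ^ (κ + 2 * b) / ((κ + 2 * b)! : ℝ))) := by
        have : singularSeries 𝓖 ^ 2 * T = singularSeries 𝓖 := by
          rw [sq, mul_assoc, hST, mul_one]
        linear_combination (((2 * b).choose b : ℝ) * (L ^ (κ + 2 * b) / ((κ + 2 * b)! : ℝ))) * this
      rw [h1, e, abs_mul, abs_mul, abs_pow, Nat.abs_cast]
      calc _ ≤ (v ^ B₁) ^ 2 * ((2 * b).choose b : ℝ) *
            ((κ + 1) * v ^ B₂ * (1 + L) ^ (κ + 2 * b - 1)) := by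
            gcongr
            exact hT2 (2 * b) (by omega) L hL0
        _ = _ := by rw [pow_add, pow_mul, ← pow_mul, ← pow_mul, mul_comm B₁ 2]; ring
  refine (abs_sub_le _ _ _).trans ((add_le_add herr1 hmain).trans (le_of_eq ?_))
  ring

/-! ### Residue classes counted by the sieve -/

theorem eq_prod_primeFactors_of_squarefree {β : Type*} [CommMonoid β] {f : ℕ → β}
    (hf1 : f 1 = 1) (hf : ∀ m n : ℕ, m.Coprime n → f (m * n) = f m * f n) {D : ℕ}
    (hD : Squarefree D) : f D = ∏ p ∈ D.primeFactors, f p := by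
  rw [Nat.multiplicative_factorization f hf hf1 hD.ne_zero, Finsupp.prod, Nat.support_factorization]
  refine prod_congr rfl fun p hp => ?_
  rw [Nat.factorization_eq_one_of_squarefree hD (Nat.prime_of_mem_primeFactors hp) (Nat.dvd_of_mem_primeFactors hp),
    pow_one]

/-- The residue classes `x` modulo `D` with `∏_{h' ∈ 𝓗} (x + h') = 0` and `x + h` invertible: the
classes of those `n` that are counted with the divisor `D` when `n + h` is prime. -/
def IsSieveClass (𝓗 : Finset ℕ) (h D : ℕ) (x : ZMod D) : Prop :=
  ∏ h' ∈ 𝓗, (x + (h' : ZMod D)) = 0 ∧ IsUnit (x + (h : ZMod D))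

/-- The number of residue classes modulo `D` described by `IsSieveClass`. -/
noncomputable def classCount (𝓗 : Finset ℕ) (h D : ℕ) : ℕ :=
  Nat.card {x : ZMod D // IsSieveClass 𝓗 h D x}

theorem isSieveClass_chineseRemainder (𝓗 : Finset ℕ) (h : ℕ) {m n : ℕ} (hmn : m.Coprime n)
    (x : ZMod (m * n)) : IsSieveClass 𝓗 h (m * n) x ↔
      IsSieveClass 𝓗 h m (ZMod.chineseRemainder hmn x).1 ∧
        IsSieveClass 𝓗 h n (ZMod.chineseRemainder hmn x).2 := by
  set e := ZMod.chineseRemainder hmn with he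
  have h1 : e (∏ h' ∈ 𝓗, (x + (h' : ZMod (m * n)))) =
      (∏ h' ∈ 𝓗, ((e x).1 + (h' : ZMod m)), ∏ h' ∈ 𝓗, ((e x).2 + (h' : ZMod n))) := by
    rw [map_prod]
    refine Prod.ext ?_ ?_
    · rw [Prod.fst_prod]
      exact prod_congr rfl fun h' _ => by rw [map_add, map_natCast]; rfl
    · rw [Prod.snd_prod]
      exact prod_congr rfl fun h' _ => by rw [map_add, map_natCast]; rfl
  have h2 : e (x + (h : ZMod (m * n))) = ((e x).1 + (h : ZMod m), (e x).2 + (h : ZMod n)) := by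
    rw [map_add, map_natCast]; rfl
  have h3 : IsUnit (x + (h : ZMod (m * n))) ↔
      IsUnit ((e x).1 + (h : ZMod m)) ∧ IsUnit ((e x).2 + (h : ZMod n)) := by
    rw [← MulEquiv.isUnit_map e, h2, Prod.isUnit_iff]
  have h4 : ∏ h' ∈ 𝓗, (x + (h' : ZMod (m * n))) = 0 ↔
      ∏ h' ∈ 𝓗, ((e x).1 + (h' : ZMod m)) = 0 ∧ ∏ h' ∈ 𝓗, ((e x).2 + (h' : ZMod n)) = 0 := by
    rw [← map_eq_zero_iff e e.injective, h1, Prod.mk_eq_zero]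
  unfold IsSieveClass
  rw [h3, h4]
  tauto

theorem classCount_mul (𝓗 : Finset ℕ) (h : ℕ) {m n : ℕ} (hmn : m.Coprime n) :
    classCount 𝓗 h (m * n) = classCount 𝓗 h m * classCount 𝓗 h n := by
  unfold classCount
  rw [← Nat.card_prod]
  refine Nat.card_congr (((ZMod.chineseRemainder hmn).toEquiv.subtypeEquiv (q := fun y =>
    IsSieveClass 𝓗 h m y.1 ∧ IsSieveClass 𝓗 h n y.2) fun x => ?_).trans
      Equiv.subtypeProdEquivProd)
  exact isSieveClass_chineseRemainder 𝓗 h hmn x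

theorem classCount_one (𝓗 : Finset ℕ) (h : ℕ) : classCount 𝓗 h 1 = 1 := by
  have : Unique {x : ZMod 1 // IsSieveClass 𝓗 h 1 x} :=
    { default := ⟨0, Subsingleton.elim _ _, isUnit_of_subsingleton _⟩
      uniq := fun x => Subtype.ext (Subsingleton.elim _ _) }
  exact Nat.card_unique

/-- The class `-h` belongs to `Ω` for the tuple `insert h 𝓗` and is the only one not counted. -/
theorem classCount_prime (𝓗 : Finset ℕ) (h : ℕ) {p : ℕ} (hp : p.Prime) :
    classCount 𝓗 h p + 1 = (Omega (insert h 𝓗) p).card := by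
  have : Fact p.Prime := ⟨hp⟩
  have h1 : classCount 𝓗 h p = ((Omega (insert h 𝓗) p).erase (-(h : ZMod p))).card := by
    refine Nat.subtype_card _ fun x => ?_
    rw [mem_erase, Omega, mem_image, IsSieveClass, isUnit_iff_ne_zero, Ne, Ne,
      ← eq_neg_iff_add_eq_zero, prod_eq_zero_iff, and_comm]
    refine and_congr_left fun hx => ?_
    constructor
    · rintro ⟨a, ha, hax⟩
      rcases mem_insert.1 ha with rfl | ha
      · exact absurd hax.symm hx
      · exact ⟨a, ha, by rw [← hax, neg_add_cancel]⟩
    · rintro ⟨a, ha, hax⟩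
      exact ⟨a, mem_insert_of_mem ha, (eq_neg_of_add_eq_zero_left hax).symm⟩
  rw [h1, card_erase_add_one]
  exact mem_image_of_mem _ (mem_insert_self _ _)

theorem classCount_div_totient {𝓗 : Finset ℕ} {h D : ℕ} (hD : Squarefree D) :
    (classCount 𝓗 h D : ℝ) / (D.totient : ℝ) = sqfreeMul (localDensity (insert h 𝓗)) D := by
  rw [eq_prod_primeFactors_of_squarefree (f := fun D => (classCount 𝓗 h D : ℝ) / (D.totient : ℝ))
    (by simp [classCount_one]) (fun m n hmn => ?_) hD, sqfreeMul_apply, if_pos hD]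
  · refine prod_congr rfl fun p hp => ?_
    have hp' := Nat.prime_of_mem_primeFactors hp
    rw [localDensity, ← classCount_prime 𝓗 h hp', Nat.totient_prime hp',
      Nat.cast_sub hp'.one_le]
    push_cast
    ring
  · simp only [classCount_mul 𝓗 h hmn, Nat.totient_mul hmn]
    push_cast
    rw [mul_div_mul_comm]

theorem classCount_le {𝓗 : Finset ℕ} {h κ D : ℕ} (hκ : (insert h 𝓗).card = κ + 1)
    (hD : Squarefree D) : (classCount 𝓗 h D : ℝ) ≤ ∏ _p ∈ D.primeFactors, (κ : ℝ) := by
  rw [eq_prod_primeFactors_of_squarefree (f := classCount 𝓗 h) (classCount_one 𝓗 h)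
    (fun m n hmn => classCount_mul 𝓗 h hmn) hD]
  push_cast
  refine prod_le_prod (fun p _ => Nat.cast_nonneg _) fun p hp => ?_
  have h1 := classCount_prime 𝓗 h (Nat.prime_of_mem_primeFactors hp)
  have h2 := card_omega_le hκ p
  exact_mod_cast (by omega : classCount 𝓗 h p ≤ κ)

/-! ### Sums over primes in the counted classes -/

theorem dvd_tuplePoly_iff (𝓗 : Finset ℕ) (n D : ℕ) :
    D ∣ tuplePoly n 𝓗 ↔ ∏ h' ∈ 𝓗, ((n : ZMod D) + (h' : ZMod D)) = 0 := by
  rw [← ZMod.natCast_eq_zero_iff, tuplePoly]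
  push_cast
  rfl

theorem isUnit_natCast_add_iff (n h D : ℕ) :
    IsUnit ((n : ZMod D) + (h : ZMod D)) ↔ (n + h).Coprime D := by
  rw [← ZMod.isUnit_iff_coprime]
  push_cast
  rfl

theorem primeLog_nonneg (n : ℕ) : 0 ≤ primeLog n := by
  unfold primeLog
  split_ifs
  · exact Real.log_natCast_nonneg n
  · exact le_rfl

theorem primeLog_le {x : ℝ} (hx : 1 ≤ x) {n : ℕ} (hn : (n : ℝ) ≤ x) : primeLog n ≤ Real.log x := by
  unfold primeLog
  split_ifs with h
  · exact Real.log_le_log (by exact_mod_cast h.pos) hn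
  · exact Real.log_nonneg hx

/-- Over `N < n ≤ 2N` the primes `n + h` exceed the prime factors of `D`, so that only invertible
classes occur. -/
theorem sum_primeLog_dvd_tuplePoly {N : ℝ} (𝓗 : Finset ℕ) (h : ℕ) {D : ℕ} [NeZero D]
    [Fintype {x : ZMod D // IsSieveClass 𝓗 h D x}]
    (hD : ∀ p ∈ D.primeFactors, (p : ℝ) ≤ N) :
    ∑ n ∈ Ioc ⌊N⌋₊ ⌊2 * N⌋₊, (if D ∣ tuplePoly n 𝓗 then primeLog (n + h) else 0) =
      ∑ x : {x : ZMod D // IsSieveClass 𝓗 h D x},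
        ∑ n ∈ Ioc ⌊N⌋₊ ⌊2 * N⌋₊, if (n : ZMod D) = x then primeLog (n + h) else 0 := by
  classical
  rw [sum_comm]
  refine sum_congr rfl fun n hn => ?_
  have hn1 : N < n := Nat.lt_of_floor_lt (mem_Ioc.1 hn).1
  by_cases hc : IsSieveClass 𝓗 h D n
  · rw [if_pos ((dvd_tuplePoly_iff 𝓗 n D).2 hc.1), Fintype.sum_eq_single ⟨(n : ZMod D), hc⟩]
    · simp
    · intro x hx
      exact if_neg fun hnx => hx (Subtype.ext hnx.symm)
  · rw [Fintype.sum_eq_zero _ fun x => if_neg fun hnx => hc (by rw [hnx]; exact x.2)]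
    split_ifs with hd
    · unfold primeLog
      refine if_neg fun hprime => hc ⟨(dvd_tuplePoly_iff 𝓗 n D).1 hd, ?_⟩
      rw [isUnit_natCast_add_iff, hprime.coprime_iff_not_dvd]
      intro hdvd
      have := hD _ (Nat.mem_primeFactors.2 ⟨hprime, hdvd, NeZero.ne D⟩)
      push_cast at this
      linarith [Nat.cast_nonneg (α := ℝ) h]
    · rfl

/-- A sum over one class modulo `D` compared with `thetaStar (N + h)`: after the shift by `h` the
two ranges differ by `h` integers. -/
theorem abs_sum_primeLog_class_sub_thetaStar_le {N : ℝ} (hN : 1 ≤ N) (h a : ℕ) {D : ℕ} :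
    |∑ n ∈ Ioc ⌊N⌋₊ ⌊2 * N⌋₊, (if (n : ZMod D) = (a : ZMod D) then primeLog (n + h) else 0) -
      thetaStar (N + h) (a + h) D| ≤ h * Real.log (2 * (N + h)) := by
  have hh : (0 : ℝ) ≤ h := Nat.cast_nonneg h
  set f : ℕ → ℝ := fun m => if m ≡ a + h [MOD D] then primeLog m else 0 with hf
  have h1 : ∑ n ∈ Ioc ⌊N⌋₊ ⌊2 * N⌋₊, (if (n : ZMod D) = (a : ZMod D) then primeLog (n + h) else 0) =
      ∑ m ∈ Ioc (⌊N⌋₊ + h) (⌊2 * N⌋₊ + h), f m := by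
    rw [← map_add_right_Ioc, sum_map]
    refine sum_congr rfl fun n _ => ?_
    simp only [hf, addRightEmbedding_apply]
    congr 1
    rw [ZMod.natCast_eq_natCast_iff, eq_iff_iff]
    exact (Nat.ModEq.add_iff_right (Nat.ModEq.refl h)).symm
  have h2 : thetaStar (N + h) (a + h) D =
      ∑ m ∈ Ioc (⌊N⌋₊ + h) (⌊2 * N⌋₊ + 2 * h), f m := by
    have e : 2 * (N + h) = 2 * N + ((2 * h : ℕ) : ℝ) := by push_cast; ring
    rw [thetaStar, sum_filter, e, Nat.floor_add_natCast (by linarith),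
      Nat.floor_add_natCast (by linarith)]
  have hle : ⌊N⌋₊ + h ≤ ⌊2 * N⌋₊ + h := by
    have := Nat.floor_le_floor (show N ≤ 2 * N by linarith)
    omega
  rw [h1, h2, ← sum_Ioc_consecutive f hle (show ⌊2 * N⌋₊ + h ≤ ⌊2 * N⌋₊ + 2 * h by omega),
    sub_add_cancel_left, abs_neg]
  have hf0 : ∀ m, 0 ≤ f m := fun m => by
    simp only [hf]; split_ifs
    · exact primeLog_nonneg m
    · exact le_rfl
  rw [abs_of_nonneg (sum_nonneg fun m _ => hf0 m)]
  have h3 : ∀ m ∈ Ioc (⌊2 * N⌋₊ + h) (⌊2 * N⌋₊ + 2 * h), f m ≤ Real.log (2 * (N + h)) := by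
    intro m hm
    have hm2 : (m : ℝ) ≤ 2 * (N + h) := by
      have h4 : (m : ℝ) ≤ ⌊2 * N⌋₊ + 2 * h := by exact_mod_cast (mem_Ioc.1 hm).2
      have := Nat.floor_le (show 0 ≤ 2 * N by linarith)
      linarith
    simp only [hf]; split_ifs
    · exact primeLog_le (by linarith) hm2
    · exact Real.log_nonneg (by linarith)
  refine (sum_le_card_nsmul _ _ _ h3).trans (le_of_eq ?_)
  rw [Nat.card_Ioc, nsmul_eq_mul, show ⌊2 * N⌋₊ + 2 * h - (⌊2 * N⌋₊ + h) = h by omega]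

theorem abs_thetaStar_sub_le {x y : ℝ} {a q : ℕ} (hy : y ∈ Set.Ioc 0 x) (ha : a.Coprime q)
    (hE : maxDiscrepancy x q ≠ ⊤) :
    |thetaStar y a q - y / (q.totient : ℝ)| ≤ (maxDiscrepancy x q).toReal := by
  rw [← ENNReal.ofReal_le_iff_le_toReal hE]
  unfold maxDiscrepancy
  refine le_iSup₂_of_le y hy ?_
  exact le_iSup₂_of_le (f := fun (a : ℕ) (_ : a.Coprime q) =>
    ENNReal.ofReal |thetaStar y a q - y / (q.totient : ℝ)|) a ha le_rfl

/-- The sum of `ϖ(n + h)` over the `n` with `D ∣ P(n; 𝓗)`. -/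
theorem abs_sum_primeLog_dvd_tuplePoly_sub_le {N : ℝ} (hN : 1 ≤ N) (𝓗 : Finset ℕ) {h D : ℕ}
    (hhN : (h : ℝ) ≤ N) (hD : Squarefree D) (hDN : ∀ p ∈ D.primeFactors, (p : ℝ) ≤ N)
    (hE : maxDiscrepancy (2 * N) D ≠ ⊤) :
    |∑ n ∈ Ioc ⌊N⌋₊ ⌊2 * N⌋₊, (if D ∣ tuplePoly n 𝓗 then primeLog (n + h) else 0) -
        N * sqfreeMul (localDensity (insert h 𝓗)) D| ≤
      classCount 𝓗 h D *
        ((maxDiscrepancy (2 * N) D).toReal + h * (Real.log (4 * N) + 1)) := by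
  have : NeZero D := ⟨hD.ne_zero⟩
  classical
  have hh : (0 : ℝ) ≤ h := Nat.cast_nonneg h
  have hφ : (1 : ℝ) ≤ (D.totient : ℝ) := by
    exact_mod_cast Nat.totient_pos.2 hD.ne_zero.bot_lt
  rw [sum_primeLog_dvd_tuplePoly 𝓗 h hDN, ← classCount_div_totient hD, classCount,
    Nat.card_eq_fintype_card]
  have e : N * ((Fintype.card {x : ZMod D // IsSieveClass 𝓗 h D x} : ℝ) / (D.totient : ℝ)) =
      ∑ _x : {x : ZMod D // IsSieveClass 𝓗 h D x}, N / (D.totient : ℝ) := by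
    rw [sum_const, card_univ, nsmul_eq_mul]; ring
  rw [e, ← sum_sub_distrib]
  refine (abs_sum_le_sum_abs _ _).trans ?_
  rw [← nsmul_eq_mul, ← card_univ]
  refine sum_le_card_nsmul _ _ _ fun x _ => ?_
  have hx : (((x : ZMod D).val : ℕ) : ZMod D) = x := ZMod.natCast_zmod_val _
  have h1 := abs_sum_primeLog_class_sub_thetaStar_le hN h (x : ZMod D).val (D := D)
  rw [hx] at h1
  have hcop : ((x : ZMod D).val + h).Coprime D := by
    rw [← isUnit_natCast_add_iff, hx]
    exact x.2.2
  have h2 := abs_thetaStar_sub_le (x := 2 * N) (y := N + h) ⟨by linarith, by linarith⟩ hcop hE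
  have h3 : |(N + h) / (D.totient : ℝ) - N / (D.totient : ℝ)| ≤ h := by
    rw [← sub_div, add_sub_cancel_left, abs_of_nonneg (by positivity)]
    exact div_le_self hh hφ
  have h4 : (h : ℝ) * Real.log (2 * (N + h)) ≤ h * Real.log (4 * N) :=
    mul_le_mul_of_nonneg_left (Real.log_le_log (by linarith) (by linarith)) hh
  refine (abs_sub_le _ _ _).trans ((add_le_add h1 ((abs_sub_le _ _ _).trans
    (add_le_add h2 h3))).trans ?_)
  linarith

/-! ### Expansion of the twisted sum -/

theorem sieveSum_eq_sum_Ioc (R : ℝ) {n : ℕ} (hn : 0 < n) (𝓗 : Finset ℕ) (a : ℕ) :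
    sieveSum R n 𝓗 a =
      ∑ d ∈ Ioc 0 ⌊R⌋₊, if d ∣ tuplePoly n 𝓗 then sieveWeight R d a else 0 := by
  have hP : tuplePoly n 𝓗 ≠ 0 := prod_ne_zero_iff.2 fun h _ => by omega
  rw [sieveSum, ← sum_filter]
  symm
  refine sum_subset_zero_on_sdiff (fun d hd => ?_) (fun d hd => ?_) fun _ _ => rfl
  · exact Nat.mem_divisors.2 ⟨(mem_filter.1 hd).2, hP⟩
  · rw [mem_sdiff, mem_filter, Nat.mem_divisors, mem_Ioc] at hd
    refine if_neg fun hdR => hd.2 ⟨⟨?_, Nat.le_floor hdR⟩, hd.1.1⟩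
    exact Nat.pos_of_dvd_of_pos hd.1.1 hP.bot_lt

theorem twistedSum_eq_sum_lcm (N R : ℝ) (𝓗 : Finset ℕ) (h a : ℕ) :
    twistedSum N R 𝓗 h a = ∑ d₁ ∈ Ioc 0 ⌊R⌋₊, ∑ d₂ ∈ Ioc 0 ⌊R⌋₊,
      sieveWeight R d₁ a * sieveWeight R d₂ a *
        ∑ n ∈ Ioc ⌊N⌋₊ ⌊2 * N⌋₊, if d₁.lcm d₂ ∣ tuplePoly n 𝓗 then primeLog (n + h) else 0 := by
  simp_rw [mul_sum]
  have h1 : ∀ n ∈ Ioc ⌊N⌋₊ ⌊2 * N⌋₊, primeLog (n + h) * (sieveSum R n 𝓗 a) ^ 2 =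
      ∑ d₁ ∈ Ioc 0 ⌊R⌋₊, ∑ d₂ ∈ Ioc 0 ⌊R⌋₊, sieveWeight R d₁ a * sieveWeight R d₂ a *
        (if d₁.lcm d₂ ∣ tuplePoly n 𝓗 then primeLog (n + h) else 0) := by
    intro n hn
    have hn0 : 0 < n := (Nat.zero_le _).trans_lt (mem_Ioc.1 hn).1
    rw [sieveSum_eq_sum_Ioc R hn0, sq, sum_mul_sum, mul_sum]
    refine sum_congr rfl fun d₁ _ => ?_
    rw [mul_sum]
    refine sum_congr rfl fun d₂ _ => ?_
    by_cases e1 : d₁ ∣ tuplePoly n 𝓗 <;> by_cases e2 : d₂ ∣ tuplePoly n 𝓗 <;>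
      simp [e1, e2, Nat.lcm_dvd_iff, mul_comm]
  rw [twistedSum, sum_congr rfl h1, sum_comm]
  exact sum_congr rfl fun d₁ _ => sum_comm

theorem abs_sieveWeight_le {R : ℝ} (hR : 1 ≤ R) {d : ℕ} (hd : 0 < d) (a : ℕ) :
    |sieveWeight R d a| ≤ Real.log R ^ a := by
  have hL : 0 ≤ Real.log R := Real.log_nonneg hR
  have hd1 : (1 : ℝ) ≤ d := by exact_mod_cast hd
  unfold sieveWeight
  split_ifs with h
  · have h0 : 0 ≤ Real.log (R / d) := Real.log_nonneg ((one_le_div (by linarith)).2 h)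
    have h1 : Real.log (R / d) ≤ Real.log R :=
      Real.log_le_log (by positivity) (div_le_self (by linarith) hd1)
    have h2 : |((moebius d : ℤ) : ℝ)| ≤ 1 := by exact_mod_cast abs_moebius_le_one
    have h3 : |1 / (a ! : ℝ)| ≤ 1 := by
      rw [abs_of_nonneg (by positivity)]
      exact (div_le_one (by positivity)).2
        (by exact_mod_cast Nat.one_le_iff_ne_zero.2 (Nat.factorial_ne_zero a))
    rw [abs_mul, abs_mul, abs_of_nonneg (pow_nonneg h0 a)]
    calc _ ≤ 1 * 1 * Real.log R ^ a := by gcongr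
      _ = _ := by ring
  · rw [abs_zero]; positivity

theorem sqfreeMul_nonneg {t : ℕ → ℝ} (ht : ∀ p : ℕ, p.Prime → 0 ≤ t p) (n : ℕ) :
    0 ≤ sqfreeMul t n := by
  rw [sqfreeMul_apply]
  split_ifs
  · exact prod_nonneg fun p hp => ht p (Nat.prime_of_mem_primeFactors hp)
  · exact le_rfl

theorem card_divisors_eq_sqfreeMul {D : ℕ} (hD : Squarefree D) :
    (D.divisors.card : ℝ) = sqfreeMul (fun _ => 2) D := by
  rw [eq_prod_primeFactors_of_squarefree (f := fun D => (D.divisors.card : ℝ)) (by simp)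
    (fun m n hmn => by simp only [hmn.card_divisors_mul, Nat.cast_mul]) hD, sqfreeMul_apply,
    if_pos hD]
  refine prod_congr rfl fun p hp => ?_
  rw [(Nat.prime_of_mem_primeFactors hp).divisors, card_pair
    (Nat.prime_of_mem_primeFactors hp).one_lt.ne]
  norm_num

theorem squarefree_lcm {m n : ℕ} (hm : Squarefree m) (hn : Squarefree n) :
    Squarefree (m.lcm n) := by
  rw [Nat.squarefree_iff_factorization_le_one (Nat.lcm_ne_zero hm.ne_zero hn.ne_zero)]
  intro p
  rw [Nat.factorization_lcm hm.ne_zero hn.ne_zero]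
  exact max_le (hm.natFactorization_le_one p) (hn.natFactorization_le_one p)

/-- At most `4^{ω(D)}` pairs have least common multiple a given squarefree `D`. -/
theorem sum_lcm_le {F : ℕ → ℝ} (hF : ∀ D, 0 ≤ F D) (m : ℕ) :
    ∑ d₁ ∈ (Ioc 0 m).filter Squarefree, ∑ d₂ ∈ (Ioc 0 m).filter Squarefree, F (d₁.lcm d₂) ≤
      ∑ D ∈ Ioc 0 (m * m), sqfreeMul (fun _ => 4) D * F D := by
  rw [← sum_product', ← sum_fiberwise_of_maps_to (t := Ioc 0 (m * m))
    (g := fun x : ℕ × ℕ => x.1.lcm x.2)]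
  swap
  · intro x hx
    rw [mem_product, mem_filter, mem_filter, mem_Ioc, mem_Ioc] at hx
    rw [mem_Ioc]
    exact ⟨Nat.lcm_pos hx.1.1.1 hx.2.1.1,
      (Nat.div_le_self _ _).trans (Nat.mul_le_mul hx.1.1.2 hx.2.1.2)⟩
  refine sum_le_sum fun D _ => ?_
  have h1 : ∀ x ∈ ((Ioc 0 m).filter Squarefree ×ˢ (Ioc 0 m).filter Squarefree).filter
      (fun x => x.1.lcm x.2 = D), F (x.1.lcm x.2) = F D := fun x hx => by
    rw [(mem_filter.1 hx).2]
  rw [sum_congr rfl h1, sum_const, nsmul_eq_mul]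
  by_cases hD : Squarefree D
  · refine mul_le_mul_of_nonneg_right ?_ (hF D)
    have h2 : sqfreeMul (fun _ => 4) D = ((D.divisors ×ˢ D.divisors).card : ℝ) := by
      rw [card_product, Nat.cast_mul, card_divisors_eq_sqfreeMul hD, sqfreeMul_mul_sqfreeMul]
      norm_num
    rw [h2, Nat.cast_le]
    refine card_le_card fun x hx => ?_
    rw [mem_product, Nat.mem_divisors, Nat.mem_divisors, ← (mem_filter.1 hx).2]
    have := (mem_filter.1 hx).2 ▸ hD.ne_zero
    exact ⟨⟨Nat.dvd_lcm_left _ _, this⟩, ⟨Nat.dvd_lcm_right _ _, this⟩⟩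
  · have h2 : ((Ioc 0 m).filter Squarefree ×ˢ (Ioc 0 m).filter Squarefree).filter
        (fun x => x.1.lcm x.2 = D) = ∅ := by
      refine filter_eq_empty_iff.2 fun x hx hxD => hD ?_
      rw [mem_product, mem_filter, mem_filter] at hx
      rw [← hxD]
      exact squarefree_lcm hx.1.2 hx.2.2
    rw [h2, card_empty, Nat.cast_zero, zero_mul]
    exact mul_nonneg (sqfreeMul_nonneg (fun _ _ => by norm_num) D) (hF D)

/-! ### Divisor sums of the discrepancies -/

/-- `c^{ω(D)} / φ(D)` is at most the divisor function of order `2c` divided by `D`, as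
`p - 1 ≥ p / 2`. -/
theorem sqfreeMul_div_totient_le (c D : ℕ) :
    sqfreeMul (fun _ => c) D / (D.totient : ℝ) ≤ (invArith ^ (2 * c)) D := by
  by_cases hD : Squarefree D
  swap
  · rw [sqfreeMul_apply, if_neg hD, zero_div]
    exact invArith_pow_nonneg _ _
  rw [eq_prod_primeFactors_of_squarefree (f := fun D => (invArith ^ (2 * c)) D)
    isMultiplicative_invArith.pow.1 (fun m n hmn => isMultiplicative_invArith.pow.2 hmn) hD,
    eq_prod_primeFactors_of_squarefree
      (f := fun D => sqfreeMul (fun _ => (c : ℝ)) D / (D.totient : ℝ))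
      (by simp [sqfreeMul_apply]) (fun m n hmn => by
        simp only [sqfreeMul_mul_of_coprime _ hmn, Nat.totient_mul hmn]
        push_cast
        rw [mul_div_mul_comm]) hD]
  have hc : (0 : ℝ) ≤ c := Nat.cast_nonneg c
  refine prod_le_prod (fun p hp => ?_) fun p hp => ?_
  · exact div_nonneg (sqfreeMul_nonneg (fun _ _ => hc) p) (Nat.cast_nonneg _)
  · have hp' := Nat.prime_of_mem_primeFactors hp
    have h2 : (2 : ℝ) ≤ p := by exact_mod_cast hp'.two_le
    rw [sqfreeMul_prime _ hp', Nat.totient_prime hp', invArith_pow_prime _ hp',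
      Nat.cast_sub hp'.one_le, div_le_div_iff₀ (by push_cast; linarith) (by linarith)]
    push_cast
    nlinarith

theorem sum_invArith_pow_le (c : ℕ) {X : ℕ} {x : ℝ} (hx : 1 ≤ x) (hX : (X : ℝ) ≤ x) :
    ∑ D ∈ Ioc 0 X, (invArith ^ c) D ≤ (1 + Real.log x) ^ c := by
  refine le_trans ?_ (rieszSum_invArith_pow_zero_le c (Real.log_nonneg hx))
  rw [rieszSum, Real.exp_log (by linarith)]
  simp only [pow_zero, Nat.factorial_zero, Nat.cast_one, div_one, mul_one]
  exact sum_le_sum_of_subset_of_nonneg (Ioc_subset_Ioc_right (Nat.le_floor hX))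
    fun D _ _ => invArith_pow_nonneg c D

theorem thetaStar_nonneg (y : ℝ) (a q : ℕ) : 0 ≤ thetaStar y a q :=
  sum_nonneg fun n _ => primeLog_nonneg n

theorem thetaStar_le {x y : ℝ} {q : ℕ} (hx : 1 ≤ x) (hy : y ∈ Set.Ioc 0 x) (hq : 0 < q)
    (hqx : (q : ℝ) ≤ x) (a : ℕ) : thetaStar y a q ≤ 3 * x / q * Real.log (2 * x) := by
  have hy0 := hy.1
  have hyx := hy.2
  have hq0 : (0 : ℝ) < q := by exact_mod_cast hq
  have hl : 0 ≤ Real.log (2 * x) := Real.log_nonneg (by linarith)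
  have h1 : (((Ioc ⌊y⌋₊ ⌊2 * y⌋₊).filter (fun n => n ≡ a [MOD q])).card : ℝ) ≤ 3 * x / q := by
    have h2 := Nat.Ioc_filter_modEq_card ⌊y⌋₊ ⌊2 * y⌋₊ hq a
    have h3 : ((((Ioc ⌊y⌋₊ ⌊2 * y⌋₊).filter (fun n => n ≡ a [MOD q])).card : ℤ) : ℚ) ≤
        ((⌊2 * y⌋₊ : ℚ) - ⌊y⌋₊) / q + 1 := by
      have hq' : (0 : ℚ) < q := by exact_mod_cast hq
      rw [h2, Int.cast_max]
      have hfl : (⌊y⌋₊ : ℚ) ≤ ⌊2 * y⌋₊ := by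
        exact_mod_cast Nat.floor_le_floor (show y ≤ 2 * y by linarith)
      refine max_le ?_ ?_
      · push_cast
        have e1 := Int.floor_le (((⌊2 * y⌋₊ : ℚ) - a) / q)
        have e2 := Int.lt_floor_add_one (((⌊y⌋₊ : ℚ) - a) / q)
        have e3 : ((⌊2 * y⌋₊ : ℚ) - ⌊y⌋₊) / q =
          ((⌊2 * y⌋₊ : ℚ) - a) / q - ((⌊y⌋₊ : ℚ) - a) / q := by ring
        linarith
      · have : 0 ≤ ((⌊2 * y⌋₊ : ℚ) - ⌊y⌋₊) / q := div_nonneg (by linarith) hq'.le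
        push_cast
        linarith
    have h4 : (((Ioc ⌊y⌋₊ ⌊2 * y⌋₊).filter (fun n => n ≡ a [MOD q])).card : ℝ) ≤
        ((⌊2 * y⌋₊ : ℝ) - ⌊y⌋₊) / q + 1 := by exact_mod_cast h3
    refine h4.trans ?_
    have e1 := Nat.floor_le (show 0 ≤ 2 * y by linarith)
    have e2 := Nat.lt_floor_add_one y
    rw [div_add_one hq0.ne', div_le_div_iff_of_pos_right hq0]
    linarith
  calc thetaStar y a q ≤
      ((Ioc ⌊y⌋₊ ⌊2 * y⌋₊).filter (fun n => n ≡ a [MOD q])).card • Real.log (2 * x) := by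
        refine sum_le_card_nsmul _ _ _ fun n hn => primeLog_le (by linarith) ?_
        have := (Nat.le_floor_iff (show 0 ≤ 2 * y by linarith)).1 (mem_Ioc.1 (mem_filter.1 hn).1).2
        linarith
    _ ≤ _ := by rw [nsmul_eq_mul]; gcongr

/-- The trivial bound for the discrepancy. -/
theorem maxDiscrepancy_le {x : ℝ} {q : ℕ} (hx : 1 ≤ x) (hq : 0 < q) (hqx : (q : ℝ) ≤ x) :
    maxDiscrepancy x q ≤
      ENNReal.ofReal (3 * x * (Real.log (2 * x) + 1) / (q.totient : ℝ)) := by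
  have hφ : (0 : ℝ) < q.totient := by exact_mod_cast Nat.totient_pos.2 hq
  have hφq : (q.totient : ℝ) ≤ q := by exact_mod_cast Nat.totient_le q
  have hl : 0 ≤ Real.log (2 * x) := Real.log_nonneg (by linarith)
  refine iSup₂_le fun y hy => iSup₂_le fun a _ => ENNReal.ofReal_le_ofReal ?_
  have h1 := thetaStar_le hx hy hq hqx a
  have h2 : 3 * x / q * Real.log (2 * x) ≤ 3 * x / (q.totient : ℝ) * Real.log (2 * x) := by gcongr
  have h3 : y / (q.totient : ℝ) ≤ 3 * x / (q.totient : ℝ) := by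
    have := hy.2
    gcongr
    linarith
  have h4 : 0 ≤ y / (q.totient : ℝ) := div_nonneg hy.1.le hφ.le
  have h5 : 0 ≤ 3 * x / (q.totient : ℝ) * Real.log (2 * x) := by positivity
  have h6 := thetaStar_nonneg y a q
  have e : 3 * x * (Real.log (2 * x) + 1) / (q.totient : ℝ) =
      3 * x / (q.totient : ℝ) * Real.log (2 * x) + 3 * x / (q.totient : ℝ) := by ring
  rw [e, abs_le]
  constructor <;> linarith

theorem LevelOfDistribution.exists_sum_toReal_le {θ : ℝ} (h : LevelOfDistribution θ) {A : ℕ}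
    (hA : 0 < A) :
    ∃ K : ℝ, 0 ≤ K ∧ ∀ x : ℝ, 2 ≤ x →
      ∑ q ∈ Icc 1 ⌊x ^ θ⌋₊, (maxDiscrepancy x q).toReal ≤ K * (x / Real.log x ^ A) := by
  obtain ⟨K, hK⟩ := h A (by exact_mod_cast hA)
  refine ⟨max K 0, le_max_right _ _, fun x hx => ?_⟩
  have hl : 0 < Real.log x := Real.log_pos (by linarith)
  have h1 := hK x hx
  rw [Real.rpow_natCast] at h1
  have h2 := h1.trans (ENNReal.ofReal_le_ofReal
    (mul_le_mul_of_nonneg_right (le_max_left K 0) (by positivity)))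
  rw [← ENNReal.toReal_sum fun q hq => ne_top_of_le_ne_top ENNReal.ofReal_ne_top
    ((single_le_sum (f := fun q => maxDiscrepancy x q) (fun _ _ => zero_le) hq).trans h1)]
  exact ENNReal.toReal_le_of_le_ofReal (by positivity) h2

/-- The discrepancies weighted by a divisor function: `c^{ω(D)} ≤ c^{2 ω(D)} / T + T`, where the
first term is treated with the trivial bound for the discrepancy and the second with the level of
distribution. -/
theorem sum_sqfreeMul_mul_maxDiscrepancy_le (c : ℕ) {N T : ℝ} (hN : 1 ≤ N) (hT : 0 < T) {X : ℕ}
    (hX : (X : ℝ) ≤ N) :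
    ∑ D ∈ Ioc 0 X, sqfreeMul (fun _ => c) D * (maxDiscrepancy (2 * N) D).toReal ≤
      6 * N * (Real.log (4 * N) + 1) * (1 + Real.log N) ^ (2 * c ^ 2) / T +
        T * ∑ D ∈ Ioc 0 X, (maxDiscrepancy (2 * N) D).toReal := by
  have hl : 0 ≤ Real.log (4 * N) := Real.log_nonneg (by linarith)
  have h1 : ∀ D ∈ Ioc 0 X, sqfreeMul (fun _ => c) D * (maxDiscrepancy (2 * N) D).toReal ≤
      6 * N * (Real.log (4 * N) + 1) / T * (invArith ^ (2 * c ^ 2)) D +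
        T * (maxDiscrepancy (2 * N) D).toReal := by
    intro D hD
    rw [mem_Ioc] at hD
    set E := (maxDiscrepancy (2 * N) D).toReal with hE
    have hE0 : 0 ≤ E := ENNReal.toReal_nonneg
    have hDX : (D : ℝ) ≤ X := by exact_mod_cast hD.2
    have hE1 : E ≤ 6 * N * (Real.log (4 * N) + 1) / (D.totient : ℝ) := by
      have h := ENNReal.toReal_le_of_le_ofReal (by
        rw [show 2 * (2 * N) = 4 * N by ring]; positivity)
        (maxDiscrepancy_le (x := 2 * N) (by linarith) hD.1 (by linarith))
      rw [show 2 * (2 * N) = 4 * N by ring, show 3 * (2 * N) = 6 * N by ring] at h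
      exact h
    set s := sqfreeMul (fun _ => (c : ℝ)) D with hs
    have hs2 : s ^ 2 = sqfreeMul (fun _ => ((c ^ 2 : ℕ) : ℝ)) D := by
      rw [sq, hs, sqfreeMul_mul_sqfreeMul]
      simp only [sq, Nat.cast_mul]
    have h2 : s ≤ s ^ 2 / T + T := by
      rw [div_add' _ _ _ hT.ne', le_div_iff₀ hT]
      nlinarith [sq_nonneg (s - T), sq_nonneg (s + T)]
    have h3 : s ^ 2 * E ≤ 6 * N * (Real.log (4 * N) + 1) * (invArith ^ (2 * c ^ 2)) D := by
      calc s ^ 2 * E ≤ s ^ 2 * (6 * N * (Real.log (4 * N) + 1) / (D.totient : ℝ)) := by gcongr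
        _ = 6 * N * (Real.log (4 * N) + 1) * (s ^ 2 / (D.totient : ℝ)) := by ring
        _ ≤ _ := by
            rw [hs2]
            exact mul_le_mul_of_nonneg_left (sqfreeMul_div_totient_le _ _) (by positivity)
    calc s * E ≤ (s ^ 2 / T + T) * E := by gcongr
      _ = s ^ 2 * E / T + T * E := by ring
      _ ≤ 6 * N * (Real.log (4 * N) + 1) * (invArith ^ (2 * c ^ 2)) D / T + T * E := by gcongr
      _ = _ := by ring
  refine (sum_le_sum h1).trans ?_
  rw [sum_add_distrib, ← mul_sum, ← mul_sum]
  have h2 := sum_invArith_pow_le (2 * c ^ 2) hN hX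
  have e : 6 * N * (Real.log (4 * N) + 1) * (1 + Real.log N) ^ (2 * c ^ 2) / T =
    6 * N * (Real.log (4 * N) + 1) / T * (1 + Real.log N) ^ (2 * c ^ 2) := by ring
  rw [e]
  gcongr

theorem sum_sqfreeMul_const_le (c : ℕ) {x : ℝ} (hx : 1 ≤ x) {X : ℕ} (hX : (X : ℝ) ≤ x) :
    ∑ D ∈ Ioc 0 X, sqfreeMul (fun _ => (c : ℝ)) D ≤ X * (1 + Real.log x) ^ (2 * c) := by
  refine le_trans ?_ (mul_le_mul_of_nonneg_left (sum_invArith_pow_le (2 * c) hx hX)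
    (Nat.cast_nonneg X))
  rw [mul_sum]
  refine sum_le_sum fun D hD => ?_
  rw [mem_Ioc] at hD
  have hφ : (0 : ℝ) < D.totient := by exact_mod_cast Nat.totient_pos.2 hD.1
  have hφX : (D.totient : ℝ) ≤ X := by exact_mod_cast (Nat.totient_le D).trans hD.2
  have h1 := sqfreeMul_div_totient_le c D
  rw [div_le_iff₀ hφ, mul_comm] at h1
  exact h1.trans (mul_le_mul_of_nonneg_right hφX (invArith_pow_nonneg _ _))

/-! ### Reduction to the quadratic form -/

theorem sum_sieveWeight_mul_eq (R : ℝ) (a m : ℕ) (G : ℕ → ℝ) :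
    ∑ d₁ ∈ Ioc 0 m, ∑ d₂ ∈ Ioc 0 m, sieveWeight R d₁ a * sieveWeight R d₂ a * G (d₁.lcm d₂) =
      ∑ d₁ ∈ (Ioc 0 m).filter Squarefree, ∑ d₂ ∈ (Ioc 0 m).filter Squarefree,
        sieveWeight R d₁ a * sieveWeight R d₂ a * G (d₁.lcm d₂) := by
  rw [sum_filter]
  refine sum_congr rfl fun d₁ _ => ?_
  split_ifs with h1
  · rw [sum_filter]
    refine sum_congr rfl fun d₂ _ => ?_
    split_ifs with h2
    · rfl
    · rw [sieveWeight_of_not_squarefree R a h2, mul_zero, zero_mul]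
  · simp [sieveWeight_of_not_squarefree R a h1]

theorem abs_twistedSum_sub_le_sum {N R : ℝ} (hR : 1 ≤ R) (hRN : R ≤ N) {𝓗 : Finset ℕ} {h κ : ℕ}
    (hhN : (h : ℝ) ≤ N) (hκ : (insert h 𝓗).card = κ + 1) (a : ℕ)
    (hE : ∀ D ∈ Ioc 0 (⌊R⌋₊ * ⌊R⌋₊), maxDiscrepancy (2 * N) D ≠ ⊤) :
    |twistedSum N R 𝓗 h a - N * ∑ d₁ ∈ Ioc 0 ⌊R⌋₊, ∑ d₂ ∈ Ioc 0 ⌊R⌋₊,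
        sieveWeight R d₁ a * sieveWeight R d₂ a *
          sqfreeMul (localDensity (insert h 𝓗)) (d₁.lcm d₂)| ≤
      Real.log R ^ (2 * a) * ∑ D ∈ Ioc 0 (⌊R⌋₊ * ⌊R⌋₊), sqfreeMul (fun _ => ((4 * κ : ℕ) : ℝ)) D *
        ((maxDiscrepancy (2 * N) D).toReal + h * (Real.log (4 * N) + 1)) := by
  have hN : 1 ≤ N := hR.trans hRN
  have hL : 0 ≤ Real.log R := Real.log_nonneg hR
  have hl : 0 ≤ Real.log (4 * N) := Real.log_nonneg (by linarith)
  set W : ℕ → ℝ := fun D => (maxDiscrepancy (2 * N) D).toReal + h * (Real.log (4 * N) + 1) with hW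
  have hW0 : ∀ D, 0 ≤ W D := fun D =>
    add_nonneg ENNReal.toReal_nonneg (mul_nonneg (Nat.cast_nonneg h) (by linarith))
  set F : ℕ → ℝ := fun D => sqfreeMul (fun _ => (κ : ℝ)) D * W D with hF
  have hF0 : ∀ D, 0 ≤ F D := fun D =>
    mul_nonneg (sqfreeMul_nonneg (fun _ _ => Nat.cast_nonneg κ) D) (hW0 D)
  set G : ℕ → ℝ := fun D =>
    ∑ n ∈ Ioc ⌊N⌋₊ ⌊2 * N⌋₊, (if D ∣ tuplePoly n 𝓗 then primeLog (n + h) else 0) -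
      N * sqfreeMul (localDensity (insert h 𝓗)) D with hG
  have e1 : twistedSum N R 𝓗 h a - N * ∑ d₁ ∈ Ioc 0 ⌊R⌋₊, ∑ d₂ ∈ Ioc 0 ⌊R⌋₊,
        sieveWeight R d₁ a * sieveWeight R d₂ a *
          sqfreeMul (localDensity (insert h 𝓗)) (d₁.lcm d₂) =
      ∑ d₁ ∈ Ioc 0 ⌊R⌋₊, ∑ d₂ ∈ Ioc 0 ⌊R⌋₊,
        sieveWeight R d₁ a * sieveWeight R d₂ a * G (d₁.lcm d₂) := by
    rw [twistedSum_eq_sum_lcm, mul_sum, ← sum_sub_distrib]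
    refine sum_congr rfl fun d₁ _ => ?_
    rw [mul_sum, ← sum_sub_distrib]
    refine sum_congr rfl fun d₂ _ => ?_
    simp only [hG]
    ring
  have hGF : ∀ d₁ ∈ (Ioc 0 ⌊R⌋₊).filter Squarefree, ∀ d₂ ∈ (Ioc 0 ⌊R⌋₊).filter Squarefree,
      |sieveWeight R d₁ a * sieveWeight R d₂ a * G (d₁.lcm d₂)| ≤
        Real.log R ^ (2 * a) * F (d₁.lcm d₂) := by
    intro d₁ hd₁ d₂ hd₂
    rw [mem_filter, mem_Ioc] at hd₁ hd₂
    have hs := squarefree_lcm hd₁.2 hd₂.2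
    have hp : ∀ p ∈ (d₁.lcm d₂).primeFactors, (p : ℝ) ≤ N := by
      intro p hp
      have hpp := Nat.prime_of_mem_primeFactors hp
      have hpm : p ≤ ⌊R⌋₊ := by
        rcases (hpp.dvd_lcm).1 (Nat.dvd_of_mem_primeFactors hp) with h1 | h1
        · exact (Nat.le_of_dvd hd₁.1.1 h1).trans hd₁.1.2
        · exact (Nat.le_of_dvd hd₂.1.1 h1).trans hd₂.1.2
      exact ((Nat.le_floor_iff (by linarith)).1 hpm).trans hRN
    have hmem : d₁.lcm d₂ ∈ Ioc 0 (⌊R⌋₊ * ⌊R⌋₊) := mem_Ioc.2 ⟨Nat.lcm_pos hd₁.1.1 hd₂.1.1,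
      (Nat.div_le_self _ _).trans (Nat.mul_le_mul hd₁.1.2 hd₂.1.2)⟩
    have h1 : |G (d₁.lcm d₂)| ≤ F (d₁.lcm d₂) := by
      refine (abs_sum_primeLog_dvd_tuplePoly_sub_le hN 𝓗 hhN hs hp (hE _ hmem)).trans ?_
      refine mul_le_mul_of_nonneg_right ?_ (hW0 _)
      rw [sqfreeMul_apply, if_pos hs]
      exact classCount_le hκ hs
    rw [abs_mul, abs_mul]
    calc _ ≤ Real.log R ^ a * Real.log R ^ a * F (d₁.lcm d₂) := by
          have := abs_sieveWeight_le hR hd₁.1.1 a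
          have := abs_sieveWeight_le hR hd₂.1.1 a
          gcongr
      _ = _ := by rw [two_mul, pow_add]
  rw [e1, sum_sieveWeight_mul_eq]
  refine (abs_sum_le_sum_abs _ _).trans ?_
  calc _ ≤ ∑ d₁ ∈ (Ioc 0 ⌊R⌋₊).filter Squarefree, ∑ d₂ ∈ (Ioc 0 ⌊R⌋₊).filter Squarefree,
        Real.log R ^ (2 * a) * F (d₁.lcm d₂) :=
        sum_le_sum fun d₁ hd₁ => (abs_sum_le_sum_abs _ _).trans
          (sum_le_sum fun d₂ hd₂ => hGF d₁ hd₁ d₂ hd₂)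
    _ = Real.log R ^ (2 * a) * ∑ d₁ ∈ (Ioc 0 ⌊R⌋₊).filter Squarefree,
          ∑ d₂ ∈ (Ioc 0 ⌊R⌋₊).filter Squarefree, F (d₁.lcm d₂) := by simp_rw [mul_sum]
    _ ≤ Real.log R ^ (2 * a) *
          ∑ D ∈ Ioc 0 (⌊R⌋₊ * ⌊R⌋₊), sqfreeMul (fun _ => 4) D * F D := by
        gcongr
        exact sum_lcm_le hF0 _
    _ = _ := by
        congr 1
        refine sum_congr rfl fun D _ => ?_
        simp only [hF]
        rw [← mul_assoc, sqfreeMul_mul_sqfreeMul]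
        push_cast
        rfl

/-- Under the level of distribution hypothesis the twisted sum is `N` times a quadratic form in the
sieve weights, up to `O(N)`. -/
theorem exists_abs_twistedSum_sub_le {θ : ℝ} (hθ0 : 0 < θ) (hθ : θ < 1)
    (hdist : LevelOfDistribution θ) (κ a : ℕ) {K₁ : ℝ} (hK₁ : 0 < K₁) :
    ∃ M N₀ : ℝ, 0 ≤ M ∧ ∀ (N R : ℝ) (𝓗 : Finset ℕ) (h : ℕ), N₀ ≤ N → 1 ≤ R → R ≤ N ^ (θ / 2) →
      (h : ℝ) ≤ K₁ * Real.log N → (insert h 𝓗).card = κ + 1 →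
      |twistedSum N R 𝓗 h a - N * ∑ d₁ ∈ Ioc 0 ⌊R⌋₊, ∑ d₂ ∈ Ioc 0 ⌊R⌋₊,
        sieveWeight R d₁ a * sieveWeight R d₂ a *
          sqfreeMul (localDensity (insert h 𝓗)) (d₁.lcm d₂)| ≤ M * N := by
  -- `c^{ω(D)}` bounds the number of triples of `d₁`, `d₂` and a class modulo `D = lcm(d₁, d₂)`. The
  -- power `m` of the logarithm is the one lost to the divisor sums, and `A` recovers it.
  set c := 4 * κ with hc
  set m := 2 * a + 1 + 2 * c ^ 2 with hm
  set A := 2 * a + m with hA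
  obtain ⟨K, hK0, hK⟩ := hdist.exists_sum_toReal_le (A := A) (by omega)
  obtain ⟨Kd, hKd⟩ := hdist 1 one_pos
  -- The contribution of the shift by `h` is at most `N ^ θ` times a power of `log N`.
  obtain ⟨N₁, hN₁⟩ : ∃ N₁ : ℝ, ∀ N, N₁ ≤ N →
      (Real.log (4 * N) + 1) ^ (2 * a + 2 + 2 * c) ≤ N ^ (1 - θ) ∧
        K₁ * Real.log N ≤ N ∧ 4 ≤ N := by
    have hlog : Filter.Tendsto (fun N : ℝ => 4 * N) Filter.atTop Filter.atTop :=
      Filter.tendsto_id.const_mul_atTop (by norm_num)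
    have h1 := ((isLittleO_log_rpow_rpow_atTop ((2 * a + 2 + 2 * c : ℕ) : ℝ)
      (sub_pos.2 hθ)).bound (show (0 : ℝ) < 1 / (2 ^ (2 * a + 2 + 2 * c) * 4 ^ (1 - θ)) by
        positivity))
    have h1' := hlog.eventually h1
    have h2 := Real.isLittleO_log_id_atTop.bound (show (0 : ℝ) < 1 / K₁ by positivity)
    obtain ⟨N₁, hN₁⟩ := Filter.eventually_atTop.1
      (h1'.and (h2.and (Filter.eventually_ge_atTop 4)))
    refine ⟨N₁, fun N hN => ?_⟩
    obtain ⟨e1, e2, e3⟩ := hN₁ N hN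
    have hl1 : 1 ≤ Real.log (4 * N) := by
      rw [Real.le_log_iff_exp_le (by linarith)]
      linarith [Real.exp_one_lt_d9]
    refine ⟨?_, ?_, e3⟩
    · rw [Real.norm_of_nonneg (by positivity), Real.norm_of_nonneg (by positivity),
        Real.rpow_natCast, Real.mul_rpow (by norm_num) (by linarith)] at e1
      calc (Real.log (4 * N) + 1) ^ (2 * a + 2 + 2 * c)
          ≤ (2 * Real.log (4 * N)) ^ (2 * a + 2 + 2 * c) := by gcongr; linarith
        _ = 2 ^ (2 * a + 2 + 2 * c) * Real.log (4 * N) ^ (2 * a + 2 + 2 * c) := mul_pow _ _ _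
        _ ≤ 2 ^ (2 * a + 2 + 2 * c) *
            (1 / (2 ^ (2 * a + 2 + 2 * c) * 4 ^ (1 - θ)) * (4 ^ (1 - θ) * N ^ (1 - θ))) := by
            gcongr
        _ = N ^ (1 - θ) := by field_simp
    · have hlN : 0 ≤ Real.log N := Real.log_nonneg (by linarith)
      rw [Real.norm_of_nonneg hlN, id, Real.norm_of_nonneg (by linarith)] at e2
      calc _ ≤ K₁ * (1 / K₁ * N) := by gcongr
        _ = N := by field_simp
  refine ⟨6 + 2 * K * 3 ^ A + K₁, N₁, by positivity, ?_⟩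
  intro N R 𝓗 h hN hR hRN hh hκ
  obtain ⟨hpow, hKN, hN4⟩ := hN₁ N hN
  have hN0 : 0 < N := by linarith
  have hRN' : R ≤ N := hRN.trans (Real.rpow_le_self_of_one_le (by linarith) (by linarith))
  set X := ⌊R⌋₊ * ⌊R⌋₊ with hX
  have hXθ : (X : ℝ) ≤ N ^ θ := by
    have hf := Nat.floor_le (show 0 ≤ R by linarith)
    rw [hX]
    push_cast
    calc (⌊R⌋₊ : ℝ) * ⌊R⌋₊ ≤ N ^ (θ / 2) * N ^ (θ / 2) := by
          have := hf.trans hRN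
          gcongr
      _ = N ^ θ := by rw [← Real.rpow_add hN0, add_halves]
  have hXN : (X : ℝ) ≤ N :=
    hXθ.trans (Real.rpow_le_self_of_one_le (by linarith) hθ.le)
  have hsub : Ioc 0 X ⊆ Icc 1 ⌊(2 * N) ^ θ⌋₊ := by
    intro D hD
    rw [mem_Ioc] at hD
    refine mem_Icc.2 ⟨hD.1, Nat.le_floor ?_⟩
    calc (D : ℝ) ≤ X := by exact_mod_cast hD.2
      _ ≤ N ^ θ := hXθ
      _ ≤ (2 * N) ^ θ := Real.rpow_le_rpow hN0.le (by linarith) hθ0.le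
  have hE : ∀ D ∈ Ioc 0 X, maxDiscrepancy (2 * N) D ≠ ⊤ := fun D hD =>
    ne_top_of_le_ne_top ENNReal.ofReal_ne_top
      ((single_le_sum (f := fun q => maxDiscrepancy (2 * N) q) (fun _ _ => zero_le)
        (hsub hD)).trans (hKd (2 * N) (by linarith)))
  refine (abs_twistedSum_sub_le_sum hR hRN' (hh.trans hKN) hκ a hE).trans ?_
  set ℒ := Real.log (4 * N) + 1 with hℒ
  have hlN : 0 ≤ Real.log N := Real.log_nonneg (by linarith)
  have hlR : 0 ≤ Real.log R := Real.log_nonneg hR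
  have hl4 : Real.log N ≤ Real.log (4 * N) := Real.log_le_log hN0 (by linarith)
  have hℒ1 : 1 ≤ ℒ := by linarith
  have hℒ0 : 0 < ℒ := by linarith
  have hRℒ : Real.log R ≤ ℒ := (Real.log_le_log (by linarith) hRN').trans (by linarith)
  have hNℒ : 1 + Real.log N ≤ ℒ := by linarith
  have hℒ3 : ℒ ≤ 3 * Real.log (2 * N) := by
    have e : Real.log (4 * N) = Real.log 2 + Real.log (2 * N) := by
      rw [← Real.log_mul (by norm_num) (by linarith)]; congr 1; ring
    have h2 : 1 ≤ Real.log (2 * N) := by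
      rw [Real.le_log_iff_exp_le (by linarith)]
      linarith [Real.exp_one_lt_d9]
    linarith [Real.log_two_lt_d9]
  have hsumE : ∑ D ∈ Ioc 0 X, (maxDiscrepancy (2 * N) D).toReal ≤ 2 * K * 3 ^ A * (N / ℒ ^ A) := by
    refine (sum_le_sum_of_subset_of_nonneg hsub fun _ _ _ => ENNReal.toReal_nonneg).trans
      ((hK (2 * N) (by linarith)).trans ?_)
    have h1 : ℒ ^ A ≤ 3 ^ A * Real.log (2 * N) ^ A := by
      rw [← mul_pow]; gcongr
    have h2 : 0 < Real.log (2 * N) := by linarith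
    have h3 : 2 * N / Real.log (2 * N) ^ A ≤ 2 * 3 ^ A * (N / ℒ ^ A) := by
      rw [← mul_div_assoc, div_le_div_iff₀ (by positivity) (by positivity)]
      calc 2 * N * ℒ ^ A ≤ 2 * N * (3 ^ A * Real.log (2 * N) ^ A) := by gcongr
        _ = _ := by ring
    calc _ ≤ K * (2 * 3 ^ A * (N / ℒ ^ A)) := by gcongr
      _ = _ := by ring
  have h1 : ∑ D ∈ Ioc 0 X, sqfreeMul (fun _ => (c : ℝ)) D * (maxDiscrepancy (2 * N) D).toReal ≤
      (6 + 2 * K * 3 ^ A) * N / ℒ ^ (2 * a) := by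
    refine (sum_sqfreeMul_mul_maxDiscrepancy_le c (T := ℒ ^ m) (by linarith) (by positivity)
      hXN).trans ?_
    have e1 : 6 * N * ℒ * (1 + Real.log N) ^ (2 * c ^ 2) / ℒ ^ m ≤ 6 * N / ℒ ^ (2 * a) := by
      calc _ ≤ 6 * N * ℒ * ℒ ^ (2 * c ^ 2) / ℒ ^ m := by gcongr
        _ = _ := by
            rw [hm, pow_add, pow_add, pow_one]
            field_simp
    have e2 : ℒ ^ m * ∑ D ∈ Ioc 0 X, (maxDiscrepancy (2 * N) D).toReal ≤
        2 * K * 3 ^ A * N / ℒ ^ (2 * a) := by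
      calc _ ≤ ℒ ^ m * (2 * K * 3 ^ A * (N / ℒ ^ A)) := by gcongr
        _ = _ := by
            rw [hA, pow_add ℒ (2 * a) m]
            field_simp
    refine (add_le_add e1 e2).trans (le_of_eq ?_)
    ring
  have h2 : ∑ D ∈ Ioc 0 X, sqfreeMul (fun _ => (c : ℝ)) D * (h * ℒ) ≤ K₁ * N / ℒ ^ (2 * a) := by
    rw [← sum_mul]
    calc _ ≤ (X * (1 + Real.log N) ^ (2 * c)) * ((K₁ * Real.log N) * ℒ) := by
          gcongr
          exact sum_sqfreeMul_const_le c (by linarith) hXN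
      _ ≤ (N ^ θ * ℒ ^ (2 * c)) * ((K₁ * ℒ) * ℒ) := by
          gcongr
          linarith
      _ = K₁ * (N ^ θ * ℒ ^ (2 * a + 2 + 2 * c)) / ℒ ^ (2 * a) := by
          rw [pow_add, pow_add]
          field_simp
      _ ≤ K₁ * (N ^ θ * N ^ (1 - θ)) / ℒ ^ (2 * a) := by gcongr
      _ = _ := by rw [← Real.rpow_add hN0]; simp
  have h3 : ∑ D ∈ Ioc 0 X, sqfreeMul (fun _ => (c : ℝ)) D *
      ((maxDiscrepancy (2 * N) D).toReal + h * ℒ) ≤ (6 + 2 * K * 3 ^ A + K₁) * N / ℒ ^ (2 * a) := by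
    simp_rw [mul_add]
    rw [sum_add_distrib]
    refine (add_le_add h1 h2).trans (le_of_eq ?_)
    ring
  have hs0 : 0 ≤ (6 + 2 * K * 3 ^ A + K₁) * N / ℒ ^ (2 * a) := by positivity
  calc _ ≤ ℒ ^ (2 * a) * ((6 + 2 * K * 3 ^ A + K₁) * N / ℒ ^ (2 * a)) := by
        refine mul_le_mul (by gcongr) h3 (sum_nonneg fun D _ => ?_) (by positivity)
        exact mul_nonneg (sqfreeMul_nonneg (fun _ _ => Nat.cast_nonneg _) D)
          (add_nonneg ENNReal.toReal_nonneg (by positivity))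
    _ = _ := by field_simp

/-! ### The asymptotic formula -/

/-- The asymptotic formula in terms of the tuple `insert h 𝓗`, of cardinality `κ + 1`; the cases
`h ∉ 𝓗` and `h ∈ 𝓗` correspond to `(κ, b) = (k, ℓ)` and `(κ, b) = (k - 1, ℓ + 1)`. -/
theorem exists_abs_twistedSum_sub_singularSeries_le (κ : ℕ) {b : ℕ} (hb : 1 ≤ b) :
    ∃ B : ℕ, ∀ θ : ℝ, 0 < θ → θ < 1 → LevelOfDistribution θ → ∀ K₁ K₂ : ℝ, 0 < K₁ → 0 < K₂ →
      ∃ M N₀ : ℝ, 0 ≤ M ∧ Real.exp (Real.exp 1) ≤ N₀ ∧ ∀ (N R : ℝ) (𝓗 : Finset ℕ) (h : ℕ),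
        N₀ ≤ N → 0 < R → Real.log N ≤ K₂ * Real.log R → Real.log R ≤ Real.log N →
        R ≤ N ^ (θ / 2) / Real.log N → (insert h 𝓗).card = κ + 1 →
        (∀ h' ∈ insert h 𝓗, (h' : ℝ) ≤ K₁ * Real.log N) →
        |twistedSum N R 𝓗 h (κ + b) - singularSeries (insert h 𝓗) / ((κ + 2 * b)! : ℝ) *
            ((2 * b).choose b : ℝ) * N * Real.log R ^ (κ + 2 * b)| ≤
          M * (N * Real.log N ^ (κ + 2 * b - 1) * Real.log (Real.log N) ^ B) := by
  obtain ⟨B, hB⟩ := exists_abs_sum_sieveWeight_lcm_sub_le κ hb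
  refine ⟨B, fun θ hθ0 hθ1 hdist K₁ K₂ hK₁ hK₂ => ?_⟩
  obtain ⟨C, hC0, hC⟩ := exists_abs_rieszSum_moebiusDiv_pow_sub_le hθ0 hdist κ hb
  obtain ⟨M₂, hM₂, hquad⟩ := hB C hC0 hC
  obtain ⟨M₁, N₁, hM₁, hred⟩ := exists_abs_twistedSum_sub_le hθ0 hθ1 hdist κ (κ + b) hK₁
  set e := κ + 2 * b - 1 with he
  set T := max (K₁ + 1) (max (2 * ((κ : ℝ) + 1)) (Real.exp 4)) with hT
  refine ⟨M₁ + M₂ * 2 ^ B * 2 ^ e, max N₁ (Real.exp T), by positivity, ?_, ?_⟩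
  · refine le_max_of_le_right (Real.exp_le_exp.2 ?_)
    exact (Real.exp_le_exp.2 (by norm_num)).trans ((le_max_right _ _).trans (le_max_right _ _))
  intro N R 𝓗 h hN hR0 hNR hRN hR hκ hle
  have hN0 : 0 < N := (Real.exp_pos T).trans_le ((le_max_right _ _).trans hN)
  have hTN : T ≤ Real.log N := (Real.le_log_iff_exp_le hN0).2 ((le_max_right _ _).trans hN)
  have hN1 : N₁ ≤ N := (le_max_left _ _).trans hN
  have hl1 : K₁ + 1 ≤ Real.log N := (le_max_left _ _).trans hTN
  have hl2 : 2 * ((κ : ℝ) + 1) ≤ Real.log N :=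
    ((le_max_left _ _).trans (le_max_right _ _)).trans hTN
  have hl3 : Real.exp 4 ≤ Real.log N := ((le_max_right _ _).trans (le_max_right _ _)).trans hTN
  have hl0 : 1 ≤ Real.log N := by linarith
  have hlR : 0 ≤ Real.log R := by
    by_contra! hneg
    nlinarith
  have hR1 : 1 ≤ R := by
    by_contra! hlt
    have := Real.log_neg hR0 hlt
    linarith
  have hll : 4 ≤ Real.log (Real.log N) := (Real.le_log_iff_exp_le (by linarith)).2 hl3
  -- `e^v` bounds `log R` and all elements of the tuple, while still `v ≤ 2 log log N`.
  set v := Real.log ((K₁ + 1) * Real.log N) with hv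
  have hev : Real.exp v = (K₁ + 1) * Real.log N := Real.exp_log (by positivity)
  have hlev : Real.log N ≤ Real.exp v := by rw [hev]; nlinarith
  have hv4 : 4 ≤ v := hll.trans ((Real.log_le_iff_le_exp (by linarith)).2 hlev)
  have hv2 : v ≤ 2 * Real.log (Real.log N) := by
    rw [hv, two_mul, ← Real.log_mul (by linarith) (by linarith)]
    exact Real.log_le_log (by positivity) (by gcongr)
  have hq := hquad v R (insert h 𝓗) hv4 (hl2.trans hlev) hκ
    (fun h' hh' => (hle h' hh').trans (by rw [hev]; nlinarith)) hR1 (hRN.trans hlev)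
  have hr := hred N R 𝓗 h hN1 hR1 (hR.trans (div_le_self (by positivity) hl0))
    (hle h (mem_insert_self _ _)) hκ
  set Q := ∑ d₁ ∈ Ioc 0 ⌊R⌋₊, ∑ d₂ ∈ Ioc 0 ⌊R⌋₊, sieveWeight R d₁ (κ + b) *
    sieveWeight R d₂ (κ + b) * sqfreeMul (localDensity (insert h 𝓗)) (d₁.lcm d₂) with hQ
  have hmain : |N * Q - singularSeries (insert h 𝓗) / ((κ + 2 * b)! : ℝ) *
      ((2 * b).choose b : ℝ) * N * Real.log R ^ (κ + 2 * b)| ≤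
      N * (M₂ * (2 * Real.log (Real.log N)) ^ B * (2 * Real.log N) ^ e) := by
    have e1 : N * Q - singularSeries (insert h 𝓗) / ((κ + 2 * b)! : ℝ) *
        ((2 * b).choose b : ℝ) * N * Real.log R ^ (κ + 2 * b) =
        N * (Q - singularSeries (insert h 𝓗) * ((2 * b).choose b : ℝ) *
          (Real.log R ^ (κ + 2 * b) / ((κ + 2 * b)! : ℝ))) := by ring
    rw [e1, abs_mul, abs_of_pos hN0]
    refine mul_le_mul_of_nonneg_left (hq.trans ?_) hN0.le
    gcongr
    linarith
  have hone : M₁ * N ≤ M₁ * (N * Real.log N ^ e * Real.log (Real.log N) ^ B) := by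
    refine mul_le_mul_of_nonneg_left ?_ hM₁
    rw [mul_assoc]
    exact le_mul_of_one_le_right hN0.le
      (one_le_mul_of_one_le_of_one_le (one_le_pow₀ hl0) (one_le_pow₀ (by linarith)))
  refine (abs_sub_le _ _ _).trans ((add_le_add (hr.trans hone) hmain).trans (le_of_eq ?_))
  rw [mul_pow, mul_pow]
  ring

end GMPY

theorem lemma2 (k ℓ : ℕ) (hk : 0 < k) (hℓ : 0 < ℓ) :
    ∃ C : ℝ, 0 < C ∧ ∃ c : ℝ, 0 < c ∧
      ∀ θ : ℝ, 0 < θ → θ < 1 → GMPY.LevelOfDistribution θ →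
      ∀ K₁ K₂ : ℝ, 0 < K₁ → 0 < K₂ →
      ∃ M N₀ : ℝ, ∀ N H R : ℝ, N₀ ≤ N → 0 < R →
        H ≤ K₁ * Real.log N → Real.log N ≤ K₂ * Real.log R → Real.log R ≤ Real.log N →
        R ≤ N ^ (θ / 2) / (Real.log N) ^ C →
        ∀ 𝓗 : Finset ℕ, 𝓗.card = k → (∀ h' ∈ 𝓗, 1 ≤ h' ∧ (h' : ℝ) ≤ H) →
          GMPY.Admissible 𝓗 →
        ∀ h : ℕ, 1 ≤ h → (h : ℝ) ≤ H →
          (h ∉ 𝓗 →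
            |GMPY.twistedSum N R 𝓗 h (k + ℓ) -
                GMPY.singularSeries (insert h 𝓗) / ((k + 2 * ℓ).factorial : ℝ) *
                  ((2 * ℓ).choose ℓ : ℝ) * N * (Real.log R) ^ (k + 2 * ℓ)| ≤
              M * (N * (Real.log N) ^ (k + 2 * ℓ - 1) * (Real.log (Real.log N)) ^ c)) ∧
          (h ∈ 𝓗 →
            |GMPY.twistedSum N R 𝓗 h (k + ℓ) -
                GMPY.singularSeries 𝓗 / ((k + 2 * ℓ + 1).factorial : ℝ) *
                  ((2 * (ℓ + 1)).choose (ℓ + 1) : ℝ) * N *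
                  (Real.log R) ^ (k + 2 * ℓ + 1)| ≤
              M * (N * (Real.log N) ^ (k + 2 * ℓ) * (Real.log (Real.log N)) ^ c)) := by
  obtain ⟨κ, rfl⟩ : ∃ κ, k = κ + 1 := ⟨k - 1, by omega⟩
  obtain ⟨B₁, hB₁⟩ := GMPY.exists_abs_twistedSum_sub_singularSeries_le (κ + 1) (b := ℓ) hℓ
  obtain ⟨B₂, hB₂⟩ := GMPY.exists_abs_twistedSum_sub_singularSeries_le κ (b := ℓ + 1) (by omega)
  -- Only `R ^ 2 ≤ N ^ θ` is needed, so any exponent `C > 0` serves.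
  refine ⟨1, one_pos, ((B₁ + B₂ + 1 : ℕ) : ℝ), by positivity, ?_⟩
  intro θ hθ0 hθ1 hdist K₁ K₂ hK₁ hK₂
  obtain ⟨M₁, N₁, hM₁, hN₁, h1⟩ := hB₁ θ hθ0 hθ1 hdist K₁ K₂ hK₁ hK₂
  obtain ⟨M₂, N₂, hM₂, hN₂, h2⟩ := hB₂ θ hθ0 hθ1 hdist K₁ K₂ hK₁ hK₂
  refine ⟨max M₁ M₂, max N₁ N₂, ?_⟩
  intro N H R hN hR0 hH hNR hRN hR 𝓗 hcard h𝓗 _ h _ hh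
  rw [Real.rpow_one] at hR
  have hN0 : 0 < N := (Real.exp_pos _).trans_le (hN₁.trans ((le_max_left _ _).trans hN))
  have hl : Real.exp 1 ≤ Real.log N :=
    (Real.le_log_iff_exp_le hN0).2 (hN₁.trans ((le_max_left _ _).trans hN))
  have hl0 : 0 < Real.log N := (Real.exp_pos 1).trans_le hl
  have hll : 1 ≤ Real.log (Real.log N) := (Real.le_log_iff_exp_le hl0).2 hl
  have hpow : ∀ {B : ℕ}, B ≤ B₁ + B₂ + 1 → Real.log (Real.log N) ^ B ≤
      Real.log (Real.log N) ^ ((B₁ + B₂ + 1 : ℕ) : ℝ) := fun hB => by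
    rw [Real.rpow_natCast]
    exact pow_le_pow_right₀ hll hB
  have hle : ∀ h' ∈ insert h 𝓗, (h' : ℝ) ≤ K₁ * Real.log N := by
    intro h' hh'
    rcases Finset.mem_insert.1 hh' with rfl | hh'
    · exact hh.trans hH
    · exact (h𝓗 h' hh').2.trans hH
  constructor
  · intro hmem
    refine (h1 N R 𝓗 h ((le_max_left _ _).trans hN) hR0 hNR hRN hR
      (by rw [Finset.card_insert_of_notMem hmem, hcard]) hle).trans ?_
    gcongr
    · exact le_max_left _ _
    · exact hpow (by omega)
  · intro hmem
    have hins : insert h 𝓗 = 𝓗 := Finset.insert_eq_of_mem hmem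
    have h3 := h2 N R 𝓗 h ((le_max_right _ _).trans hN) hR0 hNR hRN hR
      (by rw [hins, hcard]) hle
    rw [hins, show κ + (ℓ + 1) = κ + 1 + ℓ by omega,
      show κ + 2 * (ℓ + 1) = κ + 1 + 2 * ℓ + 1 by omega, Nat.add_sub_cancel] at h3
    refine h3.trans ?_
    gcongr
    · exact le_max_right _ _
    · exact hpow (by omega)
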